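/- **Setting.** Let $c:\mathbb R\to\mathbb R$ be smooth with $c(u)\ge c_0>0$, and consider $u_{tt}-c(u)(c(u)u_x)_x=0$. For data $(u_0,u_1)\in H^1(\mathbb R)\times L^2(\mathbb R)$ put $R=u_1+c(u_0)u_{0,x}$, $S=u_1-c(u_0)u_{0,x}$, $\mathcal E(u_0,u_1)=\int (u_1^2+c^2(u_0)u_{0,x}^2)\,dx$, $\mathcal W^-(x)=1+\int_{-\infty}^xS^2\,dy$, $\mathcal W^+(x)=1+\int_x^{\infty}R^2\,dy$. For $K>0$ let $X_K$ be the set of data in $H^1\times L^2$ with $\mathcal E\le K$. Fix constants $\kappa_1,\dots,\kappa_6>0$. **Characteristic coordinates.** Solutions are described by functions $(u,\alpha,\beta,p,q,x,t)(X,Y)$, $(X,Y)\in\mathbb R^2$, with $p,q>0$ and $\alpha,\beta$ taken modulo $2\pi$, that satisfy $$u_X=\tfrac{\sin\alpha}{4c}p,\quad u_Y=\tfrac{\sin\beta}{4c}q,\quad \alpha_Y=\tfrac{c'}{8c^2}(\cos\beta-\cos\alpha)q,\quad \beta_X=\tfrac{c'}{8c^2}(\cos\alpha-\cos\beta)p,$$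 $$p_Y=\tfrac{c'}{8c^2}(\sin\beta-\sin\alpha)pq,\qquad q_X=\tfrac{c'}{8c^2}(\sin\alpha-\sin\beta)pq,$$ $$x_X=\tfrac{(1+\cos\alpha)p}{4},\quad x_Y=-\tfrac{(1+\cos\beta)q}{4},\quad t_X=\tfrac{(1+\cos\alpha)p}{4c},\quad t_Y=\tfrac{(1+\cos\beta)q}{4c},$$ where $c,c'$ are evaluated at $u$. Such a solution represents the conservative solution with initial data $(u_0,u_1)$ if the curve $\Gamma_0=\{t=0\}$ is parametrized by $x\mapsto(\xi(x),\eta(x))$, $\xi,\eta$ being surjective onto $\mathbb R$, with $x(\xi(x),\eta(x))=x$, $u=u_0(x)$ on $\Gamma_0$, $\tan\frac\alpha2=R(x)$ and $\tan\frac\beta2=S(x)$ for a.e. $x$, and $\xi,\eta$ absolutely continuous with $p\,\xi'=1+R^2$ and $-q\,\eta'=1+S^2$ a.e. **Paths and lengths.** A path $\gamma:\theta\mapsto(u_0^\theta,u_1^\theta)$, $\theta\in[0,1]$, in $X_K$ is piecewise regular if there is a map $(X,Y,\theta)\mapsto(u,\alpha,\beta,p,q,x,t)$, continuous on $\mathbb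 R^2\times[0,1]$, which for every $\theta\in[0,1]$ solves this system and represents the data $\gamma(\theta)$, and which for $\theta\in(0,1)$ outside a finite set is $\mathcal C^\infty$ in $(X,Y,\theta)$ and satisfies on $\{t=0\}$: $\alpha=\pi,\ \alpha_X=0\Rightarrow\alpha_Y\ne0,\ \alpha_{XX}\neq0$; $\ \beta=\pi,\ \beta_Y=0\Rightarrow\beta_X\ne0,\ \beta_{YY}\ne0$; $\ \alpha=\beta=\pi\Rightarrow\alpha_X\ne0,\ \beta_Y\neq0$. With $(\mathcal T,\mathcal X,U,A,B,P,Q)=\partial_\theta(t,x,u,\alpha,\beta,p,q)$ let $$J_1=(\mathcal X+c\mathcal T)p,\quad J_2=\tfrac12Ap-\tfrac{c'}{4c}p\mathcal T\sin^2\tfrac\alpha2,\quad J_3=Up,\quad J_4=P\cos^2\tfrac\alpha2-\tfrac{p\sin\alpha}{2}A+\tfrac{c'}{4c}\mathcal Tp\sin\alpha,$$ $$J_5=\tfrac12P\sin\alpha-pA\sin^2\tfrac\alpha2+\tfrac{c'}{2c}\mathcal Tp\sin^2\tfrac\alpha2,\qquad J_6=P\sin^2\tfrac\alpha2+\tfrac{p\sin\alpha}{2}A,$$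 and let $H_1=(\mathcal X-c\mathcal T)q$, while $H_2,\dots,H_6$ are obtained from $J_2,\dots,J_6$ by replacing $(\alpha,p,A,P)$ with $(\beta,q,B,Q)$. The length $\|\gamma\|$ is the infimum, over all such representations of $\gamma$, of $$\int_0^1\sum_{\ell=1}^6\kappa_\ell\int_{\Gamma_0^\theta}\bigl\{|J_\ell|\,\mathcal W^-\,dX+|H_\ell|\,\mathcal W^+\,|dY|\bigr\}\,d\theta .$$ **Distance.** For data in $X_K$ with $\mathcal C^\infty_c$ components, $d^*$ is the infimum of $\|\gamma\|$ over all piecewise regular paths $\gamma$ in $X_K$ joining them. It is extended by continuity to the completion: for data $a,\tilde a\in H^1\times L^2$, $d^*(a,\tilde a)$ is the infimum of $\liminf_n d^*(a_n,\tilde a_n)$ over all $d^*$-Cauchy sequences $(a_n),(\tilde a_n)$ of $\mathcal C_c^\infty$ data in $X_K$ with $a_n\to a$, $\tilde a_n\to\tilde a$ in $H^1\times L^2$ (and $+\infty$ if there are none). **Proposition 3.** For every $K>0$ there is a constant $\delta_0>0$ (for fixed $c$ and $\kappa_1,\dots,\kappa_6$, depending only on $K$) such that, for all $u_0,\tilde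 u_0\in H^1\cap L^1$ and $u_1,\tilde u_1\in L^2$ with $\mathcal E(u_0,u_1)\le K$ and $\mathcal E(\tilde u_0,\tilde u_1)\le K$, $$\|u_0-\tilde u_0\|_{L^1}\le\delta_0\, d^*\bigl((u_0,u_1),(\tilde u_0,\tilde u_1)\bigr),$$ $$\sup_{f}\Bigl|\int f\,d\mu-\int f\,d\tilde\mu\Bigr|\le\delta_0\, d^*\bigl((u_0,u_1),(\tilde u_0,\tilde u_1)\bigr),$$ where the supremum is over all $f\in\mathcal C^1(\mathbb R)$ with $|f|\le1$ and $|f'|\le1$, and $\mu,\tilde\mu$ are the measures with densities $u_1^2+c^2(u_0)u_{0,x}^2$ and $\tilde u_1^2+c^2(\tilde u_0)\tilde u_{0,x}^2$ with respect to Lebesgue measure. -/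

import Mathlib

open scoped ContDiff

noncomputable section

namespace VarWave

open MeasureTheory Filter Topology

/-! ### Initial data, energy -/

/-- Initial data `(u₀, u₁)` on the line. -/
structure WaveData where
  /-- the initial profile `u₀` -/
  pos : ℝ → ℝ
  /-- the initial velocity `u₁` -/
  vel : ℝ → ℝ

/-- `f ∈ H¹(ℝ)`: `f` is (the continuous representative) locally absolutely continuous, and `f`
and its a.e. derivative are in `L²`. -/
def MemH1 (f : ℝ → ℝ) : Prop :=
  MemLp f 2 volume ∧ MemLp (deriv f) 2 volume ∧
    ∀ a b : ℝ, f b - f a = ∫ y in a..b, deriv f y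

/-- The data belong to `H¹(ℝ) × L²(ℝ)`. -/
def WaveData.Admissible (a : WaveData) : Prop :=
  MemH1 a.pos ∧ MemLp a.vel 2 volume

/-- Both components are smooth with compact support. -/
def WaveData.IsTest (a : WaveData) : Prop :=
  ContDiff ℝ ∞ a.pos ∧ HasCompactSupport a.pos ∧ ContDiff ℝ ∞ a.vel ∧ HasCompactSupport a.vel

/-- `R = u₁ + c(u₀) u₀ₓ`. -/
def WaveData.R (c : ℝ → ℝ) (a : WaveData) (x : ℝ) : ℝ := a.vel x + c (a.pos x) * deriv a.pos x

/-- `S = u₁ - c(u₀) u₀ₓ`. -/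
def WaveData.S (c : ℝ → ℝ) (a : WaveData) (x : ℝ) : ℝ := a.vel x - c (a.pos x) * deriv a.pos x

/-- The energy measure, with density `u₁² + c²(u₀) u₀ₓ²` with respect to Lebesgue measure. -/
def energyMeasure (c : ℝ → ℝ) (a : WaveData) : Measure ℝ :=
  volume.withDensity fun x =>
    ENNReal.ofReal (a.vel x ^ 2 + c (a.pos x) ^ 2 * deriv a.pos x ^ 2)

/-- The total energy `∫ u₁² + c²(u₀) u₀ₓ² dx`. -/
def energy (c : ℝ → ℝ) (a : WaveData) : ENNReal :=
  ∫⁻ x, ENNReal.ofReal (a.vel x ^ 2 + c (a.pos x) ^ 2 * deriv a.pos x ^ 2)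

/-- The set `X_K` of data in `H¹ × L²` with total energy at most `K`. -/
def energySublevel (c : ℝ → ℝ) (K : ℝ) : Set WaveData :=
  {a | a.Admissible ∧ energy c a ≤ ENNReal.ofReal K}

/-- `𝒲⁻(x) = 1 + ∫_{-∞}^x S²`. -/
def weightMinus (c : ℝ → ℝ) (a : WaveData) (x : ℝ) : ENNReal :=
  1 + ∫⁻ y in Set.Iic x, ENNReal.ofReal (a.S c y ^ 2)

/-- `𝒲⁺(x) = 1 + ∫_x^∞ R²`. -/
def weightPlus (c : ℝ → ℝ) (a : WaveData) (x : ℝ) : ENNReal :=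
  1 + ∫⁻ y in Set.Ici x, ENNReal.ofReal (a.R c y ^ 2)

/-! ### Conservative solutions in characteristic coordinates -/

/-- The unknowns of the semilinear system, as functions of the characteristic coordinates
`(X, Y)`.  The angles `α, β` matter only modulo `2π`. -/
structure CharFields where
  u : ℝ → ℝ → ℝ
  α : ℝ → ℝ → ℝ
  β : ℝ → ℝ → ℝ
  p : ℝ → ℝ → ℝ
  q : ℝ → ℝ → ℝ
  x : ℝ → ℝ → ℝ
  t : ℝ → ℝ → ℝ

/-- The semilinear system equivalent to `u_tt - c(u) (c(u) u_x)_x = 0`, with `p, q > 0`. -/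
structure CharFields.Solves (c : ℝ → ℝ) (F : CharFields) : Prop where
  p_pos : ∀ X Y, 0 < F.p X Y
  q_pos : ∀ X Y, 0 < F.q X Y
  u_X : ∀ X Y, HasDerivAt (fun X' => F.u X' Y)
    (Real.sin (F.α X Y) / (4 * c (F.u X Y)) * F.p X Y) X
  u_Y : ∀ X Y, HasDerivAt (fun Y' => F.u X Y')
    (Real.sin (F.β X Y) / (4 * c (F.u X Y)) * F.q X Y) Y
  α_Y : ∀ X Y, HasDerivAt (fun Y' => F.α X Y')
    (deriv c (F.u X Y) / (8 * c (F.u X Y) ^ 2) *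
      (Real.cos (F.β X Y) - Real.cos (F.α X Y)) * F.q X Y) Y
  β_X : ∀ X Y, HasDerivAt (fun X' => F.β X' Y)
    (deriv c (F.u X Y) / (8 * c (F.u X Y) ^ 2) *
      (Real.cos (F.α X Y) - Real.cos (F.β X Y)) * F.p X Y) X
  p_Y : ∀ X Y, HasDerivAt (fun Y' => F.p X Y')
    (deriv c (F.u X Y) / (8 * c (F.u X Y) ^ 2) *
      (Real.sin (F.β X Y) - Real.sin (F.α X Y)) * (F.p X Y * F.q X Y)) Y
  q_X : ∀ X Y, HasDerivAt (fun X' => F.q X' Y)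
    (deriv c (F.u X Y) / (8 * c (F.u X Y) ^ 2) *
      (Real.sin (F.α X Y) - Real.sin (F.β X Y)) * (F.p X Y * F.q X Y)) X
  x_X : ∀ X Y, HasDerivAt (fun X' => F.x X' Y) ((1 + Real.cos (F.α X Y)) * F.p X Y / 4) X
  x_Y : ∀ X Y, HasDerivAt (fun Y' => F.x X Y') (-((1 + Real.cos (F.β X Y)) * F.q X Y / 4)) Y
  t_X : ∀ X Y, HasDerivAt (fun X' => F.t X' Y)
    ((1 + Real.cos (F.α X Y)) * F.p X Y / (4 * c (F.u X Y))) X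
  t_Y : ∀ X Y, HasDerivAt (fun Y' => F.t X Y')
    ((1 + Real.cos (F.β X Y)) * F.q X Y / (4 * c (F.u X Y))) Y

/-- The fields represent the conservative solution with initial data `a`.  The curve
`{t = 0}` is parametrized by `x ↦ (ξ x, η x)`, and along it `u = u₀`, `tan (α/2) = R`,
`tan (β/2) = S` for a.e. `x` (in particular `α, β ≠ π` there), while `ξ` and `η` are absolutely
continuous with `p dX = (1 + R²) dx` and `-q dY = (1 + S²) dx`: no energy is concentrated on a
null set at time `0`.  For `ξ x = x`, `η x = -x` these are the boundary data `u = u₀`,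
`α = 2 arctan R`, `β = 2 arctan S`, `p = 1 + R²`, `q = 1 + S²` on the line `X + Y = 0`; general
`ξ, η` account for the relabelings of the characteristics. -/
structure CharFields.HasData (c : ℝ → ℝ) (F : CharFields) (a : WaveData) (ξ η : ℝ → ℝ) :
    Prop where
  ξ_surj : Function.Surjective ξ
  η_surj : Function.Surjective η
  t_eq : ∀ x, F.t (ξ x) (η x) = 0
  x_eq : ∀ x, F.x (ξ x) (η x) = x
  u_eq : ∀ x, F.u (ξ x) (η x) = a.pos x
  α_eq : ∀ᵐ x ∂volume,
    a.R c x * Real.cos (F.α (ξ x) (η x) / 2) = Real.sin (F.α (ξ x) (η x) / 2)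
  β_eq : ∀ᵐ x ∂volume,
    a.S c x * Real.cos (F.β (ξ x) (η x) / 2) = Real.sin (F.β (ξ x) (η x) / 2)
  dX_eq : ∀ y z, ξ z - ξ y = ∫ x in y..z, (1 + a.R c x ^ 2) / F.p (ξ x) (η x)
  dY_eq : ∀ y z, η z - η y = -∫ x in y..z, (1 + a.S c x ^ 2) / F.q (ξ x) (η x)

/-- The singularities at time `t = 0` are generic (structurally stable).  Since angles are taken modulo
`2π`, the condition `α = π` is written `cos α = -1`. -/
def CharFields.GenericAtZero (F : CharFields) : Prop :=
  ∀ X Y, F.t X Y = 0 →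
    (Real.cos (F.α X Y) = -1 → deriv (fun X' => F.α X' Y) X = 0 →
      deriv (fun Y' => F.α X Y') Y ≠ 0 ∧ iteratedDeriv 2 (fun X' => F.α X' Y) X ≠ 0) ∧
    (Real.cos (F.β X Y) = -1 → deriv (fun Y' => F.β X Y') Y = 0 →
      deriv (fun X' => F.β X' Y) X ≠ 0 ∧ iteratedDeriv 2 (fun Y' => F.β X Y') Y ≠ 0) ∧
    (Real.cos (F.α X Y) = -1 → Real.cos (F.β X Y) = -1 →
      deriv (fun X' => F.α X' Y) X ≠ 0 ∧ deriv (fun Y' => F.β X Y') Y ≠ 0)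

/-! ### Piecewise regular paths and their length -/

/-- All seven fields, as a function of `(X, Y, θ)`. -/
def joint (F : ℝ → CharFields) (z : ℝ × ℝ × ℝ) : ℝ × ℝ × ℝ × ℝ × ℝ × ℝ × ℝ :=
  ((F z.2.2).u z.1 z.2.1, (F z.2.2).α z.1 z.2.1, (F z.2.2).β z.1 z.2.1, (F z.2.2).p z.1 z.2.1,
    (F z.2.2).q z.1 z.2.1, (F z.2.2).x z.1 z.2.1, (F z.2.2).t z.1 z.2.1)

/-- `F` (with the parametrizations `ξ θ, η θ` of the curves `{t = 0}`) exhibits the path of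
initial data `γ`, `θ ∈ [0,1]`, as a piecewise regular path. -/
structure IsRegularRep (c : ℝ → ℝ) (γ : ℝ → WaveData) (F : ℝ → CharFields)
    (ξ η : ℝ → ℝ → ℝ) : Prop where
  cont : ContinuousOn (joint F) {z | z.2.2 ∈ Set.Icc (0 : ℝ) 1}
  solves : ∀ θ ∈ Set.Icc (0 : ℝ) 1, (F θ).Solves c
  data : ∀ θ ∈ Set.Icc (0 : ℝ) 1, (F θ).HasData c (γ θ) (ξ θ) (η θ)
  pieces : ∃ E : Finset ℝ,
    ContDiffOn ℝ ∞ (joint F) {z | z.2.2 ∈ Set.Ioo (0 : ℝ) 1 \ (E : Set ℝ)} ∧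
    ∀ θ ∈ Set.Ioo (0 : ℝ) 1 \ (E : Set ℝ), (F θ).GenericAtZero

/-- The integrands `J₁, …, J₆` at `(X, Y)`.  Here `𝒯, 𝒳, U, A, P` are the derivatives of
`t, x, u, α, p` in `θ` at fixed `(X, Y)`.  With `w = 𝒳 + c𝒯` and `z = 𝒳 - c𝒯` the shifts of
backward and forward waves, `J₁ = w p` and `J₃ = (v + R w / 2c - S z / 2c) p = U p`. -/
def J (c : ℝ → ℝ) (F : ℝ → CharFields) (θ X Y : ℝ) : Fin 6 → ℝ :=
  let α := (F θ).α X Y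
  let p := (F θ).p X Y
  let k := c ((F θ).u X Y)
  let k' := deriv c ((F θ).u X Y)
  let T := deriv (fun s => (F s).t X Y) θ
  let Xi := deriv (fun s => (F s).x X Y) θ
  let U := deriv (fun s => (F s).u X Y) θ
  let A := deriv (fun s => (F s).α X Y) θ
  let P := deriv (fun s => (F s).p X Y) θ
  ![(Xi + k * T) * p,
    A * p / 2 - k' / (4 * k) * p * T * Real.sin (α / 2) ^ 2,
    U * p,
    P * Real.cos (α / 2) ^ 2 - p * Real.sin α / 2 * A + k' / (4 * k) * T * p * Real.sin α,
    P * Real.sin α / 2 - p * A * Real.sin (α / 2) ^ 2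
      + k' / (2 * k) * T * p * Real.sin (α / 2) ^ 2,
    P * Real.sin (α / 2) ^ 2 + p * Real.sin α / 2 * A]

/-- The integrands `H₁, …, H₆` at `(X, Y)`, the analogues of `J₁, …, J₆` for forward waves:
`H₁ = z q`, `H₃ = U q`, and so on. -/
def H (c : ℝ → ℝ) (F : ℝ → CharFields) (θ X Y : ℝ) : Fin 6 → ℝ :=
  let β := (F θ).β X Y
  let q := (F θ).q X Y
  let k := c ((F θ).u X Y)
  let k' := deriv c ((F θ).u X Y)
  let T := deriv (fun s => (F s).t X Y) θ
  let Xi := deriv (fun s => (F s).x X Y) θ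
  let U := deriv (fun s => (F s).u X Y) θ
  let B := deriv (fun s => (F s).β X Y) θ
  let Q := deriv (fun s => (F s).q X Y) θ
  ![(Xi - k * T) * q,
    B * q / 2 - k' / (4 * k) * q * T * Real.sin (β / 2) ^ 2,
    U * q,
    Q * Real.cos (β / 2) ^ 2 - q * Real.sin β / 2 * B + k' / (4 * k) * T * q * Real.sin β,
    Q * Real.sin β / 2 - q * B * Real.sin (β / 2) ^ 2
      + k' / (2 * k) * T * q * Real.sin (β / 2) ^ 2,
    Q * Real.sin (β / 2) ^ 2 + q * Real.sin β / 2 * B]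

/-- The weighted norm of the tangent vector at `θ`, the line integral
`∑ κ_ℓ ∫_Γ |J_ℓ| 𝒲⁻ dX + |H_ℓ| 𝒲⁺ |dY|` over `Γ = {t = 0}`, written in the parameter `x`, where
`dX = (1 + R²)/p dx` and `|dY| = (1 + S²)/q dx`. -/
def tangentNorm (c : ℝ → ℝ) (κ : Fin 6 → ℝ) (γ : ℝ → WaveData) (F : ℝ → CharFields)
    (ξ η : ℝ → ℝ → ℝ) (θ : ℝ) : ENNReal :=
  ∑ l : Fin 6, ENNReal.ofReal (κ l) * ∫⁻ x,
    (ENNReal.ofReal |J c F θ (ξ θ x) (η θ x) l| * weightMinus c (γ θ) x *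
        ENNReal.ofReal ((1 + (γ θ).R c x ^ 2) / (F θ).p (ξ θ x) (η θ x)) +
      ENNReal.ofReal |H c F θ (ξ θ x) (η θ x) l| * weightPlus c (γ θ) x *
        ENNReal.ofReal ((1 + (γ θ).S c x ^ 2) / (F θ).q (ξ θ x) (η θ x)))

/-- The length `‖γ‖` of a path of data: the infimum over all representations, that is over all
relabelings of the characteristics, of the integral of the norm of the tangent vector.  It is
`∞` if `γ` is not piecewise regular. -/
def pathLength (c : ℝ → ℝ) (κ : Fin 6 → ℝ) (γ : ℝ → WaveData) : ENNReal :=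
  ⨅ (F : ℝ → CharFields) (ξ : ℝ → ℝ → ℝ) (η : ℝ → ℝ → ℝ) (_ : IsRegularRep c γ F ξ η),
    ∫⁻ θ in Set.Icc (0 : ℝ) 1, tangentNorm c κ γ F ξ η θ

/-! ### The geodesic distance -/

/-- The infimum of the lengths of the piecewise regular paths that join `a` to `b` and remain
inside `X_K`. -/
def geodesicDist (c : ℝ → ℝ) (κ : Fin 6 → ℝ) (K : ℝ) (a b : WaveData) : ENNReal :=
  ⨅ (γ : ℝ → WaveData) (_ : γ 0 = a) (_ : γ 1 = b)
    (_ : ∀ θ ∈ Set.Icc (0 : ℝ) 1, γ θ ∈ energySublevel c K), pathLength c κ γ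

/-- The sequence `s` of test data in `X_K` is Cauchy for the geodesic distance and converges to
`a` in `H¹ × L²`; it represents `a` in the completion. -/
structure Approximates (c : ℝ → ℝ) (κ : Fin 6 → ℝ) (K : ℝ) (s : ℕ → WaveData) (a : WaveData) :
    Prop where
  test : ∀ n, (s n).IsTest
  mem : ∀ n, s n ∈ energySublevel c K
  cauchy : ∀ ε : ENNReal, 0 < ε →
    ∃ N, ∀ m, N ≤ m → ∀ n, N ≤ n → geodesicDist c κ K (s m) (s n) < ε
  pos_tendsto :
    Tendsto (fun n => eLpNorm (fun x => (s n).pos x - a.pos x) 2 volume) atTop (𝓝 0)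
  deriv_tendsto :
    Tendsto (fun n => eLpNorm (fun x => deriv (s n).pos x - deriv a.pos x) 2 volume) atTop (𝓝 0)
  vel_tendsto :
    Tendsto (fun n => eLpNorm (fun x => (s n).vel x - a.vel x) 2 volume) atTop (𝓝 0)

/-- The distance `d*` on data in `H¹ × L²`: the extension by continuity of the geodesic distance
from smooth compactly supported data to the completion.  It is the limit of the distances along
representing sequences (the smallest one, should it depend on them), and it is `∞` if one of the
data is not in the completion. -/
def dStar (c : ℝ → ℝ) (κ : Fin 6 → ℝ) (K : ℝ) (a b : WaveData) : ENNReal :=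
  ⨅ (s : ℕ → WaveData) (s' : ℕ → WaveData) (_ : Approximates c κ K s a)
    (_ : Approximates c κ K s' b),
    liminf (fun n => geodesicDist c κ K (s n) (s' n)) atTop

/-- The distance between finite measures in the dual of `C¹`: the supremum of
`|∫ f dμ - ∫ f dν|` over all `f` of class `C¹` with `|f| ≤ 1` and `|f'| ≤ 1`. -/
def dualC1Dist (μ ν : Measure ℝ) : ENNReal :=
  ⨆ (f : ℝ → ℝ) (_ : ContDiff ℝ 1 f) (_ : ∀ x, |f x| ≤ 1) (_ : ∀ x, |deriv f x| ≤ 1),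
    ENNReal.ofReal |(∫ x, f x ∂μ) - ∫ x, f x ∂ν|

end VarWave

end

/-!
The two quantities to be estimated are line integrals over the curve `Γ = {t = 0}` of one-forms in
the characteristic plane: `∫ φ u₀ dx` is the integral of `φ(x) u dx`, and `∫ f dμ` is the integral of
`f(x)` times the energy form `p (1 - cos α) / 4 dX - q (1 - cos β) / 4 dY`, which the semilinear
system makes closed (`Family.energy_closed`).  Along a piecewise regular path, the variation in `θ` of
the integral of a one-form `σ` over `Γ^θ` is the integral of `dσ` contracted with the velocity of the
curve.  For `φ(x) u dx` the result is
`∫ φ (U - (sin α / 4c) w p dX/dx + (sin β / 4c) z q |dY|/dx) dx`,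
where `w = 𝒳 + c𝒯` and `z = 𝒳 - c𝒯`, which is bounded by `J₁, H₁, J₃` when `|φ| ≤ 1`, whatever
`φ'` is.  For the energy form, being closed, the only planar contribution carries the factor `f'`, and
the result is bounded by `J₁, H₁, J₆, H₆`.  Since the weights `𝒲⁻, 𝒲⁺` are at least `1`, both are
bounded by the norm of the tangent vector; integration in `θ` bounds the difference of the integrals at
the two ends of the path by its length.  Approximating the sign of `u₀ - ũ₀` by `φ` gives the `L¹`
estimate for test data, and a cutoff gives the estimate of the energy measures.

The curves `Γ^θ` need not depend smoothly on `θ`, because `∇t` vanishes where `α = β = π`.  They are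
therefore replaced by the zero sets of `t + |ε| r`, where `X = r + s` and `Y = r - s`: since `t` is
nondecreasing in `X` and `Y`, these are graphs `r = r(s, θ, ε)`, continuous in all three
variables, and smooth in `(s, θ)` for `ε ≠ 0`.  In the first variation the velocity of the curve
appears only in products that are bounded independently of `ε`, because `dσ` restricted to the plane
is controlled by `∇t`.  At `ε = 0` the gradient is nonzero at almost every point of the curve, since
`tan (α / 2) = R` is finite almost everywhere.  Hence the derivatives converge by dominated
convergence (`LevelFamily.hasDerivAt_sliceIntegral`), and no genericity of the path is needed.

For general data, convergence of the approximating sequences in `H¹ × L²` implies uniform convergence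
of the profiles and convergence of the energy densities in `L¹`, so that both estimates pass to the
lower limit that defines `d*`.
-/

noncomputable section

namespace VarWave

open MeasureTheory Filter Topology

/-! ### Zeros of monotone functions depending on parameters -/

/-- If every `f w` is nondecreasing with exactly one zero, continuity of `f` in the parameter alone
gives continuity of the zero. -/
theorem continuousAt_zero_of_monotone {W : Type*} [TopologicalSpace W] {f : W → ℝ → ℝ}
    {ρ : W → ℝ} (hmono : ∀ w, Monotone (f w)) (hcont : ∀ r, Continuous fun w => f w r)
    (hzero : ∀ w, f w (ρ w) = 0) (huniq : ∀ w r, f w r = 0 → r = ρ w) (w₀ : W) :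
    ContinuousAt ρ w₀ := by
  rw [Metric.continuousAt_iff']
  intro δ hδ
  have h1 : f w₀ (ρ w₀ - δ) < 0 := by
    refine lt_of_le_of_ne ((hmono w₀ (by linarith)).trans_eq (hzero w₀)) fun h => ?_
    have := huniq w₀ _ h
    linarith
  have h2 : 0 < f w₀ (ρ w₀ + δ) := by
    refine lt_of_le_of_ne ((hzero w₀).symm.trans_le (hmono w₀ (by linarith))) fun h => ?_
    have := huniq w₀ _ h.symm
    linarith
  filter_upwards [(hcont _).continuousAt.eventually_lt continuousAt_const h1,
    continuousAt_const.eventually_lt (hcont _).continuousAt h2] with w hw1 hw2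
  rw [Real.dist_eq, abs_lt]
  constructor
  · by_contra! h
    have := hmono w (show ρ w ≤ ρ w₀ - δ by linarith)
    rw [hzero] at this
    linarith
  · by_contra! h
    have := hmono w (show ρ w₀ + δ ≤ ρ w by linarith)
    rw [hzero] at this
    linarith

/-! ### Families of level curves and their regularization -/

/-- A continuous family `t (·, ·, θ)` of functions on the plane, nondecreasing in each of the
characteristic variables, whose zero set meets every line `X - Y = 2 s` exactly once; `tX`, `tY`
are the partial derivatives of `t` in the characteristic directions. -/
structure LevelFamily (t tX tY : ℝ × ℝ × ℝ → ℝ) : Prop where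
  cont : Continuous t
  cont_X : Continuous tX
  cont_Y : Continuous tY
  deriv_X : ∀ X Y θ, HasDerivAt (fun X' => t (X', Y, θ)) (tX (X, Y, θ)) X
  deriv_Y : ∀ X Y θ, HasDerivAt (fun Y' => t (X, Y', θ)) (tY (X, Y, θ)) Y
  X_nonneg : ∀ z, 0 ≤ tX z
  Y_nonneg : ∀ z, 0 ≤ tY z
  zero : ∀ s θ, ∃! r, t (r + s, r - s, θ) = 0

/-- The function `r ↦ t + |ε| r` on the line `X = r + s`, `Y = r - s`; the parameters are
`w = (s, θ, ε)`. -/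
def regLevel (t : ℝ × ℝ × ℝ → ℝ) (w : ℝ × ℝ × ℝ) (r : ℝ) : ℝ :=
  t (r + w.1, r - w.1, w.2.1) + |w.2.2| * r

/-- The zero of `regLevel t w`: the regularized curve `{t + |ε| r = 0}` is the graph
`r = height t (s, θ, ε)`. -/
def height (t : ℝ × ℝ × ℝ → ℝ) (w : ℝ × ℝ × ℝ) : ℝ :=
  Classical.epsilon fun r => regLevel t w r = 0

/-- The point with line coordinate `s` on the regularized curve, together with `θ`. -/
def levelPt (t : ℝ × ℝ × ℝ → ℝ) (w : ℝ × ℝ × ℝ) : ℝ × ℝ × ℝ :=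
  (height t w + w.1, height t w - w.1, w.2.1)

namespace LevelFamily

variable {t tX tY : ℝ × ℝ × ℝ → ℝ}

theorem mono (h : LevelFamily t tX tY) {X X' Y Y' : ℝ} (hX : X ≤ X') (hY : Y ≤ Y') (θ : ℝ) :
    t (X, Y, θ) ≤ t (X', Y', θ) := by
  have h1 : Monotone fun X => t (X, Y, θ) :=
    monotone_of_hasDerivAt_nonneg (fun X => h.deriv_X X Y θ) fun X => h.X_nonneg _
  have h2 : Monotone fun Y => t (X', Y, θ) :=
    monotone_of_hasDerivAt_nonneg (fun Y => h.deriv_Y X' Y θ) fun Y => h.Y_nonneg _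
  exact (h1 hX).trans (h2 hY)

theorem regLevel_mono (h : LevelFamily t tX tY) (w : ℝ × ℝ × ℝ) : Monotone (regLevel t w) := by
  intro r r' hr
  unfold regLevel
  have := h.mono (show r + w.1 ≤ r' + w.1 by linarith) (show r - w.1 ≤ r' - w.1 by linarith) w.2.1
  have := mul_le_mul_of_nonneg_left hr (abs_nonneg w.2.2)
  linarith

theorem regLevel_cont (h : LevelFamily t tX tY) :
    Continuous fun y : (ℝ × ℝ × ℝ) × ℝ => regLevel t y.1 y.2 := by
  unfold regLevel
  have := h.cont
  fun_prop

theorem existsUnique_regLevel (h : LevelFamily t tX tY) (w : ℝ × ℝ × ℝ) :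
    ∃! r, regLevel t w r = 0 := by
  obtain ⟨r₀, hr₀, huniq⟩ := h.zero w.1 w.2.1
  rcases eq_or_ne w.2.2 0 with hε | hε
  · simp only [regLevel, hε, abs_zero, zero_mul, add_zero]
    exact ⟨r₀, hr₀, huniq⟩
  have hε' : 0 < |w.2.2| := abs_pos.2 hε
  -- the zero lies between `0` and the zero `r₀` of the unperturbed function
  have key : ∃ r, regLevel t w r = 0 := by
    have hc : Continuous (regLevel t w) := h.regLevel_cont.comp (Continuous.prodMk_right w)
    have h0 : regLevel t w r₀ = |w.2.2| * r₀ := by simp [regLevel, hr₀]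
    rcases le_total 0 r₀ with hs | hs
    · have h1 : regLevel t w 0 ≤ 0 := by
        have := h.mono (show 0 + w.1 ≤ r₀ + w.1 by linarith)
          (show 0 - w.1 ≤ r₀ - w.1 by linarith) w.2.1
        simp only [regLevel, mul_zero, add_zero]
        exact this.trans_eq hr₀
      obtain ⟨r, -, hr⟩ := intermediate_value_Icc hs hc.continuousOn
        ⟨h1, h0 ▸ mul_nonneg hε'.le hs⟩
      exact ⟨r, hr⟩
    · have h1 : 0 ≤ regLevel t w 0 := by
        have := h.mono (show r₀ + w.1 ≤ 0 + w.1 by linarith)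
          (show r₀ - w.1 ≤ 0 - w.1 by linarith) w.2.1
        simp only [regLevel, mul_zero, add_zero]
        exact hr₀.symm.trans_le this
      obtain ⟨r, -, hr⟩ := intermediate_value_Icc hs hc.continuousOn
        ⟨h0 ▸ mul_nonpos_of_nonneg_of_nonpos hε'.le hs, h1⟩
      exact ⟨r, hr⟩
  obtain ⟨r, hr⟩ := key
  have hlt : ∀ r₁ r₂, r₁ < r₂ → regLevel t w r₁ < regLevel t w r₂ := by
    intro r₁ r₂ h12
    have := h.mono (show r₁ + w.1 ≤ r₂ + w.1 by linarith) (show r₁ - w.1 ≤ r₂ - w.1 by linarith)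
      w.2.1
    have := mul_lt_mul_of_pos_left h12 hε'
    unfold regLevel
    linarith
  refine ⟨r, hr, fun r' hr' => ?_⟩
  rcases lt_trichotomy r' r with h1 | h1 | h1
  · have := hlt _ _ h1
    simp only at hr'
    linarith
  · exact h1
  · have := hlt _ _ h1
    simp only at hr'
    linarith

theorem regLevel_height (h : LevelFamily t tX tY) (w : ℝ × ℝ × ℝ) :
    regLevel t w (height t w) = 0 :=
  Classical.epsilon_spec (h.existsUnique_regLevel w).exists

theorem eq_height (h : LevelFamily t tX tY) {w : ℝ × ℝ × ℝ} {r : ℝ} (hr : regLevel t w r = 0) :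
    r = height t w :=
  (h.existsUnique_regLevel w).unique hr (h.regLevel_height w)

theorem continuous_height (h : LevelFamily t tX tY) : Continuous (height t) :=
  continuous_iff_continuousAt.2 <| continuousAt_zero_of_monotone h.regLevel_mono
    (fun r => h.regLevel_cont.comp (Continuous.prodMk_left r)) h.regLevel_height
    fun _ _ => h.eq_height

theorem continuous_levelPt (h : LevelFamily t tX tY) : Continuous (levelPt t) := by
  have := h.continuous_height
  unfold levelPt
  fun_prop

theorem fderiv_X (h : LevelFamily t tX tY) {z : ℝ × ℝ × ℝ} (hz : DifferentiableAt ℝ t z) :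
    fderiv ℝ t z (1, 0, 0) = tX z := by
  have h1 : HasDerivAt (fun X' : ℝ => (X', z.2.1, z.2.2)) (1, 0, 0) z.1 :=
    (hasDerivAt_id z.1).prodMk ((hasDerivAt_const z.1 z.2.1).prodMk (hasDerivAt_const z.1 z.2.2))
  exact (hz.hasFDerivAt.comp_hasDerivAt z.1 h1).unique (h.deriv_X z.1 z.2.1 z.2.2)

theorem fderiv_Y (h : LevelFamily t tX tY) {z : ℝ × ℝ × ℝ} (hz : DifferentiableAt ℝ t z) :
    fderiv ℝ t z (0, 1, 0) = tY z := by
  have h1 : HasDerivAt (fun Y' : ℝ => (z.1, Y', z.2.2)) (0, 1, 0) z.2.1 :=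
    (hasDerivAt_const z.2.1 z.1).prodMk ((hasDerivAt_id z.2.1).prodMk (hasDerivAt_const z.2.1 z.2.2))
  exact (hz.hasFDerivAt.comp_hasDerivAt z.2.1 h1).unique (h.deriv_Y z.1 z.2.1 z.2.2)

theorem fderiv_add (h : LevelFamily t tX tY) {z : ℝ × ℝ × ℝ} (hz : DifferentiableAt ℝ t z) :
    fderiv ℝ t z (1, 1, 0) = tX z + tY z := by
  rw [← h.fderiv_X hz, ← h.fderiv_Y hz, ← map_add]; simp

/-- For `ε ≠ 0` the regularized curve is a nondegenerate level set, hence depends smoothly on the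
line coordinate and on `θ`. -/
theorem contDiffAt_height (h : LevelFamily t tX tY) {s θ ε : ℝ} (hε : ε ≠ 0)
    (hsm : ContDiffAt ℝ 2 t (levelPt t (s, θ, ε))) :
    ContDiffAt ℝ 2 (fun y : ℝ × ℝ => height t (y.1, y.2, ε)) (s, θ) := by
  set u : (ℝ × ℝ) × ℝ := ((s, θ), height t (s, θ, ε))
  set f : (ℝ × ℝ) × ℝ → ℝ := fun y => regLevel t (y.1.1, y.1.2, ε) y.2
  have cdf : ContDiffAt ℝ 2 f u := by
    have h1 : ContDiffAt ℝ 2 (fun y : (ℝ × ℝ) × ℝ => (y.2 + y.1.1, y.2 - y.1.1, y.1.2)) u := by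
      fun_prop
    have h2 : ContDiffAt ℝ 2 (t ∘ fun y : (ℝ × ℝ) × ℝ => (y.2 + y.1.1, y.2 - y.1.1, y.1.2)) u :=
      ContDiffAt.comp u hsm h1
    have h3 : ContDiffAt ℝ 2 (fun y : (ℝ × ℝ) × ℝ => |ε| * y.2) u := by fun_prop
    exact h2.add h3
  have hfd : HasFDerivAt f (fderiv ℝ f u) u := (cdf.differentiableAt two_ne_zero).hasFDerivAt
  have hval : fderiv ℝ f u (0, 1) = tX (levelPt t (s, θ, ε)) + tY (levelPt t (s, θ, ε)) + |ε| := by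
    have h1 : HasDerivAt (fun r : ℝ => (((s, θ), r) : (ℝ × ℝ) × ℝ)) (0, 1)
        (height t (s, θ, ε)) := (hasDerivAt_const _ _).prodMk (hasDerivAt_id _)
    have h2 := hfd.comp_hasDerivAt (height t (s, θ, ε)) h1
    have h3 : HasDerivAt (fun r : ℝ => ((r + s, r - s, θ) : ℝ × ℝ × ℝ)) (1, 1, 0)
        (height t (s, θ, ε)) :=
      ((hasDerivAt_id _).add_const s).prodMk
        (((hasDerivAt_id _).sub_const s).prodMk (hasDerivAt_const _ _))
    have hd : DifferentiableAt ℝ t (levelPt t (s, θ, ε)) := hsm.differentiableAt two_ne_zero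
    have h4 : HasDerivAt (fun r : ℝ => t (r + s, r - s, θ)) _ (height t (s, θ, ε)) :=
      hd.hasFDerivAt.comp_hasDerivAt (height t (s, θ, ε)) h3
    have h5 := h4.add ((hasDerivAt_id (height t (s, θ, ε))).const_mul |ε|)
    rw [h.fderiv_add hd, mul_one] at h5
    exact h2.unique h5
  have hpos : 0 < fderiv ℝ f u (0, 1) := by
    rw [hval]
    have := h.X_nonneg (levelPt t (s, θ, ε))
    have := h.Y_nonneg (levelPt t (s, θ, ε))
    have := abs_pos.2 hε
    linarith
  have if₂ : (fderiv ℝ f u ∘L .inr ℝ (ℝ × ℝ) ℝ).IsInvertible := by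
    refine ⟨ContinuousLinearEquiv.unitsEquivAut ℝ (Units.mk0 _ hpos.ne'), ?_⟩
    ext
    simp
  have hψ := cdf.contDiffAt_implicitFunction two_ne_zero if₂
  refine hψ.congr_of_eventuallyEq ?_
  filter_upwards [cdf.eventually_apply_implicitFunction two_ne_zero if₂] with y hy
  refine (h.eq_height ?_).symm
  have : f u = 0 := h.regLevel_height (s, θ, ε)
  rw [this] at hy
  exact hy

/-- The regularized curve and its derivatives in `s` and `θ`. -/
theorem hasFDerivAt_levelPt (h : LevelFamily t tX tY) {s θ ε : ℝ} (hε : ε ≠ 0)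
    (hsm : ContDiffAt ℝ 2 t (levelPt t (s, θ, ε))) :
    fderiv ℝ (fun y : ℝ × ℝ => levelPt t (y.1, y.2, ε)) (s, θ) (1, 0) =
        (1, -1, 0) + (-(tX (levelPt t (s, θ, ε)) - tY (levelPt t (s, θ, ε))) /
          (|ε| + (tX (levelPt t (s, θ, ε)) + tY (levelPt t (s, θ, ε))))) • (1, 1, 0) ∧
      fderiv ℝ (fun y : ℝ × ℝ => levelPt t (y.1, y.2, ε)) (s, θ) (0, 1) =
        (0, 0, 1) + (-(fderiv ℝ t (levelPt t (s, θ, ε)) (0, 0, 1)) /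
          (|ε| + (tX (levelPt t (s, θ, ε)) + tY (levelPt t (s, θ, ε))))) • (1, 1, 0) := by
  set z := levelPt t (s, θ, ε)
  have hρ := ((h.contDiffAt_height hε hsm).differentiableAt two_ne_zero).hasFDerivAt
  set L := fderiv ℝ (fun y : ℝ × ℝ => height t (y.1, y.2, ε)) (s, θ)
  have hfst : HasFDerivAt (fun y : ℝ × ℝ => y.1) (ContinuousLinearMap.fst ℝ ℝ ℝ) (s, θ) :=
    hasFDerivAt_fst
  have hsnd : HasFDerivAt (fun y : ℝ × ℝ => y.2) (ContinuousLinearMap.snd ℝ ℝ ℝ) (s, θ) :=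
    hasFDerivAt_snd
  have hZ : HasFDerivAt (fun y : ℝ × ℝ => levelPt t (y.1, y.2, ε)) _ (s, θ) :=
    (hρ.add hfst).prodMk ((hρ.sub hfst).prodMk hsnd)
  have hd : DifferentiableAt ℝ t z := hsm.differentiableAt two_ne_zero
  have hcomp : HasFDerivAt (fun y : ℝ × ℝ => t (levelPt t (y.1, y.2, ε)) +
      |ε| * height t (y.1, y.2, ε)) _ (s, θ) :=
    (hd.hasFDerivAt.comp (s, θ) hZ).add (hρ.const_mul |ε|)
  have hconst : (fun y : ℝ × ℝ => t (levelPt t (y.1, y.2, ε)) + |ε| * height t (y.1, y.2, ε)) =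
      fun _ => 0 := by
    funext y
    exact h.regLevel_height (y.1, y.2, ε)
  rw [hconst] at hcomp
  have hzero := hcomp.unique (hasFDerivAt_const (0 : ℝ) (s, θ))
  have hD : 0 < |ε| + (tX z + tY z) := by
    have := h.X_nonneg z
    have := h.Y_nonneg z
    have := abs_pos.2 hε
    linarith
  obtain ⟨tθ, htθ⟩ : ∃ tθ, tθ = fderiv ℝ t z (0, 0, 1) := ⟨_, rfl⟩
  have hdec : ∀ x y w : ℝ, fderiv ℝ t z (x, y, w) = x * tX z + y * tY z + w * tθ := by
    intro x y w
    rw [htθ, ← h.fderiv_X hd, ← h.fderiv_Y hd, ← smul_eq_mul, ← smul_eq_mul, ← smul_eq_mul, ← map_smul,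
      ← map_smul, ← map_smul, ← map_add, ← map_add]
    simp
  have e1 := congrArg (fun A => A ((1 : ℝ), (0 : ℝ))) hzero
  have e2 := congrArg (fun A => A ((0 : ℝ), (1 : ℝ))) hzero
  simp [hdec] at e1 e2
  have l1 : L (1, 0) = -(tX z - tY z) / (|ε| + (tX z + tY z)) := by
    rw [eq_div_iff hD.ne']; linarith
  have l2 : L (0, 1) = -tθ / (|ε| + (tX z + tY z)) := by
    rw [eq_div_iff hD.ne']; linarith
  rw [hZ.fderiv, ← htθ]
  constructor
  · rw [← l1]
    ext <;> simp <;> ring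
  · rw [← l2]
    ext <;> simp

end LevelFamily

/-! ### Variation of the integral of a one-form along a moving curve -/

theorem continuousAt_fderiv_apply {E F : Type*} [NormedAddCommGroup E] [NormedSpace ℝ E]
    [NormedAddCommGroup F] [NormedSpace ℝ F] {f : E → F} {x : E} (hf : ContDiffAt ℝ 1 f x) (v : E) :
    ContinuousAt (fun y => fderiv ℝ f y v) x :=
  ((hf.fderiv_right (m := 0) (by simp)).clm_apply contDiffAt_const).continuousAt

theorem hasDerivAt_integral_of_contDiffAt {P : ℝ × ℝ → ℝ} {O : Set ℝ} (hO : IsOpen O)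
    (hP : ∀ s, ∀ θ ∈ O, ContDiffAt ℝ 1 P (s, θ)) {θ₀ : ℝ} (hθ₀ : θ₀ ∈ O) (a b : ℝ) :
    HasDerivAt (fun θ => ∫ s in a..b, P (s, θ)) (∫ s in a..b, fderiv ℝ P (s, θ₀) (0, 1)) θ₀ := by
  obtain ⟨δ, hδ, hball⟩ := Metric.nhds_basis_closedBall.mem_iff.1 (hO.mem_nhds hθ₀)
  have hK : IsCompact (Set.uIcc a b ×ˢ Metric.closedBall θ₀ δ) :=
    isCompact_uIcc.prod (isCompact_closedBall _ _)
  have hcont : ContinuousOn (fun y => fderiv ℝ P y (0, 1))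
      (Set.uIcc a b ×ˢ Metric.closedBall θ₀ δ) := fun y hy =>
    (continuousAt_fderiv_apply (hP y.1 y.2 (hball hy.2)) _).continuousWithinAt
  obtain ⟨C, hC⟩ := hK.exists_bound_of_continuousOn hcont
  have hc1 : ∀ θ ∈ O, Continuous fun s => P (s, θ) := fun θ hθ =>
    continuous_iff_continuousAt.2 fun s =>
      ContinuousAt.comp (f := fun s => (s, θ)) (hP s θ hθ).continuousAt (by fun_prop)
  have hc2 : Continuous fun s => fderiv ℝ P (s, θ₀) (0, 1) :=
    continuous_iff_continuousAt.2 fun s =>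
      ContinuousAt.comp (f := fun s => (s, θ₀)) (g := fun y => fderiv ℝ P y (0, 1))
        (continuousAt_fderiv_apply (hP s θ₀ hθ₀) _) (by fun_prop)
  refine (intervalIntegral.hasDerivAt_integral_of_dominated_loc_of_deriv_le
    (F := fun θ s => P (s, θ)) (F' := fun θ s => fderiv ℝ P (s, θ) (0, 1))
    (bound := fun _ => C) (Metric.closedBall_mem_nhds θ₀ hδ) ?_ ?_ ?_ ?_ ?_ ?_).2
  · filter_upwards [hO.mem_nhds hθ₀] with θ hθ
    exact (hc1 θ hθ).aestronglyMeasurable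
  · exact (hc1 θ₀ hθ₀).intervalIntegrable _ _
  · exact hc2.aestronglyMeasurable
  · exact ae_of_all _ fun s hs θ hθ => hC (s, θ) ⟨Set.uIoc_subset_uIcc hs, hθ⟩
  · exact intervalIntegrable_const
  · refine ae_of_all _ fun s _ θ hθ => ?_
    exact ((hP s θ (hball hθ)).differentiableAt one_ne_zero).hasFDerivAt.comp_hasDerivAt θ
      ((hasDerivAt_const θ s).prodMk (hasDerivAt_id θ))

theorem integral_fderiv_fst {Q : ℝ × ℝ → ℝ} {θ : ℝ} (hQ : ∀ s, ContDiffAt ℝ 1 Q (s, θ)) (a b : ℝ) :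
    Continuous (fun s => fderiv ℝ Q (s, θ) (1, 0)) ∧
      ∫ s in a..b, fderiv ℝ Q (s, θ) (1, 0) = Q (b, θ) - Q (a, θ) := by
  have hc2 : Continuous fun s => fderiv ℝ Q (s, θ) (1, 0) :=
    continuous_iff_continuousAt.2 fun s =>
      ContinuousAt.comp (f := fun s => (s, θ)) (g := fun y => fderiv ℝ Q y (1, 0))
        (continuousAt_fderiv_apply (hQ s) _) (by fun_prop)
  refine ⟨hc2, intervalIntegral.integral_eq_sub_of_hasDerivAt (f := fun s => Q (s, θ))
    (fun s _ => ?_) (hc2.intervalIntegrable _ _)⟩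
  exact ((hQ s).differentiableAt one_ne_zero).hasFDerivAt.comp_hasDerivAt s
    ((hasDerivAt_id s).prodMk (hasDerivAt_const s θ))

/-- The exterior derivative of the one-form `σ`, evaluated on the vectors `v`, `w`. -/
def curl {E : Type*} [NormedAddCommGroup E] [NormedSpace ℝ E] (σ : E → E →L[ℝ] ℝ) (z v w : E) : ℝ :=
  fderiv ℝ σ z v w - fderiv ℝ σ z w v

/-- The exterior derivative commutes with pull-back to a surface. -/
theorem fderiv_pullback_sub {E : Type*} [NormedAddCommGroup E] [NormedSpace ℝ E]
    {σ : E → E →L[ℝ] ℝ} {Z : ℝ × ℝ → E} {y : ℝ × ℝ} (hZ : ContDiffAt ℝ 2 Z y)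
    (hσ : ContDiffAt ℝ 1 σ (Z y)) (v w : ℝ × ℝ) :
    fderiv ℝ (fun y => σ (Z y) (fderiv ℝ Z y w)) y v -
      fderiv ℝ (fun y => σ (Z y) (fderiv ℝ Z y v)) y w =
        curl σ (Z y) (fderiv ℝ Z y v) (fderiv ℝ Z y w) := by
  have hZ' : HasFDerivAt Z (fderiv ℝ Z y) y := (hZ.differentiableAt two_ne_zero).hasFDerivAt
  have hZ2 : HasFDerivAt (fderiv ℝ Z) (fderiv ℝ (fderiv ℝ Z) y) y :=
    ((hZ.fderiv_right (m := 1) (by norm_num)).differentiableAt one_ne_zero).hasFDerivAt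
  have hσ' : HasFDerivAt (fun y => σ (Z y)) ((fderiv ℝ σ (Z y)).comp (fderiv ℝ Z y)) y :=
    ((hσ.differentiableAt one_ne_zero).hasFDerivAt).comp y hZ'
  have hsymm := hZ.isSymmSndFDerivAt (by simp) v w
  have key : ∀ v w : ℝ × ℝ, fderiv ℝ (fun y => σ (Z y) (fderiv ℝ Z y w)) y v =
      σ (Z y) (fderiv ℝ (fderiv ℝ Z) y v w) +
        fderiv ℝ σ (Z y) (fderiv ℝ Z y v) (fderiv ℝ Z y w) := by
    intro v w
    have h1 : HasFDerivAt (fun y => fderiv ℝ Z y w) _ y := hZ2.clm_apply (hasFDerivAt_const w y)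
    rw [(hσ'.clm_apply h1).fderiv]
    simp
  rw [key, key, hsymm, curl]
  ring

/-- Differentiation of the integral of a one-form along a smooth family of curves. -/
theorem hasDerivAt_integral_pullback {E : Type*} [NormedAddCommGroup E] [NormedSpace ℝ E]
    {σ : E → E →L[ℝ] ℝ} {Z : ℝ × ℝ → E} {O : Set ℝ} (hO : IsOpen O)
    (hZ : ∀ s, ∀ θ ∈ O, ContDiffAt ℝ 2 Z (s, θ))
    (hσ : ∀ s, ∀ θ ∈ O, ContDiffAt ℝ 1 σ (Z (s, θ))) {a b θ₀ : ℝ} (hθ₀ : θ₀ ∈ O)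
    (ha : σ (Z (a, θ₀)) = 0) (hb : σ (Z (b, θ₀)) = 0) :
    HasDerivAt (fun θ => ∫ s in a..b, σ (Z (s, θ)) (fderiv ℝ Z (s, θ) (1, 0)))
      (∫ s in a..b, curl σ (Z (s, θ₀)) (fderiv ℝ Z (s, θ₀) (0, 1)) (fderiv ℝ Z (s, θ₀) (1, 0)))
      θ₀ := by
  have hP : ∀ v : ℝ × ℝ, ∀ s, ∀ θ ∈ O,
      ContDiffAt ℝ 1 (fun y => σ (Z y) (fderiv ℝ Z y v)) (s, θ) := by
    intro v s θ hθ
    have h1 : ContDiffAt ℝ 1 (fun y => σ (Z y)) (s, θ) :=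
      (hσ s θ hθ).comp (s, θ) ((hZ s θ hθ).of_le (by norm_num))
    have h2 : ContDiffAt ℝ 1 (fderiv ℝ Z) (s, θ) := (hZ s θ hθ).fderiv_right (by norm_num)
    exact h1.clm_apply (h2.clm_apply contDiffAt_const)
  have hG := hasDerivAt_integral_of_contDiffAt hO (hP (1, 0)) hθ₀ a b
  obtain ⟨hcQ, hQ⟩ := integral_fderiv_fst (fun s => hP (0, 1) s θ₀ hθ₀) a b
  rw [ha, hb] at hQ
  simp only [zero_apply, sub_zero] at hQ
  have hc1 : Continuous fun s =>
      fderiv ℝ (fun y => σ (Z y) (fderiv ℝ Z y (1, 0))) (s, θ₀) (0, 1) :=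
    continuous_iff_continuousAt.2 fun s =>
      ContinuousAt.comp (f := fun s => (s, θ₀))
        (g := fun y => fderiv ℝ (fun y => σ (Z y) (fderiv ℝ Z y (1, 0))) y (0, 1))
        (continuousAt_fderiv_apply (hP (1, 0) s θ₀ hθ₀) _) (by fun_prop)
  refine hG.congr_deriv ?_
  have hsub := intervalIntegral.integral_sub (μ := volume) (hc1.intervalIntegrable a b)
    (hcQ.intervalIntegrable a b)
  rw [hQ, sub_zero] at hsub
  rw [← hsub]
  refine intervalIntegral.integral_congr fun s _ => ?_
  exact fderiv_pullback_sub (hZ s θ₀ hθ₀) (hσ s θ₀ hθ₀) (0, 1) (1, 0)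

/-! ### Passage to the limit in the regularization -/

/-- The integral of `a + N / (|ε| + tX + tY)` along the regularized curve.  At `ε = 0` the quotient
has the junk value `0` where the gradient of `t` vanishes; it is only used when this happens for
almost no `s`. -/
def sliceIntegral (t tX tY : ℝ × ℝ × ℝ → ℝ) (M : ℝ) (a N : ℝ × ℝ × ℝ → ℝ) (θ ε : ℝ) : ℝ :=
  ∫ s in -M..M, (a (levelPt t (s, θ, ε)) + N (levelPt t (s, θ, ε)) /
    (|ε| + (tX (levelPt t (s, θ, ε)) + tY (levelPt t (s, θ, ε)))))

/-- If the derivatives `D θ ε` of `G · ε`, known for `ε ≠ 0` only, extend continuously to `ε = 0`,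
then `G · 0` is differentiable as well. -/
theorem hasDerivAt_of_regularization {G D : ℝ → ℝ → ℝ} {θ₀ : ℝ}
    (hG : ∀ᶠ θ in 𝓝 θ₀, ContinuousAt (fun y : ℝ × ℝ => G y.1 y.2) (θ, 0))
    (hD : ContinuousAt (fun y : ℝ × ℝ => D y.1 y.2) (θ₀, 0))
    (hder : ∀ᶠ y : ℝ × ℝ in 𝓝 (θ₀, 0),
      y.2 ≠ 0 → HasDerivAt (fun θ => G θ y.2) (D y.1 y.2) y.1) :
    HasDerivAt (fun θ => G θ 0) (D θ₀ 0) θ₀ := by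
  have hle : (𝓝[≠] (0 : ℝ)) ×ˢ 𝓝 θ₀ ≤ 𝓝 ((0 : ℝ), θ₀) := by
    rw [nhds_prod_eq]
    exact prod_mono_left _ nhdsWithin_le_nhds
  have hswap : Tendsto (Prod.swap : ℝ × ℝ → ℝ × ℝ) (𝓝[≠] (0 : ℝ) ×ˢ 𝓝 θ₀) (𝓝 (θ₀, (0 : ℝ))) :=
    (continuous_swap.tendsto ((0 : ℝ), θ₀)).mono_left hle
  refine hasDerivAt_of_tendstoUniformlyOnFilter (l := 𝓝[≠] (0 : ℝ)) (f := fun ε θ => G θ ε)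
    (f' := fun ε θ => D θ ε) (g' := fun θ => D θ 0) ?_ ?_ ?_
  · rw [Metric.tendstoUniformlyOnFilter_iff]
    intro η hη
    have h1 := Metric.continuousAt_iff'.1 hD (η / 2) (half_pos hη)
    have h2 : Tendsto (fun n : ℝ × ℝ => (n.2, (0 : ℝ))) (𝓝[≠] (0 : ℝ) ×ˢ 𝓝 θ₀)
        (𝓝 (θ₀, (0 : ℝ))) :=
      (Continuous.tendsto (by fun_prop : Continuous fun n : ℝ × ℝ => (n.2, (0 : ℝ)))
        ((0 : ℝ), θ₀)).mono_left hle
    filter_upwards [hswap.eventually h1, h2.eventually h1] with n hn1 hn2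
    have h3 : dist (D n.2 n.1) (D θ₀ 0) < η / 2 := hn1
    have h4 : dist (D n.2 0) (D θ₀ 0) < η / 2 := hn2
    linarith [dist_triangle_right (D n.2 0) (D n.2 n.1) (D θ₀ 0)]
  · have hne : ∀ᶠ n : ℝ × ℝ in 𝓝[≠] (0 : ℝ) ×ˢ 𝓝 θ₀, n.1 ≠ 0 :=
      (eventually_mem_nhdsWithin (a := (0 : ℝ)) (s := {0}ᶜ)).prod_inl _
    filter_upwards [hswap.eventually hder, hne] with n hn hn0
    exact hn hn0
  · filter_upwards [hG] with θ hθ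
    have h1 : Tendsto (fun ε : ℝ => (θ, ε)) (𝓝[≠] 0) (𝓝 (θ, 0)) :=
      ((Continuous.prodMk_right θ).tendsto 0).mono_left nhdsWithin_le_nhds
    exact Tendsto.comp (g := fun y : ℝ × ℝ => G y.1 y.2) hθ h1

namespace LevelFamily

variable {t tX tY : ℝ × ℝ × ℝ → ℝ}

/-- The quotient is bounded uniformly in `ε` because `N` is controlled by the gradient of `t`;
continuity up to `ε = 0` is dominated convergence. -/
theorem continuousAt_sliceIntegral (h : LevelFamily t tX tY) {O : Set ℝ} (hO : IsOpen O)
    {a N B : ℝ × ℝ × ℝ → ℝ} (ha : ∀ z, z.2.2 ∈ O → ContinuousAt a z)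
    (hN : ∀ z, z.2.2 ∈ O → ContinuousAt N z) (hB : ∀ z, z.2.2 ∈ O → ContinuousAt B z)
    (hNB : ∀ z, z.2.2 ∈ O → |N z| ≤ B z * (tX z + tY z)) (M : ℝ) {θ₀ : ℝ} (hθ₀ : θ₀ ∈ O)
    (hnd : ∀ᵐ s, 0 < tX (levelPt t (s, θ₀, 0)) + tY (levelPt t (s, θ₀, 0))) :
    ContinuousAt (fun y : ℝ × ℝ => sliceIntegral t tX tY M a N y.1 y.2) (θ₀, 0) := by
  obtain ⟨δ, hδ, hball⟩ := Metric.nhds_basis_closedBall.mem_iff.1 (hO.mem_nhds hθ₀)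
  have hK : IsCompact (Set.uIcc (-M) M ×ˢ Metric.closedBall θ₀ δ ×ˢ Metric.closedBall (0 : ℝ) 1) :=
    isCompact_uIcc.prod ((isCompact_closedBall _ _).prod (isCompact_closedBall _ _))
  have hpt := h.continuous_levelPt
  have hcomp : ∀ {g : ℝ × ℝ × ℝ → ℝ}, (∀ z, z.2.2 ∈ O → ContinuousAt g z) →
      ∀ w : ℝ × ℝ × ℝ, w.2.1 ∈ O → ContinuousAt (fun w => g (levelPt t w)) w :=
    fun hg w hw => (hg (levelPt t w) hw).comp hpt.continuousAt
  have hcont : ContinuousOn (fun w => |a (levelPt t w)| + |B (levelPt t w)|)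
      (Set.uIcc (-M) M ×ˢ Metric.closedBall θ₀ δ ×ˢ Metric.closedBall (0 : ℝ) 1) := fun w hw =>
    ((hcomp ha w (hball hw.2.1)).abs.add (hcomp hB w (hball hw.2.1)).abs).continuousWithinAt
  obtain ⟨C, hC⟩ := hK.exists_bound_of_continuousOn hcont
  have hnhds : Metric.closedBall θ₀ δ ×ˢ Metric.closedBall (0 : ℝ) 1 ∈ 𝓝 (θ₀, (0 : ℝ)) :=
    prod_mem_nhds (Metric.closedBall_mem_nhds _ hδ) (Metric.closedBall_mem_nhds _ one_pos)
  have hslice : ∀ {g : ℝ × ℝ × ℝ → ℝ}, (∀ z, z.2.2 ∈ O → ContinuousAt g z) →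
      ∀ y : ℝ × ℝ, y.1 ∈ O → Continuous fun s => g (levelPt t (s, y.1, y.2)) :=
    fun hg y hy => continuous_iff_continuousAt.2 fun s =>
      ContinuousAt.comp (f := fun s => (s, y.1, y.2)) (hcomp hg (s, y.1, y.2) hy) (by fun_prop)
  have htr : ∀ z, z.2.2 ∈ O → ContinuousAt (fun z => tX z + tY z) z := fun z _ =>
    (h.cont_X.add h.cont_Y).continuousAt
  refine intervalIntegral.continuousAt_of_dominated_interval (bound := fun _ => C) ?_ ?_
    intervalIntegrable_const ?_
  · filter_upwards [hnhds] with y hy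
    refine (Measurable.aestronglyMeasurable ?_)
    exact (hslice ha y (hball hy.1)).measurable.add ((hslice hN y (hball hy.1)).measurable.div
      (measurable_const.add (hslice htr y (hball hy.1)).measurable))
  · filter_upwards [hnhds] with y hy
    refine ae_of_all _ fun s hs => ?_
    set z := levelPt t (s, y.1, y.2)
    have hzO : z.2.2 ∈ O := hball hy.1
    have hb := hC (s, y.1, y.2) ⟨Set.uIoc_subset_uIcc hs, hy⟩
    rw [Real.norm_eq_abs, abs_of_nonneg (by positivity)] at hb
    refine le_trans ?_ hb
    rw [Real.norm_eq_abs]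
    refine (abs_add_le _ _).trans (add_le_add le_rfl ?_)
    have h0 : 0 ≤ tX z + tY z := add_nonneg (h.X_nonneg z) (h.Y_nonneg z)
    have h1 : |N z| ≤ |B z| * (tX z + tY z) :=
      (hNB z hzO).trans (mul_le_mul_of_nonneg_right (le_abs_self _) h0)
    rw [abs_div, abs_of_nonneg (add_nonneg (abs_nonneg y.2) h0)]
    refine div_le_of_le_mul₀ (add_nonneg (abs_nonneg y.2) h0) (abs_nonneg _) (h1.trans ?_)
    exact mul_le_mul_of_nonneg_left (le_add_of_nonneg_left (abs_nonneg _)) (abs_nonneg _)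
  · filter_upwards [hnd] with s hs _
    have hins : ContinuousAt (fun y : ℝ × ℝ => (s, y.1, y.2)) (θ₀, 0) := by fun_prop
    have hg : ∀ {g : ℝ × ℝ × ℝ → ℝ}, (∀ z, z.2.2 ∈ O → ContinuousAt g z) →
        ContinuousAt (fun y : ℝ × ℝ => g (levelPt t (s, y.1, y.2))) (θ₀, 0) := fun hg =>
      ContinuousAt.comp' (f := fun y : ℝ × ℝ => (s, y.1, y.2)) (hcomp hg (s, θ₀, 0) hθ₀) hins
    refine (hg ha).add ((hg hN).div ?_ ?_)
    · exact ContinuousAt.add (by fun_prop) (hg htr)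
    · simpa using hs.ne'

/-- First variation, along the curves `{t = 0}`, of the integral of a one-form `σ` on
`(X, Y, θ)`-space.  The curves need not depend smoothly on `θ` where the gradient of `t` vanishes;
it is enough that the exterior derivative of `σ` in the `(X, Y)`-plane is controlled by the gradient
of `t`. -/
theorem hasDerivAt_sliceIntegral (h : LevelFamily t tX tY) {O : Set ℝ} (hO : IsOpen O)
    (hsm : ∀ z : ℝ × ℝ × ℝ, z.2.2 ∈ O → ContDiffAt ℝ 2 t z)
    {σ : ℝ × ℝ × ℝ → ℝ × ℝ × ℝ →L[ℝ] ℝ} (hσ : ∀ z, z.2.2 ∈ O → ContDiffAt ℝ 1 σ z)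
    {B : ℝ × ℝ × ℝ → ℝ} (hB : ∀ z, z.2.2 ∈ O → ContinuousAt B z)
    (hcurl : ∀ z, z.2.2 ∈ O → |curl σ z (1, 1, 0) (1, -1, 0)| ≤ B z * (tX z + tY z))
    {M θ₀ : ℝ} (hθ₀ : θ₀ ∈ O)
    (hnd : ∀ θ ∈ O, ∀ᵐ s, 0 < tX (levelPt t (s, θ, 0)) + tY (levelPt t (s, θ, 0)))
    (hbdry : ∀ᶠ y : ℝ × ℝ in 𝓝 (θ₀, 0),
      σ (levelPt t (-M, y.1, y.2)) = 0 ∧ σ (levelPt t (M, y.1, y.2)) = 0) :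
    HasDerivAt (fun θ => sliceIntegral t tX tY M (fun z => σ z (1, -1, 0))
        (fun z => -(tX z - tY z) * σ z (1, 1, 0)) θ 0)
      (sliceIntegral t tX tY M (fun z => curl σ z (0, 0, 1) (1, -1, 0))
        (fun z => -(tX z - tY z) * curl σ z (0, 0, 1) (1, 1, 0) +
          -(fderiv ℝ t z (0, 0, 1)) * curl σ z (1, 1, 0) (1, -1, 0)) θ₀ 0) θ₀ := by
  set G : ℝ → ℝ → ℝ := sliceIntegral t tX tY M (fun z => σ z (1, -1, 0))
        (fun z => -(tX z - tY z) * σ z (1, 1, 0))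
  set D : ℝ → ℝ → ℝ := sliceIntegral t tX tY M (fun z => curl σ z (0, 0, 1) (1, -1, 0))
        (fun z => -(tX z - tY z) * curl σ z (0, 0, 1) (1, 1, 0) +
          -(fderiv ℝ t z (0, 0, 1)) * curl σ z (1, 1, 0) (1, -1, 0))
  have habs : ∀ z, |tX z - tY z| ≤ tX z + tY z := fun z => by
    have := h.X_nonneg z
    have := h.Y_nonneg z
    rw [abs_le]; constructor <;> linarith
  have hcσ : ∀ v : ℝ × ℝ × ℝ, ∀ z, z.2.2 ∈ O → ContinuousAt (fun z => σ z v) z := fun v z hz =>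
    (hσ z hz).continuousAt.clm_apply continuousAt_const
  have hcurlc : ∀ v w : ℝ × ℝ × ℝ, ∀ z, z.2.2 ∈ O → ContinuousAt (fun z => curl σ z v w) z :=
    fun v w z hz =>
      ((continuousAt_fderiv_apply (hσ z hz) v).clm_apply continuousAt_const).sub
        ((continuousAt_fderiv_apply (hσ z hz) w).clm_apply continuousAt_const)
  have hctt : ∀ z : ℝ × ℝ × ℝ, ContinuousAt (fun z => -(tX z - tY z)) z := fun z =>
    (h.cont_X.sub h.cont_Y).neg.continuousAt
  have hctθ : ∀ z : ℝ × ℝ × ℝ, z.2.2 ∈ O → ContinuousAt (fun z => fderiv ℝ t z (0, 0, 1)) z :=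
    fun z hz => continuousAt_fderiv_apply ((hsm z hz).of_le (by norm_num)) _
  -- the integrals and their derivatives are continuous up to `ε = 0`
  have hG : ∀ θ ∈ O, ContinuousAt (fun y : ℝ × ℝ => G y.1 y.2) (θ, 0) := by
    intro θ hθ
    refine h.continuousAt_sliceIntegral hO (a := fun z => σ z (1, -1, 0))
      (N := fun z => -(tX z - tY z) * σ z (1, 1, 0)) (B := fun z => |σ z (1, 1, 0)|) (hcσ _)
      (fun z hz => (hctt z).mul (hcσ _ z hz)) (fun z hz => (hcσ _ z hz).abs) ?_ M hθ (hnd θ hθ)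
    intro z _
    rw [abs_mul, abs_neg, mul_comm]
    exact mul_le_mul_of_nonneg_left (habs z) (abs_nonneg _)
  have hD : ContinuousAt (fun y : ℝ × ℝ => D y.1 y.2) (θ₀, 0) := by
    refine h.continuousAt_sliceIntegral hO
      (a := fun z => curl σ z (0, 0, 1) (1, -1, 0))
      (N := fun z => -(tX z - tY z) * curl σ z (0, 0, 1) (1, 1, 0) +
        -(fderiv ℝ t z (0, 0, 1)) * curl σ z (1, 1, 0) (1, -1, 0))
      (B := fun z => |curl σ z (0, 0, 1) (1, 1, 0)| + |fderiv ℝ t z (0, 0, 1)| * B z)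
      (hcurlc _ _) (fun z hz => ((hctt z).mul (hcurlc _ _ z hz)).add
        ((hctθ z hz).neg.mul (hcurlc _ _ z hz)))
      (fun z hz => (hcurlc _ _ z hz).abs.add ((hctθ z hz).abs.mul (hB z hz))) ?_ M hθ₀ (hnd θ₀ hθ₀)
    intro z hz
    refine (abs_add_le _ _).trans ?_
    rw [abs_mul, abs_mul, abs_neg, abs_neg, add_mul, mul_assoc, mul_comm |tX z - tY z|]
    exact add_le_add (mul_le_mul_of_nonneg_left (habs z) (abs_nonneg _))
      (mul_le_mul_of_nonneg_left (hcurl z hz) (abs_nonneg _))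
  refine hasDerivAt_of_regularization (G := G) (D := D) ?_ hD ?_
  · filter_upwards [hO.mem_nhds hθ₀] with θ hθ using hG θ hθ
  · have hmem : ∀ᶠ y : ℝ × ℝ in 𝓝 (θ₀, 0), y.1 ∈ O :=
      continuousAt_fst.eventually_mem (hO.mem_nhds hθ₀)
    filter_upwards [hbdry, hmem] with y hbn hθ hε
    obtain ⟨θ, ε⟩ := y
    simp only at hθ hε hbn ⊢
    have hZ : ∀ s, ∀ θ ∈ O, ContDiffAt ℝ 2 (fun y : ℝ × ℝ => levelPt t (y.1, y.2, ε)) (s, θ) := by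
      intro s θ hθ
      have := h.contDiffAt_height hε (s := s) (θ := θ) (hsm _ hθ)
      exact (this.add contDiffAt_fst).prodMk ((this.sub contDiffAt_fst).prodMk contDiffAt_snd)
    have hder := hasDerivAt_integral_pullback hO hZ (fun s θ hθ => hσ (levelPt t (s, θ, ε)) hθ)
      hθ hbn.1 hbn.2
    have hint : ∀ θ ∈ O, G θ ε = ∫ s in -M..M, σ (levelPt t (s, θ, ε))
          (fderiv ℝ (fun y : ℝ × ℝ => levelPt t (y.1, y.2, ε)) (s, θ) (1, 0)) := by
      intro θ hθ
      refine intervalIntegral.integral_congr fun s _ => ?_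
      simp only
      rw [(h.hasFDerivAt_levelPt hε (s := s) (hsm _ hθ)).1, map_add, map_smul, smul_eq_mul]
      ring
    refine (hder.congr_of_eventuallyEq ?_).congr_deriv ?_
    · filter_upwards [hO.mem_nhds hθ] with θ' hθ'
      exact hint θ' hθ'
    · refine intervalIntegral.integral_congr fun s _ => ?_
      simp only
      rw [(h.hasFDerivAt_levelPt hε (s := s) (hsm _ hθ)).1,
        (h.hasFDerivAt_levelPt hε (s := s) (hsm _ hθ)).2]
      simp only [curl, map_add, map_smul, smul_eq_mul, add_apply,
        smul_apply]
      ring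

end LevelFamily

/-! ### Parametrization of the curve `{t = 0}` -/

/-- `σ` is an increasing bijection of the line, locally absolutely continuous with derivative
`h`. -/
structure HasDensity (σ h : ℝ → ℝ) : Prop where
  mono : StrictMono σ
  surj : Function.Surjective σ
  nonneg : ∀ x, 0 ≤ h x
  locInt : LocallyIntegrable h
  eq : ∀ y z, σ z - σ y = ∫ x in y..z, h x

namespace HasDensity

variable {σ h : ℝ → ℝ}

theorem map_withDensity (H : HasDensity σ h) :
    (volume.withDensity fun x => ENNReal.ofReal (h x)).map σ = volume := by
  symm
  refine Measure.ext_of_Ioc _ _ fun a b hab => ?_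
  obtain ⟨y, rfl⟩ := H.surj a
  obtain ⟨z, rfl⟩ := H.surj b
  have hyz : y < z := H.mono.lt_iff_lt.1 hab
  have hpre : σ ⁻¹' Set.Ioc (σ y) (σ z) = Set.Ioc y z := by
    ext x; simp [H.mono.lt_iff_lt, H.mono.le_iff_le]
  have hint : IntegrableOn h (Set.Ioc y z) :=
    (H.locInt.integrableOn_isCompact isCompact_Icc).mono_set Set.Ioc_subset_Icc_self
  rw [Measure.map_apply H.mono.monotone.measurable measurableSet_Ioc, hpre,
    withDensity_apply _ measurableSet_Ioc, Real.volume_Ioc, H.eq,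
    intervalIntegral.integral_of_le hyz.le,
    ofReal_integral_eq_lintegral_ofReal hint (ae_of_all _ H.nonneg)]

theorem measurableEmbedding (H : HasDensity σ h) : MeasurableEmbedding σ :=
  (H.mono.orderIsoOfSurjective σ H.surj).toHomeomorph.measurableEmbedding

theorem lintegral_eq (H : HasDensity σ h) (g : ℝ → ENNReal) :
    ∫⁻ s, g s = ∫⁻ x, g (σ x) * ENNReal.ofReal (h x) := by
  have hm := H.locInt.aestronglyMeasurable.aemeasurable.ennreal_ofReal
  conv_lhs => rw [← H.map_withDensity]
  rw [H.measurableEmbedding.lintegral_map,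
    lintegral_withDensity_eq_lintegral_mul_non_measurable₀ _ hm (ae_of_all _ fun x => by simp)]
  simp only [Pi.mul_apply, mul_comm]

theorem integral_eq (H : HasDensity σ h) (g : ℝ → ℝ) : ∫ s, g s = ∫ x, g (σ x) * h x := by
  have hm := H.locInt.aestronglyMeasurable.aemeasurable.ennreal_ofReal
  conv_lhs => rw [← H.map_withDensity]
  rw [H.measurableEmbedding.integral_map,
    integral_withDensity_eq_integral_toReal_smul₀ hm (ae_of_all _ fun x => by simp)]
  simp only [ENNReal.toReal_ofReal (H.nonneg _), smul_eq_mul, mul_comm]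

theorem ae_of_ae_comp (H : HasDensity σ h) {S : ℝ → Prop} (hS : ∀ᵐ x, S (σ x)) : ∀ᵐ s, S s := by
  rw [← H.map_withDensity, H.measurableEmbedding.ae_map_iff]
  exact (withDensity_absolutelyContinuous _ _).ae_le hS

end HasDensity

theorem eq_zero_of_hasDerivAt_of_eq_left {f : ℝ → ℝ} {f' x y : ℝ} (hf : HasDerivAt f f' x)
    (hyx : y < x) (heq : ∀ z ∈ Set.Icc y x, f z = f x) : f' = 0 := by
  have h1 : HasDerivWithinAt f 0 (Set.Icc y x) x :=
    (hasDerivWithinAt_const x _ (f x)).congr heq rfl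
  exact (uniqueDiffOn_Icc hyx x ⟨hyx.le, le_rfl⟩).eq_deriv _ hf.hasDerivWithinAt h1

theorem eq_zero_of_hasDerivAt_of_eq_right {f : ℝ → ℝ} {f' x y : ℝ} (hf : HasDerivAt f f' x)
    (hxy : x < y) (heq : ∀ z ∈ Set.Icc x y, f z = f x) : f' = 0 := by
  have h1 : HasDerivWithinAt f 0 (Set.Icc x y) x :=
    (hasDerivWithinAt_const x _ (f x)).congr heq rfl
  exact (uniqueDiffOn_Icc hxy x ⟨le_rfl, hxy.le⟩).eq_deriv _ hf.hasDerivWithinAt h1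

theorem one_add_cos_eq (α : ℝ) : 1 + Real.cos α = 2 * Real.cos (α / 2) ^ 2 := by
  have := Real.cos_sq (α / 2)
  rw [mul_div_cancel₀ α two_ne_zero] at this
  linarith

/-- The relation `tan (α / 2) = R`, in the form in which it is used. -/
theorem half_angle {R α : ℝ} (h : R * Real.cos (α / 2) = Real.sin (α / 2)) :
    0 < Real.cos (α / 2) ^ 2 ∧ (1 + R ^ 2) * Real.cos (α / 2) ^ 2 = 1 ∧
      R ^ 2 = Real.sin (α / 2) ^ 2 * (1 + R ^ 2) := by
  have h1 := Real.sin_sq_add_cos_sq (α / 2)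
  have h2 : (1 + R ^ 2) * Real.cos (α / 2) ^ 2 = 1 := by rw [← h] at h1; linarith
  refine ⟨?_, h2, ?_⟩
  · refine lt_of_le_of_ne (sq_nonneg _) fun h0 => ?_
    rw [← h0] at h2
    simp at h2
  · have : Real.sin (α / 2) ^ 2 = 1 - Real.cos (α / 2) ^ 2 := by linarith
    rw [this, sub_mul, mul_comm (Real.cos (α / 2) ^ 2), h2]
    ring

namespace CharFields

variable {c : ℝ → ℝ} {F : CharFields} {a : WaveData} {ξ η : ℝ → ℝ}

theorem Solves.t_mono (hs : F.Solves c) (hc : ∀ v, 0 < c v) {X X' Y Y' : ℝ} (hX : X ≤ X')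
    (hY : Y ≤ Y') : F.t X Y ≤ F.t X' Y' := by
  have hcos : ∀ α, 0 ≤ 1 + Real.cos α := fun α => by linarith [Real.neg_one_le_cos α]
  have h1 : Monotone fun X => F.t X Y :=
    monotone_of_hasDerivAt_nonneg (fun X => hs.t_X X Y) fun X => div_nonneg
      (mul_nonneg (hcos _) (hs.p_pos _ _).le) (mul_pos four_pos (hc _)).le
  have h2 : Monotone fun Y => F.t X' Y :=
    monotone_of_hasDerivAt_nonneg (fun Y => hs.t_Y X' Y) fun Y => div_nonneg
      (mul_nonneg (hcos _) (hs.q_pos _ _).le) (mul_pos four_pos (hc _)).le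
  exact (h1 hX).trans (h2 hY)

namespace HasData

theorem ξ_mono (hd : F.HasData c a ξ η) (hs : F.Solves c) : Monotone ξ := fun y z hyz => by
  rw [← sub_nonneg, hd.dX_eq]
  exact intervalIntegral.integral_nonneg hyz fun x _ =>
    div_nonneg (by positivity) (hs.p_pos _ _).le

theorem η_anti (hd : F.HasData c a ξ η) (hs : F.Solves c) : Antitone η := fun y z hyz => by
  rw [← sub_nonneg, ← neg_sub, hd.dY_eq, neg_neg]
  exact intervalIntegral.integral_nonneg hyz fun x _ =>
    div_nonneg (by positivity) (hs.q_pos _ _).le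

theorem ξ_cont (hd : F.HasData c a ξ η) (hs : F.Solves c) : Continuous ξ :=
  (hd.ξ_mono hs).continuous_of_surjective hd.ξ_surj

theorem η_cont (hd : F.HasData c a ξ η) (hs : F.Solves c) : Continuous η := by
  have h1 : Monotone fun x => -η x := (hd.η_anti hs).neg
  have h2 : Function.Surjective fun x => -η x := fun y => by
    obtain ⟨x, hx⟩ := hd.η_surj (-y)
    exact ⟨x, by simp [hx]⟩
  exact continuous_neg_iff.1 (h1.continuous_of_surjective h2)

/-- The line coordinate `(X - Y) / 2` of the point of the curve above `x`, which is an increasing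
bijection of the line. -/
theorem hasDensity (hd : F.HasData c a ξ η) (hs : F.Solves c)
    (hp : Continuous fun z : ℝ × ℝ => F.p z.1 z.2) (hq : Continuous fun z : ℝ × ℝ => F.q z.1 z.2)
    (hR : LocallyIntegrable fun x => 1 + a.R c x ^ 2)
    (hS : LocallyIntegrable fun x => 1 + a.S c x ^ 2) :
    HasDensity (fun x => (ξ x - η x) / 2) (fun x => ((1 + a.R c x ^ 2) / F.p (ξ x) (η x) +
      (1 + a.S c x ^ 2) / F.q (ξ x) (η x)) / 2) := by
  have hξ := hd.ξ_cont hs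
  have hη := hd.η_cont hs
  have hpc : Continuous fun x => (F.p (ξ x) (η x))⁻¹ :=
    (hp.comp (hξ.prodMk hη)).inv₀ fun x => (hs.p_pos _ _).ne'
  have hqc : Continuous fun x => (F.q (ξ x) (η x))⁻¹ :=
    (hq.comp (hξ.prodMk hη)).inv₀ fun x => (hs.q_pos _ _).ne'
  have h1 : LocallyIntegrable fun x => (1 + a.R c x ^ 2) / F.p (ξ x) (η x) := by
    simp only [div_eq_mul_inv]
    exact (hR.locallyIntegrableOn _).mul_continuousOn hpc.continuousOn isOpen_univ.isLocallyClosed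
      |> locallyIntegrableOn_univ.1
  have h2 : LocallyIntegrable fun x => (1 + a.S c x ^ 2) / F.q (ξ x) (η x) := by
    simp only [div_eq_mul_inv]
    exact (hS.locallyIntegrableOn _).mul_continuousOn hqc.continuousOn isOpen_univ.isLocallyClosed
      |> locallyIntegrableOn_univ.1
  have hmono : Monotone fun x => (ξ x - η x) / 2 := fun y z hyz => by
    have := hd.ξ_mono hs hyz
    have := hd.η_anti hs hyz
    simp only
    linarith
  have hinj : Function.Injective fun x => (ξ x - η x) / 2 := by
    have key : ∀ y z, y ≤ z → (ξ y - η y) / 2 = (ξ z - η z) / 2 → y = z := by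
      intro y z hyz h
      have h1 := hd.ξ_mono hs hyz
      have h2 := hd.η_anti hs hyz
      rw [← hd.x_eq y, ← hd.x_eq z, show ξ y = ξ z by linarith, show η y = η z by linarith]
    intro y z h
    rcases le_total y z with hyz | hyz
    · exact key y z hyz h
    · exact (key z y hyz h.symm).symm
  have hcont : Continuous fun x => (ξ x - η x) / 2 := by fun_prop
  refine ⟨hmono.strictMono_of_injective hinj, ?_, ?_, ?_, ?_⟩
  · intro s
    -- `ξ` and `-η` are unbounded in both directions
    obtain ⟨x₁, hx₁⟩ := hd.ξ_surj s
    obtain ⟨x₂, hx₂⟩ := hd.η_surj (-s)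
    have hlo : (ξ (min x₁ x₂) - η (min x₁ x₂)) / 2 ≤ s := by
      have := hd.ξ_mono hs (min_le_left x₁ x₂)
      have := hd.η_anti hs (min_le_right x₁ x₂)
      linarith
    have hhi : s ≤ (ξ (max x₁ x₂) - η (max x₁ x₂)) / 2 := by
      have := hd.ξ_mono hs (le_max_left x₁ x₂)
      have := hd.η_anti hs (le_max_right x₁ x₂)
      linarith
    obtain ⟨x, -, hx⟩ := intermediate_value_Icc
      ((min_le_left x₁ x₂).trans (le_max_left x₁ x₂)) hcont.continuousOn ⟨hlo, hhi⟩
    exact ⟨x, hx⟩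
  · intro x
    have := hs.p_pos (ξ x) (η x)
    have := hs.q_pos (ξ x) (η x)
    positivity
  · simp only [div_eq_mul_inv _ (2 : ℝ), mul_comm _ (2 : ℝ)⁻¹]
    exact (h1.add h2).smul (2 : ℝ)⁻¹
  · intro y z
    rw [intervalIntegral.integral_div, intervalIntegral.integral_add
      (h1.integrableOn_isCompact isCompact_uIcc).intervalIntegrable
      (h2.integrableOn_isCompact isCompact_uIcc).intervalIntegrable, ← hd.dX_eq,
      ← neg_neg (∫ x in y..z, (1 + a.S c x ^ 2) / F.q (ξ x) (η x)), ← hd.dY_eq]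
    ring

/-- Since `tan (α / 2) = R` almost everywhere, `t` is not stationary in `X` along any arc of the
curve. -/
theorem exists_cos_ne (hd : F.HasData c a ξ η) {U : Set ℝ} (hU : IsOpen U) (hne : U.Nonempty) :
    ∃ x ∈ U, 0 < 1 + Real.cos (F.α (ξ x) (η x)) := by
  by_contra! hcon
  have h0 : volume U ≠ 0 := (hU.measure_pos volume hne).ne'
  apply h0
  refine measure_mono_null (fun x hx => ?_) (ae_iff.1 hd.α_eq)
  intro h
  have h1 := (half_angle h).1
  have h2 := hcon x hx
  rw [one_add_cos_eq] at h2
  linarith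

/-- Off the curve, `t` has a sign: it is nonzero in the open quadrants below and above each point
of the curve. -/
theorem t_ne_zero (hd : F.HasData c a ξ η) (hs : F.Solves c) (hc : ∀ v, 0 < c v) {X Y x₀ : ℝ}
    (hXY : (X < ξ x₀ ∧ Y < η x₀) ∨ (ξ x₀ < X ∧ η x₀ < Y)) : F.t X Y ≠ 0 := by
  intro h0
  have hξ := hd.ξ_cont hs
  have hη := hd.η_cont hs
  have hfin : ∀ x, (1 + Real.cos (F.α (ξ x) (η x))) * F.p (ξ x) (η x) /
      (4 * c (F.u (ξ x) (η x))) = 0 → ¬ 0 < 1 + Real.cos (F.α (ξ x) (η x)) := by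
    intro x h hpos
    have := div_pos (mul_pos hpos (hs.p_pos (ξ x) (η x))) (mul_pos four_pos (hc (F.u (ξ x) (η x))))
    exact this.ne' h
  rcases hXY with ⟨hX, hY⟩ | ⟨hX, hY⟩
  · obtain ⟨x, ⟨hxX, hxY⟩, hx⟩ := hd.exists_cos_ne
      (U := {x | X < ξ x} ∩ {x | Y < η x})
      ((isOpen_lt continuous_const hξ).inter (isOpen_lt continuous_const hη)) ⟨x₀, hX, hY⟩
    refine hfin x (eq_zero_of_hasDerivAt_of_eq_left (hs.t_X (ξ x) (η x)) hxX fun z hz => ?_) hx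
    rw [hd.t_eq]
    refine le_antisymm ((hs.t_mono hc hz.2 le_rfl).trans_eq (hd.t_eq x)) ?_
    exact h0.symm.trans_le (hs.t_mono hc hz.1 (le_of_lt hxY))
  · obtain ⟨x, ⟨hxX, hxY⟩, hx⟩ := hd.exists_cos_ne
      (U := {x | ξ x < X} ∩ {x | η x < Y})
      ((isOpen_lt hξ continuous_const).inter (isOpen_lt hη continuous_const)) ⟨x₀, hX, hY⟩
    refine hfin x (eq_zero_of_hasDerivAt_of_eq_right (hs.t_X (ξ x) (η x)) hxX fun z hz => ?_) hx
    rw [hd.t_eq]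
    refine le_antisymm ((hs.t_mono hc hz.2 (le_of_lt hxY)).trans_eq h0) ?_
    exact (hd.t_eq x).symm.trans_le (hs.t_mono hc hz.1 le_rfl)

/-- On the line `X = r + s`, `Y = r - s`, the only zero of `t` is the point of the curve. -/
theorem t_eq_zero_iff (hd : F.HasData c a ξ η) (hs : F.Solves c) (hc : ∀ v, 0 < c v) (x r : ℝ) :
    F.t (r + (ξ x - η x) / 2) (r - (ξ x - η x) / 2) = 0 ↔ r = (ξ x + η x) / 2 := by
  constructor
  · intro h
    by_contra hne
    refine hd.t_ne_zero hs hc (x₀ := x) ?_ h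
    rcases lt_or_gt_of_ne hne with h1 | h1
    · left; constructor <;> linarith
    · right; constructor <;> linarith
  · rintro rfl
    convert hd.t_eq x using 2 <;> ring

end HasData

end CharFields

/-- The energy density `u₁² + c²(u₀) u₀ₓ²`. -/
def WaveData.density (c : ℝ → ℝ) (a : WaveData) (x : ℝ) : ℝ :=
  a.vel x ^ 2 + c (a.pos x) ^ 2 * deriv a.pos x ^ 2

theorem WaveData.density_nonneg (c : ℝ → ℝ) (a : WaveData) (x : ℝ) : 0 ≤ a.density c x := by
  unfold density; positivity

theorem WaveData.density_eq (c : ℝ → ℝ) (a : WaveData) (x : ℝ) :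
    a.density c x = (a.R c x ^ 2 + a.S c x ^ 2) / 2 := by
  unfold density R S; ring

section

variable {c : ℝ → ℝ} {a : WaveData}

theorem WaveData.Admissible.aestronglyMeasurable (ha : a.Admissible) (hc : Continuous c) :
    AEStronglyMeasurable (a.R c) ∧ AEStronglyMeasurable (a.S c) ∧
      AEStronglyMeasurable (a.density c) := by
  have h1 : AEStronglyMeasurable (fun x => c (a.pos x)) :=
    hc.comp_aestronglyMeasurable ha.1.1.aestronglyMeasurable
  have h2 := ha.1.2.1.aestronglyMeasurable
  have h3 := ha.2.aestronglyMeasurable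
  exact ⟨h3.add (h1.mul h2), h3.sub (h1.mul h2), (h3.pow 2).add ((h1.pow 2).mul (h2.pow 2))⟩

theorem integrable_density (hc : Continuous c) (ha : a.Admissible) (he : energy c a ≠ ⊤) :
    Integrable (a.density c) :=
  ⟨(ha.aestronglyMeasurable hc).2.2, (hasFiniteIntegral_iff_ofReal
    (ae_of_all _ (a.density_nonneg c))).2 he.lt_top⟩

theorem integrable_R_sq (hc : Continuous c) (ha : a.Admissible) (he : energy c a ≠ ⊤) :
    Integrable fun x => a.R c x ^ 2 := by
  refine ((integrable_density hc ha he).const_mul 2).mono'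
    ((ha.aestronglyMeasurable hc).1.pow 2) (ae_of_all _ fun x => ?_)
  rw [a.density_eq, Real.norm_eq_abs, abs_of_nonneg (sq_nonneg _)]
  linarith [sq_nonneg (a.S c x)]

theorem integrable_S_sq (hc : Continuous c) (ha : a.Admissible) (he : energy c a ≠ ⊤) :
    Integrable fun x => a.S c x ^ 2 := by
  refine ((integrable_density hc ha he).const_mul 2).mono'
    ((ha.aestronglyMeasurable hc).2.1.pow 2) (ae_of_all _ fun x => ?_)
  rw [a.density_eq, Real.norm_eq_abs, abs_of_nonneg (sq_nonneg _)]
  linarith [sq_nonneg (a.R c x)]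

end

/-! ### Families of solutions -/

/-- A component of a family of fields, as a function of `z = (X, Y, θ)`. -/
def fld (g : CharFields → ℝ → ℝ → ℝ) (F : ℝ → CharFields) (z : ℝ × ℝ × ℝ) : ℝ :=
  g (F z.2.2) z.1 z.2.1

/-- The derivative of the field `t` in `X`, as given by the semilinear system. -/
def timeX (c : ℝ → ℝ) (F : ℝ → CharFields) (z : ℝ × ℝ × ℝ) : ℝ :=
  (1 + Real.cos (fld CharFields.α F z)) * fld CharFields.p F z / (4 * c (fld CharFields.u F z))

/-- The derivative of the field `t` in `Y`, as given by the semilinear system. -/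
def timeY (c : ℝ → ℝ) (F : ℝ → CharFields) (z : ℝ × ℝ × ℝ) : ℝ :=
  (1 + Real.cos (fld CharFields.β F z)) * fld CharFields.q F z / (4 * c (fld CharFields.u F z))

/-- A family of conservative solutions with data `γ θ`, defined and continuous for all real `θ`,
and smooth for `θ` in the open set `O`. -/
structure Family (c : ℝ → ℝ) (γ : ℝ → WaveData) (F : ℝ → CharFields) (ξ η : ℝ → ℝ → ℝ)
    (O : Set ℝ) : Prop where
  c_smooth : ContDiff ℝ ∞ c
  c_pos : ∀ v, 0 < c v
  cont : Continuous (joint F)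
  solves : ∀ θ, (F θ).Solves c
  data : ∀ θ, (F θ).HasData c (γ θ) (ξ θ) (η θ)
  adm : ∀ θ, (γ θ).Admissible
  energy_ne_top : ∀ θ, energy c (γ θ) ≠ ⊤
  isOpen : IsOpen O
  smooth : ∀ z : ℝ × ℝ × ℝ, z.2.2 ∈ O → ContDiffAt ℝ ∞ (joint F) z

namespace Family

variable {c : ℝ → ℝ} {γ : ℝ → WaveData} {F : ℝ → CharFields} {ξ η : ℝ → ℝ → ℝ} {O : Set ℝ}

theorem continuous_fld (h : Family c γ F ξ η O) :
    Continuous (fld CharFields.u F) ∧ Continuous (fld CharFields.α F) ∧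
      Continuous (fld CharFields.β F) ∧ Continuous (fld CharFields.p F) ∧
      Continuous (fld CharFields.q F) ∧ Continuous (fld CharFields.x F) ∧
      Continuous (fld CharFields.t F) :=
  ⟨h.cont.fst, h.cont.snd.fst, h.cont.snd.snd.fst, h.cont.snd.snd.snd.fst,
    h.cont.snd.snd.snd.snd.fst, h.cont.snd.snd.snd.snd.snd.fst, h.cont.snd.snd.snd.snd.snd.snd⟩

theorem smooth_fld (h : Family c γ F ξ η O) {z : ℝ × ℝ × ℝ} (hz : z.2.2 ∈ O) :
    ContDiffAt ℝ ∞ (fld CharFields.u F) z ∧ ContDiffAt ℝ ∞ (fld CharFields.α F) z ∧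
      ContDiffAt ℝ ∞ (fld CharFields.β F) z ∧ ContDiffAt ℝ ∞ (fld CharFields.p F) z ∧
      ContDiffAt ℝ ∞ (fld CharFields.q F) z ∧ ContDiffAt ℝ ∞ (fld CharFields.x F) z ∧
      ContDiffAt ℝ ∞ (fld CharFields.t F) z :=
  have hj := h.smooth z hz
  ⟨hj.fst, hj.snd.fst, hj.snd.snd.fst, hj.snd.snd.snd.fst,
    hj.snd.snd.snd.snd.fst, hj.snd.snd.snd.snd.snd.fst, hj.snd.snd.snd.snd.snd.snd⟩

/-- The line coordinate of the curve `{t = 0}` and its density with respect to `x`. -/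
theorem hasDensity (h : Family c γ F ξ η O) (θ : ℝ) :
    HasDensity (fun x => (ξ θ x - η θ x) / 2)
      (fun x => ((1 + (γ θ).R c x ^ 2) / (F θ).p (ξ θ x) (η θ x) +
        (1 + (γ θ).S c x ^ 2) / (F θ).q (ξ θ x) (η θ x)) / 2) := by
  obtain ⟨-, -, -, hp, hq, -, -⟩ := h.continuous_fld
  have hins : Continuous fun z : ℝ × ℝ => (z.1, z.2, θ) := by fun_prop
  refine (h.data θ).hasDensity (h.solves θ) (hp.comp hins) (hq.comp hins) ?_ ?_
  · exact (locallyIntegrable_const 1).add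
      (integrable_R_sq h.c_smooth.continuous (h.adm θ) (h.energy_ne_top θ)).locallyIntegrable
  · exact (locallyIntegrable_const 1).add
      (integrable_S_sq h.c_smooth.continuous (h.adm θ) (h.energy_ne_top θ)).locallyIntegrable

theorem levelFamily (h : Family c γ F ξ η O) :
    LevelFamily (fld CharFields.t F) (timeX c F) (timeY c F) := by
  obtain ⟨hu, hα, hβ, hp, hq, -, ht⟩ := h.continuous_fld
  have hcu := h.c_smooth.continuous.comp hu
  have h4 : ∀ z, 4 * c (fld CharFields.u F z) ≠ 0 := fun z =>
    (mul_pos four_pos (h.c_pos _)).ne'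
  have hcos : ∀ α, 0 ≤ 1 + Real.cos α := fun α => by linarith [Real.neg_one_le_cos α]
  refine ⟨ht, ?_, ?_, fun X Y θ => (h.solves θ).t_X X Y, fun X Y θ => (h.solves θ).t_Y X Y,
    fun z => ?_, fun z => ?_, fun s θ => ?_⟩
  · exact ((continuous_const.add (Real.continuous_cos.comp hα)).mul hp).div
      (continuous_const.mul hcu) h4
  · exact ((continuous_const.add (Real.continuous_cos.comp hβ)).mul hq).div
      (continuous_const.mul hcu) h4
  · exact div_nonneg (mul_nonneg (hcos _) ((h.solves _).p_pos _ _).le)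
      (mul_pos four_pos (h.c_pos _)).le
  · exact div_nonneg (mul_nonneg (hcos _) ((h.solves _).q_pos _ _).le)
      (mul_pos four_pos (h.c_pos _)).le
  · obtain ⟨x, rfl⟩ := (h.hasDensity θ).surj s
    have := (h.data θ).t_eq_zero_iff (h.solves θ) h.c_pos x
    exact ⟨(ξ θ x + η θ x) / 2, (this _).2 rfl, fun r hr => (this r).1 hr⟩

theorem levelPt_eq (h : Family c γ F ξ η O) (θ x : ℝ) :
    levelPt (fld CharFields.t F) ((ξ θ x - η θ x) / 2, θ, 0) = (ξ θ x, η θ x, θ) := by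
  have h1 : (ξ θ x + η θ x) / 2 =
      height (fld CharFields.t F) ((ξ θ x - η θ x) / 2, θ, 0) := by
    refine h.levelFamily.eq_height ?_
    have := ((h.data θ).t_eq_zero_iff (h.solves θ) h.c_pos x ((ξ θ x + η θ x) / 2)).2 rfl
    simpa [regLevel, fld] using this
  unfold levelPt
  rw [← h1]
  ext <;> simp <;> ring

/-- At almost every point of the curve, the partial derivatives of `t` are positive, and are the
reciprocals of the densities of `X` and `Y`, up to the factor `2c`. -/
theorem ae_timeX (h : Family c γ F ξ η O) (θ : ℝ) : ∀ᵐ x,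
    0 < timeX c F (ξ θ x, η θ x, θ) ∧ 0 < timeY c F (ξ θ x, η θ x, θ) ∧
    (1 + (γ θ).R c x ^ 2) / (F θ).p (ξ θ x) (η θ x) =
      1 / (2 * c (fld CharFields.u F (ξ θ x, η θ x, θ)) * timeX c F (ξ θ x, η θ x, θ)) ∧
    (1 + (γ θ).S c x ^ 2) / (F θ).q (ξ θ x) (η θ x) =
      1 / (2 * c (fld CharFields.u F (ξ θ x, η θ x, θ)) * timeY c F (ξ θ x, η θ x, θ)) := by
  filter_upwards [(h.data θ).α_eq, (h.data θ).β_eq] with x hα hβ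
  obtain ⟨h1, h2, -⟩ := half_angle hα
  obtain ⟨k1, k2, -⟩ := half_angle hβ
  have hp := (h.solves θ).p_pos (ξ θ x) (η θ x)
  have hq := (h.solves θ).q_pos (ξ θ x) (η θ x)
  have hc := h.c_pos ((F θ).u (ξ θ x) (η θ x))
  simp only [timeX, timeY, fld, one_add_cos_eq]
  refine ⟨by positivity, by positivity, ?_, ?_⟩
  · rw [eq_div_of_mul_eq h1.ne' h2]; field_simp; norm_num
  · rw [eq_div_of_mul_eq k1.ne' k2]; field_simp; norm_num

theorem ae_nondegenerate (h : Family c γ F ξ η O) (θ : ℝ) : ∀ᵐ s,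
    0 < timeX c F (levelPt (fld CharFields.t F) (s, θ, 0)) +
      timeY c F (levelPt (fld CharFields.t F) (s, θ, 0)) := by
  refine (h.hasDensity θ).ae_of_ae_comp ?_
  filter_upwards [h.ae_timeX θ] with x hx
  rw [h.levelPt_eq]
  exact add_pos hx.1 hx.2.1

theorem x_levelPt_mono (h : Family c γ F ξ η O) (θ : ℝ) :
    Monotone fun s => fld CharFields.x F (levelPt (fld CharFields.t F) (s, θ, 0)) := by
  intro s s' hs
  obtain ⟨x, rfl⟩ := (h.hasDensity θ).surj s
  obtain ⟨x', rfl⟩ := (h.hasDensity θ).surj s'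
  simp only [h.levelPt_eq]
  rw [fld, fld, (h.data θ).x_eq, (h.data θ).x_eq]
  exact (h.hasDensity θ).mono.le_iff_le.1 hs

/-- By compactness, a bounded interval of the line coordinate contains all points of the curves
`{t = 0}`, `0 ≤ θ ≤ 1`, at which `|x| ≤ m`. -/
theorem exists_line_bound (h : Family c γ F ξ η O) (m : ℝ) : ∃ M : ℝ, ∀ θ ∈ Set.Icc (0 : ℝ) 1,
    fld CharFields.x F (levelPt (fld CharFields.t F) (-M, θ, 0)) < -m ∧
      m < fld CharFields.x F (levelPt (fld CharFields.t F) (M, θ, 0)) := by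
  obtain ⟨-, -, -, -, -, hx, -⟩ := h.continuous_fld
  have hpt := h.levelFamily.continuous_levelPt
  have hc : ∀ s, Continuous fun θ =>
      fld CharFields.x F (levelPt (fld CharFields.t F) (s, θ, 0)) := fun s => by fun_prop
  have hex : ∀ θ, ∃ n : ℕ, fld CharFields.x F (levelPt (fld CharFields.t F) (-n, θ, 0)) < -m ∧
      m < fld CharFields.x F (levelPt (fld CharFields.t F) (n, θ, 0)) := by
    intro θ
    obtain ⟨n, hn⟩ := exists_nat_ge (max ((ξ θ (m + 1) - η θ (m + 1)) / 2)
      (-((ξ θ (-m - 1) - η θ (-m - 1)) / 2)))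
    refine ⟨n, ?_, ?_⟩
    · have h1 : -(n : ℝ) ≤ (ξ θ (-m - 1) - η θ (-m - 1)) / 2 := by
        linarith [(le_max_right _ _).trans hn]
      have h2 := h.x_levelPt_mono θ h1
      simp only [h.levelPt_eq] at h2
      rw [fld, fld, (h.data θ).x_eq] at h2
      rw [fld]
      linarith
    · have h2 := h.x_levelPt_mono θ ((le_max_left _ _).trans hn)
      simp only [h.levelPt_eq] at h2
      rw [fld, fld, (h.data θ).x_eq] at h2
      rw [fld]
      linarith
  obtain ⟨n, hn⟩ := isCompact_Icc.elim_directed_cover (s := Set.Icc (0 : ℝ) 1)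
    (fun n : ℕ => {θ | fld CharFields.x F (levelPt (fld CharFields.t F) (-n, θ, 0)) < -m} ∩
      {θ | m < fld CharFields.x F (levelPt (fld CharFields.t F) (n, θ, 0))})
    (fun n => (isOpen_lt (hc _) continuous_const).inter (isOpen_lt continuous_const (hc _)))
    (fun θ _ => Set.mem_iUnion.2 (hex θ))
    (directed_of_isDirected_le fun i j hij θ hθ => by
      have hij' : (i : ℝ) ≤ j := Nat.cast_le.2 hij
      exact ⟨(h.x_levelPt_mono θ (neg_le_neg hij')).trans_lt hθ.1,
        lt_of_lt_of_le hθ.2 (h.x_levelPt_mono θ hij')⟩)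
  exact ⟨n, fun θ hθ => hn hθ⟩

end Family

/-! ### Growth of a function of one variable -/

/-- Integrated form of a differential inequality that may fail at countably many parameters. -/
theorem ofReal_abs_sub_le_lintegral {G : ℝ → ℝ} {D : ℝ → ℝ} {O : Set ℝ} {C : ENNReal}
    (hC : C ≠ ⊤) {T : ℝ → ENNReal} (hG : ContinuousOn G (Set.Icc 0 1))
    (hO : (Set.Ioo (0 : ℝ) 1 \ O).Countable) (hD : ∀ θ ∈ O, HasDerivAt G (D θ) θ)
    (hDT : ∀ θ ∈ O, ENNReal.ofReal |D θ| ≤ C * T θ) :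
    ENNReal.ofReal |G 1 - G 0| ≤ C * ∫⁻ θ in Set.Icc (0 : ℝ) 1, T θ := by
  have hae : ∀ᵐ θ ∂(volume.restrict (Set.Icc (0 : ℝ) 1)), θ ∈ O := by
    rw [Measure.restrict_congr_set Ioo_ae_eq_Icc.symm]
    have h1 : ∀ᵐ θ : ℝ, θ ∉ Set.Ioo (0 : ℝ) 1 \ O := hO.ae_notMem volume
    filter_upwards [ae_restrict_mem measurableSet_Ioo, ae_restrict_of_ae h1] with θ h2 h3
    by_contra h4
    exact h3 ⟨h2, h4⟩
  have hle : ∫⁻ θ in Set.Icc (0 : ℝ) 1, ‖deriv G θ‖ₑ ≤ C * ∫⁻ θ in Set.Icc (0 : ℝ) 1, T θ := by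
    rw [← lintegral_const_mul' _ _ hC]
    refine lintegral_mono_ae ?_
    filter_upwards [hae] with θ hθ
    rw [(hD θ hθ).deriv, Real.enorm_eq_ofReal_abs]
    exact hDT θ hθ
  rcases eq_or_ne (C * ∫⁻ θ in Set.Icc (0 : ℝ) 1, T θ) ⊤ with htop | htop
  · rw [htop]; exact le_top
  have hint : IntegrableOn (deriv G) (Set.Icc 0 1) :=
    ⟨(measurable_deriv G).aestronglyMeasurable, hle.trans_lt htop.lt_top⟩
  have hftc := integral_eq_of_hasDerivAt_off_countable_of_le G (deriv G) zero_le_one hO hG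
    (fun θ hθ => by
      have : θ ∈ O := by
        by_contra h4
        exact hθ.2 ⟨hθ.1, h4⟩
      rw [(hD θ this).deriv]
      exact hD θ this)
    ((intervalIntegrable_iff_integrableOn_Icc_of_le zero_le_one).2 hint)
  rw [← hftc, intervalIntegral.integral_of_le zero_le_one, ← integral_Icc_eq_integral_Ioc,
    ← Real.enorm_eq_ofReal_abs]
  exact (enorm_integral_le_lintegral_enorm _).trans hle

namespace Family

variable {c : ℝ → ℝ} {γ : ℝ → WaveData} {F : ℝ → CharFields} {ξ η : ℝ → ℝ → ℝ} {O : Set ℝ}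

/-- Growth estimate for the integral over the curves `{t = 0}` of a one-form whose coefficients
vanish where `x` is large.  The density of the integral with respect to `x` is `g θ`, and
the density of its derivative is `d θ`. -/
theorem ofReal_abs_sub_le (h : Family c γ F ξ η O) (hO : (Set.Ioo (0 : ℝ) 1 \ O).Countable)
    (hO1 : O ⊆ Set.Icc 0 1)
    {σ : ℝ × ℝ × ℝ → ℝ × ℝ × ℝ →L[ℝ] ℝ} (hσ : ∀ z, z.2.2 ∈ O → ContDiffAt ℝ 1 σ z)
    {a b B : ℝ × ℝ × ℝ → ℝ} (ha : Continuous a) (hb : Continuous b)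
    (haσ : ∀ z, z.2.2 ∈ O → σ z (1, -1, 0) = a z) (hbσ : ∀ z, z.2.2 ∈ O → σ z (1, 1, 0) = b z)
    (hB : ∀ z, z.2.2 ∈ O → ContinuousAt B z)
    (hcurl : ∀ z, z.2.2 ∈ O → |curl σ z (1, 1, 0) (1, -1, 0)| ≤ B z * (timeX c F z + timeY c F z))
    {m : ℝ} (hm0 : 0 ≤ m) (hm : ∀ z, m ≤ |fld CharFields.x F z| → a z = 0 ∧ b z = 0 ∧ σ z = 0)
    {g d : ℝ → ℝ → ℝ}
    (hg : ∀ θ, ∀ᵐ x, g θ x = (a (ξ θ x, η θ x, θ) +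
      -(timeX c F (ξ θ x, η θ x, θ) - timeY c F (ξ θ x, η θ x, θ)) * b (ξ θ x, η θ x, θ) /
        (timeX c F (ξ θ x, η θ x, θ) + timeY c F (ξ θ x, η θ x, θ))) *
      (((1 + (γ θ).R c x ^ 2) / (F θ).p (ξ θ x) (η θ x) +
        (1 + (γ θ).S c x ^ 2) / (F θ).q (ξ θ x) (η θ x)) / 2))
    (hd : ∀ θ ∈ O, ∀ᵐ x, d θ x = (curl σ (ξ θ x, η θ x, θ) (0, 0, 1) (1, -1, 0) +
      (-(timeX c F (ξ θ x, η θ x, θ) - timeY c F (ξ θ x, η θ x, θ)) *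
          curl σ (ξ θ x, η θ x, θ) (0, 0, 1) (1, 1, 0) +
        -(fderiv ℝ (fld CharFields.t F) (ξ θ x, η θ x, θ) (0, 0, 1)) *
          curl σ (ξ θ x, η θ x, θ) (1, 1, 0) (1, -1, 0)) /
        (timeX c F (ξ θ x, η θ x, θ) + timeY c F (ξ θ x, η θ x, θ))) *
      (((1 + (γ θ).R c x ^ 2) / (F θ).p (ξ θ x) (η θ x) +
        (1 + (γ θ).S c x ^ 2) / (F θ).q (ξ θ x) (η θ x)) / 2))
    {C : ENNReal} (hC : C ≠ ⊤) {T : ℝ → ENNReal}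
    (hdT : ∀ θ ∈ O, ∫⁻ x, ENNReal.ofReal |d θ x| ≤ C * T θ) :
    ENNReal.ofReal |(∫ x, g 1 x) - ∫ x, g 0 x| ≤ C * ∫⁻ θ in Set.Icc (0 : ℝ) 1, T θ := by
  have hL := h.levelFamily
  obtain ⟨M, hM⟩ := h.exists_line_bound m
  obtain ⟨-, -, -, -, -, hx, -⟩ := h.continuous_fld
  have hpt := hL.continuous_levelPt
  set tt := fld CharFields.t F with htt
  have hout : ∀ θ ∈ Set.Icc (0 : ℝ) 1, ∀ s, s ∉ Set.Ioc (-M) M →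
      a (levelPt tt (s, θ, 0)) = 0 ∧ b (levelPt tt (s, θ, 0)) = 0 := by
    intro θ hθ s hs
    have h1 : m ≤ |fld CharFields.x F (levelPt tt (s, θ, 0))| := by
      by_cases h2 : s ≤ -M
      · have h3 : _ ≤ _ := h.x_levelPt_mono θ h2
        exact le_trans (by linarith [(hM θ hθ).1]) (neg_le_abs _)
      · have h4 : M ≤ s := by
          by_contra h5
          exact hs ⟨not_le.1 h2, (not_le.1 h5).le⟩
        have h3 : _ ≤ _ := h.x_levelPt_mono θ h4
        exact le_trans (by linarith [(hM θ hθ).2]) (le_abs_self _)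
    exact ⟨(hm _ h1).1, (hm _ h1).2.1⟩
  have hM0 : ∀ θ ∈ Set.Icc (0 : ℝ) 1, m < |fld CharFields.x F (levelPt tt (-M, θ, 0))| ∧
      m < |fld CharFields.x F (levelPt tt (M, θ, 0))| := fun θ hθ =>
    ⟨lt_of_lt_of_le (by linarith [(hM θ hθ).1]) (neg_le_abs _),
      lt_of_lt_of_le (hM θ hθ).2 (le_abs_self _)⟩
  have hM' : -M ≤ M := by
    by_contra hlt
    have h3 : _ ≤ _ := h.x_levelPt_mono 0 (not_le.1 hlt).le
    linarith [hM 0 ⟨le_rfl, zero_le_one⟩]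
  have hGint : ∀ θ ∈ Set.Icc (0 : ℝ) 1, ∫ x, g θ x = sliceIntegral tt (timeX c F) (timeY c F) M a
      (fun z => -(timeX c F z - timeY c F z) * b z) θ 0 := by
    intro θ hθ
    rw [sliceIntegral, intervalIntegral.integral_of_le hM',
      setIntegral_eq_integral_of_forall_compl_eq_zero]
    · symm
      rw [(h.hasDensity θ).integral_eq]
      refine integral_congr_ae ?_
      filter_upwards [hg θ] with x hx
      simp only [htt, h.levelPt_eq, abs_zero, zero_add]
      exact hx.symm
    · intro s hs
      simp [hout θ hθ s hs]
  have habs : ∀ z, |timeX c F z - timeY c F z| ≤ timeX c F z + timeY c F z := fun z => by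
    have := hL.X_nonneg z
    have := hL.Y_nonneg z
    rw [abs_le]; constructor <;> linarith
  rw [hGint 1 ⟨zero_le_one, le_rfl⟩, hGint 0 ⟨le_rfl, zero_le_one⟩]
  refine ofReal_abs_sub_le_lintegral hC (G := fun θ => sliceIntegral tt (timeX c F) (timeY c F) M a
      (fun z => -(timeX c F z - timeY c F z) * b z) θ 0)
    (D := fun θ => sliceIntegral tt (timeX c F) (timeY c F) M
        (fun z => curl σ z (0, 0, 1) (1, -1, 0))
        (fun z => -(timeX c F z - timeY c F z) * curl σ z (0, 0, 1) (1, 1, 0) +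
          -(fderiv ℝ tt z (0, 0, 1)) * curl σ z (1, 1, 0) (1, -1, 0)) θ 0) ?_ hO ?_ ?_
  · intro θ _
    have h1 := hL.continuousAt_sliceIntegral isOpen_univ (a := a)
      (N := fun z => -(timeX c F z - timeY c F z) * b z) (B := fun z => |b z|)
      (fun z _ => ha.continuousAt)
      (fun z _ => ((hL.cont_X.sub hL.cont_Y).neg.mul hb).continuousAt)
      (fun z _ => hb.abs.continuousAt)
      (fun z _ => by
        rw [abs_mul, abs_neg, mul_comm]
        exact mul_le_mul_of_nonneg_left (habs z) (abs_nonneg _))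
      M (Set.mem_univ θ) (h.ae_nondegenerate θ)
    exact (ContinuousAt.comp' (f := fun θ : ℝ => (θ, (0 : ℝ))) h1
      (by fun_prop)).continuousWithinAt
  · intro θ hθ
    have hcx : ∀ s : ℝ, ContinuousAt
        (fun y : ℝ × ℝ => |fld CharFields.x F (levelPt tt (s, y.1, y.2))|) (θ, 0) := fun s => by
      fun_prop
    have hbdry : ∀ᶠ y : ℝ × ℝ in 𝓝 (θ, 0),
        σ (levelPt tt (-M, y.1, y.2)) = 0 ∧ σ (levelPt tt (M, y.1, y.2)) = 0 := by
      filter_upwards [continuousAt_const.eventually_lt (hcx (-M)) (hM0 θ (hO1 hθ)).1,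
        continuousAt_const.eventually_lt (hcx M) (hM0 θ (hO1 hθ)).2] with y h1 h2
      exact ⟨(hm _ h1.le).2.2, (hm _ h2.le).2.2⟩
    refine (hL.hasDerivAt_sliceIntegral h.isOpen
      (fun z hz => ((h.smooth_fld hz).2.2.2.2.2.2).of_le ENat.LEInfty.out) hσ hB hcurl hθ
      (fun θ _ => h.ae_nondegenerate θ) hbdry).congr_of_eventuallyEq ?_
    filter_upwards [h.isOpen.mem_nhds hθ] with θ' hθ'
    refine intervalIntegral.integral_congr fun s _ => ?_
    simp only
    rw [haσ _ (show (levelPt tt (s, θ', 0)).2.2 ∈ O from hθ'),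
      hbσ _ (show (levelPt tt (s, θ', 0)).2.2 ∈ O from hθ')]
  · intro θ hθ
    refine le_trans ?_ (hdT θ hθ)
    rw [← Real.enorm_eq_ofReal_abs, sliceIntegral, intervalIntegral.integral_of_le hM']
    refine (enorm_integral_le_lintegral_enorm _).trans ((setLIntegral_le_lintegral _ _).trans ?_)
    rw [(h.hasDensity θ).lintegral_eq]
    refine (lintegral_congr_ae ?_).le
    filter_upwards [hd θ hθ] with x hx
    rw [hx, abs_mul, abs_of_nonneg ((h.hasDensity θ).nonneg x), ENNReal.ofReal_mul (abs_nonneg _)]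
    simp only [htt, h.levelPt_eq, abs_zero, zero_add, Real.enorm_eq_ofReal_abs]

end Family

/-! ### Growth of integrals of the profile -/

section Partial

variable {g : ℝ × ℝ × ℝ → ℝ} {X Y θ : ℝ}

theorem hasDerivAt_fst_of_differentiableAt (hg : DifferentiableAt ℝ g (X, Y, θ)) :
    HasDerivAt (fun X' => g (X', Y, θ)) (fderiv ℝ g (X, Y, θ) (1, 0, 0)) X :=
  hg.hasFDerivAt.comp_hasDerivAt X
    ((hasDerivAt_id X).prodMk ((hasDerivAt_const X Y).prodMk (hasDerivAt_const X θ)))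

theorem hasDerivAt_snd_of_differentiableAt (hg : DifferentiableAt ℝ g (X, Y, θ)) :
    HasDerivAt (fun Y' => g (X, Y', θ)) (fderiv ℝ g (X, Y, θ) (0, 1, 0)) Y :=
  hg.hasFDerivAt.comp_hasDerivAt Y
    ((hasDerivAt_const Y X).prodMk ((hasDerivAt_id Y).prodMk (hasDerivAt_const Y θ)))

theorem hasDerivAt_trd_of_differentiableAt (hg : DifferentiableAt ℝ g (X, Y, θ)) :
    HasDerivAt (fun θ' => g (X, Y, θ')) (fderiv ℝ g (X, Y, θ) (0, 0, 1)) θ :=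
  hg.hasFDerivAt.comp_hasDerivAt θ
    ((hasDerivAt_const θ X).prodMk ((hasDerivAt_const θ Y).prodMk (hasDerivAt_id θ)))

end Partial

/-- `d(f dg) = df ∧ dg`. -/
theorem curl_smul_fderiv {E : Type*} [NormedAddCommGroup E] [NormedSpace ℝ E] {f g : E → ℝ} {z : E}
    (hf : DifferentiableAt ℝ f z) (hg : ContDiffAt ℝ 2 g z) (v w : E) :
    curl (fun z => f z • fderiv ℝ g z) z v w =
      fderiv ℝ f z v * fderiv ℝ g z w - fderiv ℝ f z w * fderiv ℝ g z v := by
  have h2 : DifferentiableAt ℝ (fderiv ℝ g) z :=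
    (hg.fderiv_right (m := 1) (by norm_num)).differentiableAt one_ne_zero
  have hsymm := hg.isSymmSndFDerivAt (by simp) v w
  have h3 : fderiv ℝ (fun z => f z • fderiv ℝ g z) z = _ :=
    (hf.hasFDerivAt.smul h2.hasFDerivAt).fderiv
  rw [curl, h3]
  simp [hsymm]

/-- The exterior derivative of the pull-back of `φ(x) u dx`. -/
theorem curl_comp_mul_smul_fderiv {E : Type*} [NormedAddCommGroup E] [NormedSpace ℝ E]
    {φ : ℝ → ℝ} {u x : E → ℝ} {z : E} (hφ : DifferentiableAt ℝ φ (x z))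
    (hu : DifferentiableAt ℝ u z) (hx : ContDiffAt ℝ 2 x z) (v w : E) :
    curl (fun z => (φ (x z) * u z) • fderiv ℝ x z) z v w =
      φ (x z) * (fderiv ℝ u z v * fderiv ℝ x z w - fderiv ℝ u z w * fderiv ℝ x z v) := by
  have hxd := (hx.differentiableAt two_ne_zero).hasFDerivAt
  have h1 : HasFDerivAt (fun z => φ (x z)) (deriv φ (x z) • fderiv ℝ x z) z :=
    hφ.hasDerivAt.comp_hasFDerivAt z hxd
  have h2 : HasFDerivAt (fun z => φ (x z) * u z) _ z := h1.mul hu.hasFDerivAt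
  rw [curl_smul_fderiv h2.differentiableAt hx, h2.fderiv]
  simp
  ring

/-- The exterior derivative of a one-form `A dX + B dY`. -/
theorem curl_smul_add_smul {A B : ℝ × ℝ × ℝ → ℝ} {z : ℝ × ℝ × ℝ} (hA : DifferentiableAt ℝ A z)
    (hB : DifferentiableAt ℝ B z) (v w : ℝ × ℝ × ℝ) :
    curl (fun z => A z • ContinuousLinearMap.fst ℝ ℝ (ℝ × ℝ) +
      B z • (ContinuousLinearMap.fst ℝ ℝ ℝ).comp (ContinuousLinearMap.snd ℝ ℝ (ℝ × ℝ))) z v w =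
      fderiv ℝ A z v * w.1 + fderiv ℝ B z v * w.2.1 -
        (fderiv ℝ A z w * v.1 + fderiv ℝ B z w * v.2.1) := by
  have h1 := (hA.hasFDerivAt.smul_const (ContinuousLinearMap.fst ℝ ℝ (ℝ × ℝ))).add
    (hB.hasFDerivAt.smul_const
      ((ContinuousLinearMap.fst ℝ ℝ ℝ).comp (ContinuousLinearMap.snd ℝ ℝ (ℝ × ℝ))))
  have h2 : fderiv ℝ (fun z => A z • ContinuousLinearMap.fst ℝ ℝ (ℝ × ℝ) +
      B z • (ContinuousLinearMap.fst ℝ ℝ ℝ).comp (ContinuousLinearMap.snd ℝ ℝ (ℝ × ℝ))) z = _ :=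
    h1.fderiv
  rw [curl, h2]
  simp

/-- Values on the diagonal directions in which the line coordinate, respectively the height,
increases. -/
theorem map_diagonals {L : ℝ × ℝ × ℝ →L[ℝ] ℝ} :
    L (1, -1, 0) = L (1, 0, 0) - L (0, 1, 0) ∧ L (1, 1, 0) = L (1, 0, 0) + L (0, 1, 0) := by
  rw [← map_sub, ← map_add]
  simp

/-- The unweighted line integral of `|J_l| dX + |H_l| |dY|` over the curve `{t = 0}`. -/
def lineNorm (c : ℝ → ℝ) (γ : ℝ → WaveData) (F : ℝ → CharFields) (ξ η : ℝ → ℝ → ℝ) (θ : ℝ)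
    (l : Fin 6) : ENNReal :=
  ∫⁻ x, ENNReal.ofReal (|J c F θ (ξ θ x) (η θ x) l| *
        ((1 + (γ θ).R c x ^ 2) / (F θ).p (ξ θ x) (η θ x)) +
      |H c F θ (ξ θ x) (η θ x) l| * ((1 + (γ θ).S c x ^ 2) / (F θ).q (ξ θ x) (η θ x)))

/-- The weights `𝒲⁻`, `𝒲⁺` are at least `1`. -/
theorem lineNorm_le {c : ℝ → ℝ} {κ : Fin 6 → ℝ} {γ : ℝ → WaveData} {F : ℝ → CharFields}
    {ξ η : ℝ → ℝ → ℝ} {θ : ℝ} (hs : (F θ).Solves c) {l : Fin 6} (hκ : 0 < κ l) :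
    lineNorm c γ F ξ η θ l ≤ ENNReal.ofReal (1 / κ l) * tangentNorm c κ γ F ξ η θ := by
  have h1 : ENNReal.ofReal (κ l) * lineNorm c γ F ξ η θ l ≤ tangentNorm c κ γ F ξ η θ := by
    refine le_trans ?_ (Finset.single_le_sum (fun i _ => zero_le) (Finset.mem_univ l))
    refine mul_le_mul_right (lintegral_mono fun x => ?_) _
    have hp := hs.p_pos (ξ θ x) (η θ x)
    have hq := hs.q_pos (ξ θ x) (η θ x)
    rw [ENNReal.ofReal_add (by positivity) (by positivity), ENNReal.ofReal_mul (abs_nonneg _),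
      ENNReal.ofReal_mul (abs_nonneg _)]
    gcongr
    · exact le_mul_of_one_le_right' (by unfold weightMinus; exact le_self_add)
    · exact le_mul_of_one_le_right' (by unfold weightPlus; exact le_self_add)
  calc lineNorm c γ F ξ η θ l
      = ENNReal.ofReal (1 / κ l) * (ENNReal.ofReal (κ l) * lineNorm c γ F ξ η θ l) := by
        rw [← mul_assoc, ← ENNReal.ofReal_mul (by positivity), one_div_mul_cancel hκ.ne']
        simp
    _ ≤ _ := mul_le_mul_right h1 _

theorem J_apply (c : ℝ → ℝ) (F : ℝ → CharFields) (θ X Y : ℝ) :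
    J c F θ X Y 0 = (deriv (fun s => (F s).x X Y) θ + c ((F θ).u X Y) *
        deriv (fun s => (F s).t X Y) θ) * (F θ).p X Y ∧
      J c F θ X Y 2 = deriv (fun s => (F s).u X Y) θ * (F θ).p X Y ∧
      J c F θ X Y 5 = deriv (fun s => (F s).p X Y) θ * Real.sin ((F θ).α X Y / 2) ^ 2 +
        (F θ).p X Y * Real.sin ((F θ).α X Y) / 2 * deriv (fun s => (F s).α X Y) θ :=
  ⟨rfl, rfl, rfl⟩

theorem H_apply (c : ℝ → ℝ) (F : ℝ → CharFields) (θ X Y : ℝ) :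
    H c F θ X Y 0 = (deriv (fun s => (F s).x X Y) θ - c ((F θ).u X Y) *
        deriv (fun s => (F s).t X Y) θ) * (F θ).q X Y ∧
      H c F θ X Y 5 = deriv (fun s => (F s).q X Y) θ * Real.sin ((F θ).β X Y / 2) ^ 2 +
        (F θ).q X Y * Real.sin ((F θ).β X Y) / 2 * deriv (fun s => (F s).β X Y) θ :=
  ⟨rfl, rfl⟩

namespace Family

variable {c : ℝ → ℝ} {γ : ℝ → WaveData} {F : ℝ → CharFields} {ξ η : ℝ → ℝ → ℝ} {O : Set ℝ}

theorem differentiableAt_fld (h : Family c γ F ξ η O) {z : ℝ × ℝ × ℝ} (hz : z.2.2 ∈ O) :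
    DifferentiableAt ℝ (fld CharFields.u F) z ∧ DifferentiableAt ℝ (fld CharFields.α F) z ∧
      DifferentiableAt ℝ (fld CharFields.β F) z ∧ DifferentiableAt ℝ (fld CharFields.p F) z ∧
      DifferentiableAt ℝ (fld CharFields.q F) z ∧ DifferentiableAt ℝ (fld CharFields.x F) z ∧
      DifferentiableAt ℝ (fld CharFields.t F) z := by
  obtain ⟨h1, h2, h3, h4, h5, h6, h7⟩ := h.smooth_fld hz
  have : (∞ : WithTop ℕ∞) ≠ 0 := by simp
  exact ⟨h1.differentiableAt this, h2.differentiableAt this, h3.differentiableAt this,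
    h4.differentiableAt this, h5.differentiableAt this, h6.differentiableAt this,
    h7.differentiableAt this⟩

theorem fderiv_x (h : Family c γ F ξ η O) {z : ℝ × ℝ × ℝ} (hz : z.2.2 ∈ O) :
    fderiv ℝ (fld CharFields.x F) z (1, 0, 0) = c (fld CharFields.u F z) * timeX c F z ∧
      fderiv ℝ (fld CharFields.x F) z (0, 1, 0) = -(c (fld CharFields.u F z) * timeY c F z) := by
  obtain ⟨-, -, -, -, -, hx, -⟩ := h.differentiableAt_fld hz
  have hc := (h.c_pos (fld CharFields.u F z)).ne'
  refine ⟨((hasDerivAt_fst_of_differentiableAt hx).unique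
    ((h.solves z.2.2).x_X z.1 z.2.1)).trans ?_, ((hasDerivAt_snd_of_differentiableAt hx).unique
    ((h.solves z.2.2).x_Y z.1 z.2.1)).trans ?_⟩
  · simp only [timeX, fld] at hc ⊢
    field_simp
  · simp only [timeY, fld] at hc ⊢
    field_simp

theorem fderiv_u (h : Family c γ F ξ η O) {z : ℝ × ℝ × ℝ} (hz : z.2.2 ∈ O) :
    fderiv ℝ (fld CharFields.u F) z (1, 0, 0) = Real.sin (fld CharFields.α F z) /
        (4 * c (fld CharFields.u F z)) * fld CharFields.p F z ∧
      fderiv ℝ (fld CharFields.u F) z (0, 1, 0) = Real.sin (fld CharFields.β F z) /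
        (4 * c (fld CharFields.u F z)) * fld CharFields.q F z := by
  obtain ⟨hu, -⟩ := h.differentiableAt_fld hz
  exact ⟨(hasDerivAt_fst_of_differentiableAt hu).unique ((h.solves z.2.2).u_X z.1 z.2.1),
    (hasDerivAt_snd_of_differentiableAt hu).unique ((h.solves z.2.2).u_Y z.1 z.2.1)⟩

theorem aemeasurable_line (h : Family c γ F ξ η O) {θ : ℝ} (hθ : θ ∈ O) :
    AEMeasurable fun x => ENNReal.ofReal (|J c F θ (ξ θ x) (η θ x) 0| *
        ((1 + (γ θ).R c x ^ 2) / (F θ).p (ξ θ x) (η θ x)) +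
      |H c F θ (ξ θ x) (η θ x) 0| * ((1 + (γ θ).S c x ^ 2) / (F θ).q (ξ θ x) (η θ x))) := by
  obtain ⟨hu, -, -, hp, hq, -, -⟩ := h.continuous_fld
  have hξ := (h.data θ).ξ_cont (h.solves θ)
  have hη := (h.data θ).η_cont (h.solves θ)
  have hins : Continuous fun x => (ξ θ x, η θ x, θ) := by fun_prop
  obtain ⟨hR, hS, -⟩ := (h.adm θ).aestronglyMeasurable h.c_smooth.continuous
  have hT : Continuous fun x => deriv (fun s => (F s).t (ξ θ x) (η θ x)) θ := by
    have h1 : ∀ x, deriv (fun s => (F s).t (ξ θ x) (η θ x)) θ =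
        fderiv ℝ (fld CharFields.t F) (ξ θ x, η θ x, θ) (0, 0, 1) := fun x =>
      (hasDerivAt_trd_of_differentiableAt (g := fld CharFields.t F)
        (h.differentiableAt_fld (z := (ξ θ x, η θ x, θ)) hθ).2.2.2.2.2.2).deriv
    simp only [h1]
    refine continuous_iff_continuousAt.2 fun x => ?_
    exact ContinuousAt.comp' (f := fun x => (ξ θ x, η θ x, θ))
      (continuousAt_fderiv_apply (((h.smooth_fld (z := (ξ θ x, η θ x, θ)) hθ).2.2.2.2.2.2).of_le
        ENat.LEInfty.out) _) hins.continuousAt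
  have hX : Continuous fun x => deriv (fun s => (F s).x (ξ θ x) (η θ x)) θ := by
    have h1 : ∀ x, deriv (fun s => (F s).x (ξ θ x) (η θ x)) θ =
        fderiv ℝ (fld CharFields.x F) (ξ θ x, η θ x, θ) (0, 0, 1) := fun x =>
      (hasDerivAt_trd_of_differentiableAt (g := fld CharFields.x F)
        (h.differentiableAt_fld (z := (ξ θ x, η θ x, θ)) hθ).2.2.2.2.2.1).deriv
    simp only [h1]
    refine continuous_iff_continuousAt.2 fun x => ?_
    exact ContinuousAt.comp' (f := fun x => (ξ θ x, η θ x, θ))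
      (continuousAt_fderiv_apply (((h.smooth_fld (z := (ξ θ x, η θ x, θ)) hθ).2.2.2.2.2.1).of_le
        ENat.LEInfty.out) _) hins.continuousAt
  have hcu : Continuous fun x => c ((F θ).u (ξ θ x) (η θ x)) :=
    h.c_smooth.continuous.comp (hu.comp hins)
  have hpx : Continuous fun x => (F θ).p (ξ θ x) (η θ x) := hp.comp hins
  have hqx : Continuous fun x => (F θ).q (ξ θ x) (η θ x) := hq.comp hins
  have hJ : Continuous fun x => J c F θ (ξ θ x) (η θ x) 0 := (hX.add (hcu.mul hT)).mul hpx
  have hH : Continuous fun x => H c F θ (ξ θ x) (η θ x) 0 := (hX.sub (hcu.mul hT)).mul hqx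
  have hR' := hR.aemeasurable
  have hS' := hS.aemeasurable
  exact ((hJ.abs.measurable.aemeasurable.mul
    (((hR'.pow_const 2).const_add 1).div hpx.measurable.aemeasurable)).add
    (hH.abs.measurable.aemeasurable.mul
      (((hS'.pow_const 2).const_add 1).div hqx.measurable.aemeasurable))).ennreal_ofReal

/-- Growth of `∫ φ u dx` along the family.  Since `d (φ(x) u dx) = φ(x) du ∧ dx`, the variation
contains `φ` but not its derivative, and the bound does not depend on the size of `φ'`. -/
theorem ofReal_abs_integral_pos_sub_le (h : Family c γ F ξ η O)
    (hO : (Set.Ioo (0 : ℝ) 1 \ O).Countable) (hO1 : O ⊆ Set.Icc 0 1) {c₀ : ℝ} (hc₀ : 0 < c₀)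
    (hcc₀ : ∀ v, c₀ ≤ c v) {κ : Fin 6 → ℝ} (hκ : ∀ l, 0 < κ l)
    {φ : ℝ → ℝ} (hφ : ContDiff ℝ 1 φ) (hφ1 : ∀ x, |φ x| ≤ 1) {m : ℝ} (hm0 : 0 ≤ m)
    (hm : ∀ x, m ≤ |x| → φ x = 0) :
    ENNReal.ofReal |(∫ x, φ x * (γ 1).pos x) - ∫ x, φ x * (γ 0).pos x| ≤
      ENNReal.ofReal (1 / κ 2 + 1 / (4 * c₀) * (1 / κ 0)) *
        ∫⁻ θ in Set.Icc (0 : ℝ) 1, tangentNorm c κ γ F ξ η θ := by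
  obtain ⟨hu, hα, hβ, hp, hq, hx, ht⟩ := h.continuous_fld
  have hL := h.levelFamily
  have hcu := h.c_smooth.continuous.comp hu
  have hφx := hφ.continuous.comp hx
  have hxes : ∀ z : ℝ × ℝ × ℝ, z.2.2 ∈ O → fderiv ℝ (fld CharFields.x F) z (1, -1, 0) =
      c (fld CharFields.u F z) * (timeX c F z + timeY c F z) := fun z hz => by
    rw [map_diagonals.1, (h.fderiv_x hz).1, (h.fderiv_x hz).2]; ring
  have hxer : ∀ z : ℝ × ℝ × ℝ, z.2.2 ∈ O → fderiv ℝ (fld CharFields.x F) z (1, 1, 0) =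
      c (fld CharFields.u F z) * (timeX c F z - timeY c F z) := fun z hz => by
    rw [map_diagonals.2, (h.fderiv_x hz).1, (h.fderiv_x hz).2]; ring
  have hcurl : ∀ z : ℝ × ℝ × ℝ, z.2.2 ∈ O → ∀ v w, curl (fun z => (φ (fld CharFields.x F z) *
      fld CharFields.u F z) • fderiv ℝ (fld CharFields.x F) z) z v w =
      φ (fld CharFields.x F z) * (fderiv ℝ (fld CharFields.u F) z v *
        fderiv ℝ (fld CharFields.x F) z w -
          fderiv ℝ (fld CharFields.u F) z w * fderiv ℝ (fld CharFields.x F) z v) :=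
    fun z hz v w => curl_comp_mul_smul_fderiv (hφ.differentiable one_ne_zero _)
      (h.differentiableAt_fld hz).1 ((h.smooth_fld hz).2.2.2.2.2.1.of_le ENat.LEInfty.out) v w
  refine h.ofReal_abs_sub_le hO hO1
    (σ := fun z => (φ (fld CharFields.x F z) * fld CharFields.u F z) •
      fderiv ℝ (fld CharFields.x F) z) ?_
    (a := fun z => φ (fld CharFields.x F z) * fld CharFields.u F z *
      (c (fld CharFields.u F z) * (timeX c F z + timeY c F z)))
    (b := fun z => φ (fld CharFields.x F z) * fld CharFields.u F z *
      (c (fld CharFields.u F z) * (timeX c F z - timeY c F z)))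
    (B := fun z => |φ (fld CharFields.x F z)| * (|fderiv ℝ (fld CharFields.u F) z (1, 1, 0)| +
      |fderiv ℝ (fld CharFields.u F) z (1, -1, 0)|) * c (fld CharFields.u F z))
    ?_ ?_ ?_ ?_ ?_ ?_ hm0 ?_ (g := fun θ x => φ x * (γ θ).pos x) ?_ (d := fun θ x => φ x *
      (deriv (fun s => (F s).u (ξ θ x) (η θ x)) θ -
        Real.sin ((F θ).α (ξ θ x) (η θ x)) / (4 * c ((F θ).u (ξ θ x) (η θ x))) *
          (J c F θ (ξ θ x) (η θ x) 0 * ((1 + (γ θ).R c x ^ 2) / (F θ).p (ξ θ x) (η θ x))) +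
        Real.sin ((F θ).β (ξ θ x) (η θ x)) / (4 * c ((F θ).u (ξ θ x) (η θ x))) *
          (H c F θ (ξ θ x) (η θ x) 0 * ((1 + (γ θ).S c x ^ 2) / (F θ).q (ξ θ x) (η θ x)))))
    ?_ ENNReal.ofReal_ne_top ?_
  · intro z hz
    obtain ⟨su, -, -, -, -, sx, -⟩ := h.smooth_fld hz
    have sx1 : ContDiffAt ℝ 1 (fld CharFields.x F) z := sx.of_le ENat.LEInfty.out
    exact ((hφ.contDiffAt.comp z sx1).mul (su.of_le ENat.LEInfty.out)).smul
      (sx.fderiv_right (m := 1) (by norm_cast))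
  · exact (hφx.mul hu).mul (hcu.mul (hL.cont_X.add hL.cont_Y))
  · exact (hφx.mul hu).mul (hcu.mul (hL.cont_X.sub hL.cont_Y))
  · intro z hz
    simp [hxes z hz]
  · intro z hz
    simp [hxer z hz]
  · intro z hz
    have su1 : ContDiffAt ℝ 1 (fld CharFields.u F) z :=
      (h.smooth_fld hz).1.of_le ENat.LEInfty.out
    exact (hφx.continuousAt.abs.mul ((continuousAt_fderiv_apply su1 _).abs.add
      (continuousAt_fderiv_apply su1 _).abs)).mul hcu.continuousAt
  · intro z hz
    rw [hcurl z hz, hxes z hz, hxer z hz, abs_mul]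
    have hX := hL.X_nonneg z
    have hY := hL.Y_nonneg z
    have hc := h.c_pos (fld CharFields.u F z)
    have h1 : |timeX c F z - timeY c F z| ≤ timeX c F z + timeY c F z := by
      rw [abs_le]; constructor <;> linarith
    rw [mul_assoc, mul_assoc]
    refine mul_le_mul_of_nonneg_left ?_ (abs_nonneg _)
    refine (abs_sub _ _).trans ?_
    rw [abs_mul, abs_mul, abs_mul, abs_mul, abs_of_pos hc, abs_of_nonneg (add_nonneg hX hY),
      add_mul]
    gcongr
  · intro z hz
    simp [hm _ hz]
  · intro θ
    filter_upwards [h.ae_timeX θ] with x hx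
    obtain ⟨hX, hY, e1, e2⟩ := hx
    have hc := h.c_pos (fld CharFields.u F (ξ θ x, η θ x, θ))
    have hxx : fld CharFields.x F (ξ θ x, η θ x, θ) = x := (h.data θ).x_eq x
    have huu : fld CharFields.u F (ξ θ x, η θ x, θ) = (γ θ).pos x := (h.data θ).u_eq x
    rw [e1, e2, hxx]
    rw [huu] at hc ⊢
    have hXY := add_pos hX hY
    field_simp
    ring
  · intro θ hθ
    filter_upwards [h.ae_timeX θ] with x hx
    obtain ⟨hX, hY, e1, e2⟩ := hx
    have hc := h.c_pos (fld CharFields.u F (ξ θ x, η θ x, θ))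
    have hxx : fld CharFields.x F (ξ θ x, η θ x, θ) = x := (h.data θ).x_eq x
    set z : ℝ × ℝ × ℝ := (ξ θ x, η θ x, θ) with hz
    have hzO : z.2.2 ∈ O := hθ
    obtain ⟨du, -, -, -, -, dx, dt⟩ := h.differentiableAt_fld hzO
    have eu : deriv (fun s => (F s).u (ξ θ x) (η θ x)) θ =
      fderiv ℝ (fld CharFields.u F) z (0, 0, 1) := (hasDerivAt_trd_of_differentiableAt du).deriv
    have ex : deriv (fun s => (F s).x (ξ θ x) (η θ x)) θ =
      fderiv ℝ (fld CharFields.x F) z (0, 0, 1) := (hasDerivAt_trd_of_differentiableAt dx).deriv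
    have et : deriv (fun s => (F s).t (ξ θ x) (η θ x)) θ =
      fderiv ℝ (fld CharFields.t F) z (0, 0, 1) := (hasDerivAt_trd_of_differentiableAt dt).deriv
    simp only [hcurl z hzO, hxes z hzO, hxer z hzO, hxx]
    rw [e1, e2, (J_apply ..).1, (H_apply ..).1, eu, ex, et, map_diagonals.1, map_diagonals.2,
      (h.fderiv_u hzO).1, (h.fderiv_u hzO).2]
    change φ x * (_ - Real.sin (fld CharFields.α F z) / (4 * c (fld CharFields.u F z)) *
      ((_ + c (fld CharFields.u F z) * _) * fld CharFields.p F z * _) +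
      Real.sin (fld CharFields.β F z) / (4 * c (fld CharFields.u F z)) *
      ((_ - c (fld CharFields.u F z) * _) * fld CharFields.q F z * _)) = _
    have hXY := add_pos hX hY
    generalize fderiv ℝ (fld CharFields.u F) z (0, 0, 1) = U
    generalize fderiv ℝ (fld CharFields.x F) z (0, 0, 1) = Xi
    generalize fderiv ℝ (fld CharFields.t F) z (0, 0, 1) = T
    generalize timeX c F z = tX at *
    generalize timeY c F z = tY at *
    generalize c (fld CharFields.u F z) = k at *
    generalize Real.sin (fld CharFields.α F z) = sα
    generalize Real.sin (fld CharFields.β F z) = sβ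
    generalize fld CharFields.p F z = p
    generalize fld CharFields.q F z = q
    field_simp
    ring
  · intro θ hθ
    have hle : ∀ x, ENNReal.ofReal |φ x *
      (deriv (fun s => (F s).u (ξ θ x) (η θ x)) θ -
        Real.sin ((F θ).α (ξ θ x) (η θ x)) / (4 * c ((F θ).u (ξ θ x) (η θ x))) *
          (J c F θ (ξ θ x) (η θ x) 0 * ((1 + (γ θ).R c x ^ 2) / (F θ).p (ξ θ x) (η θ x))) +
        Real.sin ((F θ).β (ξ θ x) (η θ x)) / (4 * c ((F θ).u (ξ θ x) (η θ x))) *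
          (H c F θ (ξ θ x) (η θ x) 0 * ((1 + (γ θ).S c x ^ 2) / (F θ).q (ξ θ x) (η θ x))))| ≤
      ENNReal.ofReal (1 / (4 * c₀)) * ENNReal.ofReal (|J c F θ (ξ θ x) (η θ x) 0| *
        ((1 + (γ θ).R c x ^ 2) / (F θ).p (ξ θ x) (η θ x)) +
      |H c F θ (ξ θ x) (η θ x) 0| * ((1 + (γ θ).S c x ^ 2) / (F θ).q (ξ θ x) (η θ x))) +
      ENNReal.ofReal (|J c F θ (ξ θ x) (η θ x) 2| *
        ((1 + (γ θ).R c x ^ 2) / (F θ).p (ξ θ x) (η θ x)) +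
      |H c F θ (ξ θ x) (η θ x) 2| * ((1 + (γ θ).S c x ^ 2) / (F θ).q (ξ θ x) (η θ x))) := by
      intro x
      have hp0 := (h.solves θ).p_pos (ξ θ x) (η θ x)
      have hq0 := (h.solves θ).q_pos (ξ θ x) (η θ x)
      rw [← ENNReal.ofReal_mul (by positivity), ← ENNReal.ofReal_add (by positivity) (by positivity)]
      refine ENNReal.ofReal_le_ofReal ?_
      have hk := hcc₀ ((F θ).u (ξ θ x) (η θ x))
      have hratio : ∀ s : ℝ, |Real.sin s / (4 * c ((F θ).u (ξ θ x) (η θ x)))| ≤ 1 / (4 * c₀) := by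
        intro s
        have hkp := hc₀.trans_le hk
        rw [abs_div, abs_of_pos (by positivity : 0 < 4 * c ((F θ).u (ξ θ x) (η θ x)))]
        gcongr
        exact Real.abs_sin_le_one s
      have hU : |deriv (fun s => (F s).u (ξ θ x) (η θ x)) θ| ≤ |J c F θ (ξ θ x) (η θ x) 2| *
          ((1 + (γ θ).R c x ^ 2) / (F θ).p (ξ θ x) (η θ x)) := by
        rw [(J_apply ..).2.1, abs_mul, abs_of_pos hp0, mul_assoc, mul_div_cancel₀ _ hp0.ne']
        exact le_mul_of_one_le_right (abs_nonneg _) (by linarith [sq_nonneg ((γ θ).R c x)])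
      have hh1 : 0 ≤ (1 + (γ θ).R c x ^ 2) / (F θ).p (ξ θ x) (η θ x) := by positivity
      have hh2 : 0 ≤ (1 + (γ θ).S c x ^ 2) / (F θ).q (ξ θ x) (η θ x) := by positivity
      rw [abs_mul]
      refine (mul_le_of_le_one_left (abs_nonneg _) (hφ1 x)).trans ?_
      refine (abs_add_le _ _).trans ((add_le_add (abs_sub _ _) le_rfl).trans ?_)
      rw [abs_mul (Real.sin ((F θ).α _ _) / _), abs_mul (Real.sin ((F θ).β _ _) / _),
        abs_mul (J ..), abs_mul (H ..), abs_of_nonneg hh1, abs_of_nonneg hh2]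
      have e1 := mul_le_mul_of_nonneg_right (hratio ((F θ).α (ξ θ x) (η θ x)))
        (mul_nonneg (abs_nonneg (J c F θ (ξ θ x) (η θ x) 0)) hh1)
      have e2 := mul_le_mul_of_nonneg_right (hratio ((F θ).β (ξ θ x) (η θ x)))
        (mul_nonneg (abs_nonneg (H c F θ (ξ θ x) (η θ x) 0)) hh2)
      have e3 := mul_nonneg (abs_nonneg (H c F θ (ξ θ x) (η θ x) 2)) hh2
      linarith
    refine (lintegral_mono hle).trans ?_
    have hmeas := h.aemeasurable_line hθ
    rw [lintegral_add_left' (hmeas.const_mul _), lintegral_const_mul' _ _ ENNReal.ofReal_ne_top]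
    have k0 := lineNorm_le (c := c) (γ := γ) (ξ := ξ) (η := η) (h.solves θ) (hκ 0)
    have k2 := lineNorm_le (c := c) (γ := γ) (ξ := ξ) (η := η) (h.solves θ) (hκ 2)
    refine (add_le_add (mul_le_mul_right k0 _) k2).trans ?_
    have hκ0 := hκ 0
    have hκ2 := hκ 2
    rw [← mul_assoc, ← ENNReal.ofReal_mul (by positivity), ← add_mul,
      ← ENNReal.ofReal_add (by positivity) (by positivity), add_comm (1 / κ 2)]

end Family

/-! ### Growth of integrals against the energy measure -/

/-- The coefficient of `dX` in the energy form. -/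
def energyX (F : ℝ → CharFields) (z : ℝ × ℝ × ℝ) : ℝ :=
  fld CharFields.p F z * (1 - Real.cos (fld CharFields.α F z)) / 4

/-- The coefficient of `-dY` in the energy form. -/
def energyY (F : ℝ → CharFields) (z : ℝ × ℝ × ℝ) : ℝ :=
  fld CharFields.q F z * (1 - Real.cos (fld CharFields.β F z)) / 4

theorem one_sub_cos_eq (α : ℝ) : 1 - Real.cos α = 2 * Real.sin (α / 2) ^ 2 := by
  have := one_add_cos_eq α
  have := Real.sin_sq_add_cos_sq (α / 2)
  linarith

namespace Family

variable {c : ℝ → ℝ} {γ : ℝ → WaveData} {F : ℝ → CharFields} {ξ η : ℝ → ℝ → ℝ} {O : Set ℝ}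

theorem smooth_energy (h : Family c γ F ξ η O) {z : ℝ × ℝ × ℝ} (hz : z.2.2 ∈ O) :
    ContDiffAt ℝ ∞ (energyX F) z ∧ ContDiffAt ℝ ∞ (energyY F) z := by
  obtain ⟨-, hα, hβ, hp, hq, -, -⟩ := h.smooth_fld hz
  exact ⟨(hp.mul (contDiffAt_const.sub hα.cos)).div_const 4,
    (hq.mul (contDiffAt_const.sub hβ.cos)).div_const 4⟩

/-- The energy form `energyX dX - energyY dY` is closed. -/
theorem energy_closed (h : Family c γ F ξ η O) {z : ℝ × ℝ × ℝ} (hz : z.2.2 ∈ O) :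
    fderiv ℝ (energyX F) z (0, 1, 0) + fderiv ℝ (energyY F) z (1, 0, 0) = 0 := by
  have hn : (∞ : WithTop ℕ∞) ≠ 0 := by simp
  have hs := h.solves z.2.2
  have h1 := (((hs.p_Y z.1 z.2.1).mul ((hs.α_Y z.1 z.2.1).cos.const_sub 1)).div_const 4).unique
    (hasDerivAt_snd_of_differentiableAt (g := energyX F)
      ((h.smooth_energy hz).1.differentiableAt hn))
  have h2 := (((hs.q_X z.1 z.2.1).mul ((hs.β_X z.1 z.2.1).cos.const_sub 1)).div_const 4).unique
    (hasDerivAt_fst_of_differentiableAt (g := energyY F)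
      ((h.smooth_energy hz).2.differentiableAt hn))
  rw [← h1, ← h2]
  ring

/-- The variation of the coefficients of the energy form is given by `J₆` and `H₆`. -/
theorem fderiv_energy (h : Family c γ F ξ η O) {X Y θ : ℝ} (hθ : θ ∈ O) :
    fderiv ℝ (energyX F) (X, Y, θ) (0, 0, 1) = J c F θ X Y 5 / 2 ∧
      fderiv ℝ (energyY F) (X, Y, θ) (0, 0, 1) = H c F θ X Y 5 / 2 := by
  have hn : (∞ : WithTop ℕ∞) ≠ 0 := by simp
  have hz : (X, Y, θ).2.2 ∈ O := hθ
  obtain ⟨-, hα, hβ, hp, hq, -, -⟩ := h.differentiableAt_fld hz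
  have dα : HasDerivAt (fun s => (F s).α X Y) (deriv (fun s => (F s).α X Y) θ) θ :=
    (hasDerivAt_trd_of_differentiableAt hα).differentiableAt.hasDerivAt
  have dβ : HasDerivAt (fun s => (F s).β X Y) (deriv (fun s => (F s).β X Y) θ) θ :=
    (hasDerivAt_trd_of_differentiableAt hβ).differentiableAt.hasDerivAt
  have dp : HasDerivAt (fun s => (F s).p X Y) (deriv (fun s => (F s).p X Y) θ) θ :=
    (hasDerivAt_trd_of_differentiableAt hp).differentiableAt.hasDerivAt
  have dq : HasDerivAt (fun s => (F s).q X Y) (deriv (fun s => (F s).q X Y) θ) θ :=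
    (hasDerivAt_trd_of_differentiableAt hq).differentiableAt.hasDerivAt
  have h1 := ((dp.mul (dα.cos.const_sub 1)).div_const 4).unique
    (hasDerivAt_trd_of_differentiableAt (g := energyX F)
      ((h.smooth_energy hz).1.differentiableAt hn))
  have h2 := ((dq.mul (dβ.cos.const_sub 1)).div_const 4).unique
    (hasDerivAt_trd_of_differentiableAt (g := energyY F)
      ((h.smooth_energy hz).2.differentiableAt hn))
  rw [← h1, ← h2, (J_apply ..).2.2, (H_apply ..).2, one_sub_cos_eq, one_sub_cos_eq]
  constructor <;> ring

/-- Growth of `∫ f dμ` along the family, where `μ` is the energy measure.  The bound `2` for `f'`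
leaves room for the product of an admissible test function with a cutoff. -/
theorem ofReal_abs_integral_density_sub_le (h : Family c γ F ξ η O)
    (hO : (Set.Ioo (0 : ℝ) 1 \ O).Countable) (hO1 : O ⊆ Set.Icc 0 1)
    {κ : Fin 6 → ℝ} (hκ : ∀ l, 0 < κ l)
    {f : ℝ → ℝ} (hf : ContDiff ℝ 1 f) (hf1 : ∀ x, |f x| ≤ 1) (hf2 : ∀ x, |deriv f x| ≤ 2)
    {m : ℝ} (hm0 : 0 ≤ m) (hm : ∀ x, m ≤ |x| → f x = 0) :
    ENNReal.ofReal |(∫ x, f x * (γ 1).density c x) - ∫ x, f x * (γ 0).density c x| ≤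
      ENNReal.ofReal (1 / κ 0 + 1 / κ 5) *
        ∫⁻ θ in Set.Icc (0 : ℝ) 1, tangentNorm c κ γ F ξ η θ := by
  obtain ⟨hu, hα, hβ, hp, hq, hx, ht⟩ := h.continuous_fld
  have hL := h.levelFamily
  have hn : (∞ : WithTop ℕ∞) ≠ 0 := by simp
  have hcu := h.c_smooth.continuous.comp hu
  have hfx := hf.continuous.comp hx
  have hEX : Continuous (energyX F) :=
    (hp.mul (continuous_const.sub (Real.continuous_cos.comp hα))).div_const 4
  have hEY : Continuous (energyY F) :=
    (hq.mul (continuous_const.sub (Real.continuous_cos.comp hβ))).div_const 4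
  have hdA : ∀ {E : ℝ × ℝ × ℝ → ℝ} {z : ℝ × ℝ × ℝ}, z.2.2 ∈ O → ContDiffAt ℝ ∞ E z →
      HasFDerivAt (fun z => f (fld CharFields.x F z) * E z)
        (f (fld CharFields.x F z) • fderiv ℝ E z +
          E z • (deriv f (fld CharFields.x F z) • fderiv ℝ (fld CharFields.x F) z)) z := by
    intro E z hz hE
    have h1 : HasFDerivAt (fun z => f (fld CharFields.x F z))
        (deriv f (fld CharFields.x F z) • fderiv ℝ (fld CharFields.x F) z) z :=
      (hf.differentiable one_ne_zero _).hasDerivAt.comp_hasFDerivAt z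
        (h.differentiableAt_fld hz).2.2.2.2.2.1.hasFDerivAt
    exact h1.mul (hE.differentiableAt hn).hasFDerivAt
  have hcurl : ∀ z : ℝ × ℝ × ℝ, z.2.2 ∈ O → ∀ v w, curl (fun z =>
      (f (fld CharFields.x F z) * energyX F z) • ContinuousLinearMap.fst ℝ ℝ (ℝ × ℝ) +
      (f (fld CharFields.x F z) * -energyY F z) •
        (ContinuousLinearMap.fst ℝ ℝ ℝ).comp (ContinuousLinearMap.snd ℝ ℝ (ℝ × ℝ))) z v w = _ :=
    fun z hz v w => curl_smul_add_smul (hdA hz (h.smooth_energy hz).1).differentiableAt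
      (hdA hz (h.smooth_energy hz).2.neg).differentiableAt v w
  have hfA : ∀ z : ℝ × ℝ × ℝ, z.2.2 ∈ O → ∀ v,
      fderiv ℝ (fun z => f (fld CharFields.x F z) * energyX F z) z v =
        f (fld CharFields.x F z) * fderiv ℝ (energyX F) z v +
          energyX F z * (deriv f (fld CharFields.x F z) * fderiv ℝ (fld CharFields.x F) z v) :=
    fun z hz v => by rw [(hdA hz (h.smooth_energy hz).1).fderiv]; simp
  have hfB : ∀ z : ℝ × ℝ × ℝ, z.2.2 ∈ O → ∀ v,
      fderiv ℝ (fun z => f (fld CharFields.x F z) * -energyY F z) z v =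
        -(f (fld CharFields.x F z) * fderiv ℝ (energyY F) z v +
          energyY F z * (deriv f (fld CharFields.x F z) * fderiv ℝ (fld CharFields.x F) z v)) :=
    fun z hz v => by
      have h2 : fderiv ℝ (fun z => -energyY F z) z = -fderiv ℝ (energyY F) z := fderiv_neg
      rw [(hdA hz (h.smooth_energy hz).2.neg).fderiv, h2]
      simp
      ring
  -- only the derivative of `f` contributes to the planar part, because the energy form is closed
  have hcurl2 : ∀ z : ℝ × ℝ × ℝ, z.2.2 ∈ O → curl (fun z =>
      (f (fld CharFields.x F z) * energyX F z) • ContinuousLinearMap.fst ℝ ℝ (ℝ × ℝ) +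
      (f (fld CharFields.x F z) * -energyY F z) •
        (ContinuousLinearMap.fst ℝ ℝ ℝ).comp (ContinuousLinearMap.snd ℝ ℝ (ℝ × ℝ))) z
          (1, 1, 0) (1, -1, 0) = 2 * deriv f (fld CharFields.x F z) * c (fld CharFields.u F z) *
            (energyY F z * timeX c F z - energyX F z * timeY c F z) := by
    intro z hz
    have hcl := h.energy_closed hz
    rw [hcurl z hz, hfA z hz, hfA z hz, hfB z hz, hfB z hz]
    simp only [map_diagonals.1, map_diagonals.2, (h.fderiv_x hz).1, (h.fderiv_x hz).2]
    linear_combination 2 * f (fld CharFields.x F z) * hcl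
  refine h.ofReal_abs_sub_le hO hO1
    (σ := fun z => (f (fld CharFields.x F z) * energyX F z) •
        ContinuousLinearMap.fst ℝ ℝ (ℝ × ℝ) +
      (f (fld CharFields.x F z) * -energyY F z) •
        (ContinuousLinearMap.fst ℝ ℝ ℝ).comp (ContinuousLinearMap.snd ℝ ℝ (ℝ × ℝ))) ?_
    (a := fun z => f (fld CharFields.x F z) * (energyX F z + energyY F z))
    (b := fun z => f (fld CharFields.x F z) * (energyX F z - energyY F z))
    (B := fun z => 2 * |deriv f (fld CharFields.x F z)| * c (fld CharFields.u F z) *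
      (|energyX F z| + |energyY F z|))
    ?_ ?_ ?_ ?_ ?_ ?_ hm0 ?_ (g := fun θ x => f x * (γ θ).density c x) ?_ (d := fun θ x =>
      deriv f x * (energyX F (ξ θ x, η θ x, θ) / (F θ).p (ξ θ x) (η θ x)) *
        (J c F θ (ξ θ x) (η θ x) 0 * ((1 + (γ θ).R c x ^ 2) / (F θ).p (ξ θ x) (η θ x))) +
      deriv f x * (energyY F (ξ θ x, η θ x, θ) / (F θ).q (ξ θ x) (η θ x)) *
        (H c F θ (ξ θ x) (η θ x) 0 * ((1 + (γ θ).S c x ^ 2) / (F θ).q (ξ θ x) (η θ x))) +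
      f x * (J c F θ (ξ θ x) (η θ x) 5 / 2 *
          ((1 + (γ θ).R c x ^ 2) / (F θ).p (ξ θ x) (η θ x)) +
        H c F θ (ξ θ x) (η θ x) 5 / 2 * ((1 + (γ θ).S c x ^ 2) / (F θ).q (ξ θ x) (η θ x))))
    ?_ ENNReal.ofReal_ne_top ?_
  · intro z hz
    have sx1 : ContDiffAt ℝ 1 (fld CharFields.x F) z :=
      (h.smooth_fld hz).2.2.2.2.2.1.of_le ENat.LEInfty.out
    have sf : ContDiffAt ℝ 1 (fun z => f (fld CharFields.x F z)) z := hf.contDiffAt.comp z sx1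
    exact ((sf.mul ((h.smooth_energy hz).1.of_le ENat.LEInfty.out)).smul contDiffAt_const).add
      ((sf.mul ((h.smooth_energy hz).2.neg.of_le ENat.LEInfty.out)).smul contDiffAt_const)
  · exact hfx.mul (hEX.add hEY)
  · exact hfx.mul (hEX.sub hEY)
  · intro z _
    simp
    ring
  · intro z _
    simp
    ring
  · intro z _
    have hf' : Continuous fun z => deriv f (fld CharFields.x F z) :=
      (hf.continuous_deriv le_rfl).comp hx
    exact ((continuousAt_const.mul hf'.continuousAt.abs).mul hcu.continuousAt).mul
      (hEX.continuousAt.abs.add hEY.continuousAt.abs)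
  · intro z hz
    rw [hcurl2 z hz]
    have hX := hL.X_nonneg z
    have hY := hL.Y_nonneg z
    have hc := h.c_pos (fld CharFields.u F z)
    rw [abs_mul, abs_mul, abs_mul, abs_of_pos hc, abs_two, mul_assoc _ (_ + _)]
    refine mul_le_mul_of_nonneg_left ?_ (by positivity)
    refine (abs_sub _ _).trans ?_
    rw [abs_mul, abs_mul, abs_of_nonneg hX, abs_of_nonneg hY]
    nlinarith [mul_nonneg (abs_nonneg (energyX F z)) hX, mul_nonneg (abs_nonneg (energyY F z)) hY]
  · intro z hz
    simp [hm _ hz]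
  · intro θ
    filter_upwards [h.ae_timeX θ, (h.data θ).α_eq, (h.data θ).β_eq] with x hx hαx hβx
    obtain ⟨hX, hY, e1, e2⟩ := hx
    obtain ⟨-, -, r1⟩ := half_angle hαx
    obtain ⟨-, -, r2⟩ := half_angle hβx
    have hp0 := (h.solves θ).p_pos (ξ θ x) (η θ x)
    have hq0 := (h.solves θ).q_pos (ξ θ x) (η θ x)
    have hc := h.c_pos (fld CharFields.u F (ξ θ x, η θ x, θ))
    have hxx : fld CharFields.x F (ξ θ x, η θ x, θ) = x := (h.data θ).x_eq x
    have a1 : energyX F (ξ θ x, η θ x, θ) * ((1 + (γ θ).R c x ^ 2) / (F θ).p (ξ θ x) (η θ x)) =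
        (γ θ).R c x ^ 2 / 2 := by
      have hS : ∀ S P r : ℝ, P ≠ 0 → P * (2 * S) / 4 * (r / P) = S * r / 2 := fun S P r hP => by
        field_simp
        ring
      simp only [energyX, fld, one_sub_cos_eq]
      rw [hS _ _ _ hp0.ne', ← r1]
    have a2 : energyY F (ξ θ x, η θ x, θ) * ((1 + (γ θ).S c x ^ 2) / (F θ).q (ξ θ x) (η θ x)) =
        (γ θ).S c x ^ 2 / 2 := by
      have hS : ∀ S P r : ℝ, P ≠ 0 → P * (2 * S) / 4 * (r / P) = S * r / 2 := fun S P r hP => by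
        field_simp
        ring
      simp only [energyY, fld, one_sub_cos_eq]
      rw [hS _ _ _ hq0.ne', ← r2]
    rw [WaveData.density_eq, add_div, ← a1, ← a2, e1, e2, hxx]
    have hXY := add_pos hX hY
    field_simp
    ring
  · intro θ hθ
    filter_upwards [h.ae_timeX θ] with x hx
    obtain ⟨hX, hY, e1, e2⟩ := hx
    have hc := h.c_pos (fld CharFields.u F (ξ θ x, η θ x, θ))
    have hxx : fld CharFields.x F (ξ θ x, η θ x, θ) = x := (h.data θ).x_eq x
    have hp0 : 0 < fld CharFields.p F (ξ θ x, η θ x, θ) := (h.solves θ).p_pos (ξ θ x) (η θ x)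
    have hq0 : 0 < fld CharFields.q F (ξ θ x, η θ x, θ) := (h.solves θ).q_pos (ξ θ x) (η θ x)
    set z : ℝ × ℝ × ℝ := (ξ θ x, η θ x, θ) with hz
    have hzO : z.2.2 ∈ O := hθ
    obtain ⟨-, -, -, -, -, dx, dt⟩ := h.differentiableAt_fld hzO
    have ex : deriv (fun s => (F s).x (ξ θ x) (η θ x)) θ =
      fderiv ℝ (fld CharFields.x F) z (0, 0, 1) := (hasDerivAt_trd_of_differentiableAt dx).deriv
    have et : deriv (fun s => (F s).t (ξ θ x) (η θ x)) θ =
      fderiv ℝ (fld CharFields.t F) z (0, 0, 1) := (hasDerivAt_trd_of_differentiableAt dt).deriv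
    rw [hcurl2 z hzO, hcurl z hzO, hcurl z hzO, hfA z hzO, hfA z hzO, hfA z hzO, hfB z hzO,
      hfB z hzO, hfB z hzO, e1, e2, (J_apply ..).1, (H_apply ..).1, ex, et, ← (h.fderiv_energy hθ).1,
      ← (h.fderiv_energy hθ).2, hxx]
    change deriv f x * (energyX F z / fld CharFields.p F z) *
        ((_ + c (fld CharFields.u F z) * _) * fld CharFields.p F z * _) +
      deriv f x * (energyY F z / fld CharFields.q F z) *
        ((_ - c (fld CharFields.u F z) * _) * fld CharFields.q F z * _) +
      f x * (fderiv ℝ (energyX F) z (0, 0, 1) * _ + fderiv ℝ (energyY F) z (0, 0, 1) * _) = _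
    have hXY := add_pos hX hY
    simp only
    generalize fderiv ℝ (energyX F) z (0, 0, 1) = A
    generalize fderiv ℝ (energyY F) z (0, 0, 1) = B
    generalize fderiv ℝ (fld CharFields.x F) z (0, 0, 1) = Xi
    generalize fderiv ℝ (fld CharFields.t F) z (0, 0, 1) = T
    generalize timeX c F z = tX at *
    generalize timeY c F z = tY at *
    generalize c (fld CharFields.u F z) = k at *
    generalize energyX F z = eX
    generalize energyY F z = eY
    generalize fld CharFields.p F z = p at *
    generalize fld CharFields.q F z = q at *
    field_simp
    ring
  · intro θ hθ
    have hle : ∀ x, ENNReal.ofReal |deriv f x * (energyX F (ξ θ x, η θ x, θ) /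
          (F θ).p (ξ θ x) (η θ x)) *
        (J c F θ (ξ θ x) (η θ x) 0 * ((1 + (γ θ).R c x ^ 2) / (F θ).p (ξ θ x) (η θ x))) +
      deriv f x * (energyY F (ξ θ x, η θ x, θ) / (F θ).q (ξ θ x) (η θ x)) *
        (H c F θ (ξ θ x) (η θ x) 0 * ((1 + (γ θ).S c x ^ 2) / (F θ).q (ξ θ x) (η θ x))) +
      f x * (J c F θ (ξ θ x) (η θ x) 5 / 2 *
          ((1 + (γ θ).R c x ^ 2) / (F θ).p (ξ θ x) (η θ x)) +
        H c F θ (ξ θ x) (η θ x) 5 / 2 *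
          ((1 + (γ θ).S c x ^ 2) / (F θ).q (ξ θ x) (η θ x)))| ≤
      ENNReal.ofReal (|J c F θ (ξ θ x) (η θ x) 0| *
        ((1 + (γ θ).R c x ^ 2) / (F θ).p (ξ θ x) (η θ x)) +
      |H c F θ (ξ θ x) (η θ x) 0| * ((1 + (γ θ).S c x ^ 2) / (F θ).q (ξ θ x) (η θ x))) +
      ENNReal.ofReal (|J c F θ (ξ θ x) (η θ x) 5| *
        ((1 + (γ θ).R c x ^ 2) / (F θ).p (ξ θ x) (η θ x)) +
      |H c F θ (ξ θ x) (η θ x) 5| * ((1 + (γ θ).S c x ^ 2) / (F θ).q (ξ θ x) (η θ x))) := by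
      intro x
      have hp0 := (h.solves θ).p_pos (ξ θ x) (η θ x)
      have hq0 := (h.solves θ).q_pos (ξ θ x) (η θ x)
      rw [← ENNReal.ofReal_add (by positivity) (by positivity)]
      refine ENNReal.ofReal_le_ofReal ?_
      have hcos : ∀ s, |(1 - Real.cos s) / 4| ≤ 1 / 2 := fun s => by
        rw [abs_le]; constructor <;> linarith [Real.cos_le_one s, Real.neg_one_le_cos s]
      have q1 : |deriv f x * (energyX F (ξ θ x, η θ x, θ) / (F θ).p (ξ θ x) (η θ x))| ≤ 1 := by
        have : energyX F (ξ θ x, η θ x, θ) / (F θ).p (ξ θ x) (η θ x) =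
            (1 - Real.cos ((F θ).α (ξ θ x) (η θ x))) / 4 := by
          simp only [energyX, fld]
          field_simp
        rw [this, abs_mul]
        exact (mul_le_mul (hf2 x) (hcos _) (abs_nonneg _) zero_le_two).trans_eq (by norm_num)
      have q2 : |deriv f x * (energyY F (ξ θ x, η θ x, θ) / (F θ).q (ξ θ x) (η θ x))| ≤ 1 := by
        have : energyY F (ξ θ x, η θ x, θ) / (F θ).q (ξ θ x) (η θ x) =
            (1 - Real.cos ((F θ).β (ξ θ x) (η θ x))) / 4 := by
          simp only [energyY, fld]
          field_simp
        rw [this, abs_mul]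
        exact (mul_le_mul (hf2 x) (hcos _) (abs_nonneg _) zero_le_two).trans_eq (by norm_num)
      have hh1 : 0 ≤ (1 + (γ θ).R c x ^ 2) / (F θ).p (ξ θ x) (η θ x) := by positivity
      have hh2 : 0 ≤ (1 + (γ θ).S c x ^ 2) / (F θ).q (ξ θ x) (η θ x) := by positivity
      refine (abs_add_le _ _).trans (add_le_add ((abs_add_le _ _).trans (add_le_add ?_ ?_)) ?_)
      · rw [abs_mul, abs_mul (J ..), abs_of_nonneg hh1]
        exact mul_le_of_le_one_left (mul_nonneg (abs_nonneg _) hh1) q1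
      · rw [abs_mul, abs_mul (H ..), abs_of_nonneg hh2]
        exact mul_le_of_le_one_left (mul_nonneg (abs_nonneg _) hh2) q2
      · rw [abs_mul]
        refine (mul_le_of_le_one_left (abs_nonneg _) (hf1 x)).trans
          ((abs_add_le _ _).trans (add_le_add ?_ ?_))
        · rw [abs_mul, abs_of_nonneg hh1, abs_div, abs_two]
          exact mul_le_mul_of_nonneg_right (half_le_self (abs_nonneg _)) hh1
        · rw [abs_mul, abs_of_nonneg hh2, abs_div, abs_two]
          exact mul_le_mul_of_nonneg_right (half_le_self (abs_nonneg _)) hh2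
    refine (lintegral_mono hle).trans ?_
    rw [lintegral_add_left' (h.aemeasurable_line hθ)]
    refine (add_le_add (lineNorm_le (c := c) (γ := γ) (ξ := ξ) (η := η) (h.solves θ) (hκ 0))
      (lineNorm_le (c := c) (γ := γ) (ξ := ξ) (η := η) (h.solves θ) (hκ 5))).trans ?_
    have hκ0 := hκ 0
    have hκ5 := hκ 5
    rw [← add_mul, ← ENNReal.ofReal_add (by positivity) (by positivity)]

end Family

/-! ### Piecewise regular paths -/

/-- The nearest point of `[0, 1]`. -/
def clamp (θ : ℝ) : ℝ := max 0 (min θ 1)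

theorem clamp_mem (θ : ℝ) : clamp θ ∈ Set.Icc (0 : ℝ) 1 :=
  ⟨le_max_left _ _, max_le zero_le_one (min_le_right _ _)⟩

theorem clamp_of_mem {θ : ℝ} (h : θ ∈ Set.Icc (0 : ℝ) 1) : clamp θ = θ := by
  rw [clamp, min_eq_left h.2, max_eq_right h.1]

theorem continuous_clamp : Continuous clamp := by
  unfold clamp; fun_prop

/-- A piecewise regular path gives a family of solutions, extended by constants to all real
parameters. -/
theorem IsRegularRep.exists_family {c : ℝ → ℝ} (hc : ContDiff ℝ ∞ c) (hc0 : ∀ v, 0 < c v) {K : ℝ}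
    {γ : ℝ → WaveData} {F : ℝ → CharFields} {ξ η : ℝ → ℝ → ℝ} (h : IsRegularRep c γ F ξ η)
    (hγ : ∀ θ ∈ Set.Icc (0 : ℝ) 1, γ θ ∈ energySublevel c K) :
    ∃ O : Set ℝ, (Set.Ioo (0 : ℝ) 1 \ O).Countable ∧ O ⊆ Set.Icc 0 1 ∧
      Family c (γ ∘ clamp) (F ∘ clamp) (ξ ∘ clamp) (η ∘ clamp) O := by
  obtain ⟨E, hE, -⟩ := h.pieces
  have hOo : IsOpen (Set.Ioo (0 : ℝ) 1 \ (E : Set ℝ)) :=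
    isOpen_Ioo.sdiff E.finite_toSet.isClosed
  have hjoint : joint (F ∘ clamp) =
      joint F ∘ fun z : ℝ × ℝ × ℝ => (z.1, z.2.1, clamp z.2.2) := rfl
  have hmap : Continuous fun z : ℝ × ℝ × ℝ => (z.1, z.2.1, clamp z.2.2) := by
    have := continuous_clamp
    fun_prop
  refine ⟨Set.Ioo (0 : ℝ) 1 \ E, ?_, fun θ hθ => ⟨hθ.1.1.le, hθ.1.2.le⟩, hc, hc0, ?_,
    fun θ => h.solves _ (clamp_mem θ), fun θ => h.data _ (clamp_mem θ),
    fun θ => (hγ _ (clamp_mem θ)).1,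
    fun θ => ((hγ _ (clamp_mem θ)).2.trans_lt ENNReal.ofReal_lt_top).ne, hOo, fun z hz => ?_⟩
  · refine E.countable_toSet.mono fun θ hθ => ?_
    by_contra hcon
    exact hθ.2 ⟨hθ.1, hcon⟩
  · rw [hjoint, ← continuousOn_univ]
    exact h.cont.comp hmap.continuousOn fun z _ => clamp_mem _
  · have hopen : IsOpen {z : ℝ × ℝ × ℝ | z.2.2 ∈ Set.Ioo (0 : ℝ) 1 \ (E : Set ℝ)} :=
      hOo.preimage (by fun_prop)
    refine (hE.contDiffAt (hopen.mem_nhds hz)).congr_of_eventuallyEq ?_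
    filter_upwards [hopen.mem_nhds hz] with y hy
    simp only [hjoint, Function.comp_apply]
    rw [clamp_of_mem ⟨hy.1.1.le, hy.1.2.le⟩]

theorem tangentNorm_clamp (c : ℝ → ℝ) (κ : Fin 6 → ℝ) (γ : ℝ → WaveData) (F : ℝ → CharFields)
    (ξ η : ℝ → ℝ → ℝ) {θ : ℝ} (hθ : θ ∈ Set.Ioo (0 : ℝ) 1) :
    tangentNorm c κ (γ ∘ clamp) (F ∘ clamp) (ξ ∘ clamp) (η ∘ clamp) θ =
      tangentNorm c κ γ F ξ η θ := by
  have h1 : clamp θ = θ := clamp_of_mem ⟨hθ.1.le, hθ.2.le⟩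
  have hev : ∀ g : CharFields → ℝ, deriv (fun s => g ((F ∘ clamp) s)) θ =
      deriv (fun s => g (F s)) θ := fun g => by
    refine Filter.EventuallyEq.deriv_eq ?_
    filter_upwards [isOpen_Ioo.mem_nhds hθ] with s hs
    rw [Function.comp_apply, clamp_of_mem ⟨hs.1.le, hs.2.le⟩]
  have hJ : ∀ X Y, J c (F ∘ clamp) θ X Y = J c F θ X Y := fun X Y => by
    unfold J
    simp only [hev (fun G => G.t X Y), hev (fun G => G.x X Y), hev (fun G => G.u X Y),
      hev (fun G => G.α X Y), hev (fun G => G.p X Y)]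
    simp only [Function.comp_apply, h1]
  have hH : ∀ X Y, H c (F ∘ clamp) θ X Y = H c F θ X Y := fun X Y => by
    unfold H
    simp only [hev (fun G => G.t X Y), hev (fun G => G.x X Y), hev (fun G => G.u X Y),
      hev (fun G => G.β X Y), hev (fun G => G.q X Y)]
    simp only [Function.comp_apply, h1]
  unfold tangentNorm
  simp only [hJ, hH]
  simp only [Function.comp_apply, h1]

theorem lintegral_tangentNorm_clamp (c : ℝ → ℝ) (κ : Fin 6 → ℝ) (γ : ℝ → WaveData)
    (F : ℝ → CharFields) (ξ η : ℝ → ℝ → ℝ) :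
    ∫⁻ θ in Set.Icc (0 : ℝ) 1,
        tangentNorm c κ (γ ∘ clamp) (F ∘ clamp) (ξ ∘ clamp) (η ∘ clamp) θ =
      ∫⁻ θ in Set.Icc (0 : ℝ) 1, tangentNorm c κ γ F ξ η θ := by
  rw [Measure.restrict_congr_set Ioo_ae_eq_Icc.symm]
  exact setLIntegral_congr_fun measurableSet_Ioo fun θ hθ => tangentNorm_clamp c κ γ F ξ η hθ

/-- To bound a quantity by a multiple of the geodesic distance, it is enough to bound it along
families of solutions. -/
theorem le_mul_geodesicDist {c : ℝ → ℝ} (hc : ContDiff ℝ ∞ c) (hc0 : ∀ v, 0 < c v)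
    {κ : Fin 6 → ℝ} {K : ℝ} {a b : WaveData} {V : ENNReal} {C : ℝ} (hC : 0 < C)
    (hV : ∀ (γ : ℝ → WaveData) (F : ℝ → CharFields) (ξ η : ℝ → ℝ → ℝ) (O : Set ℝ),
      (Set.Ioo (0 : ℝ) 1 \ O).Countable → O ⊆ Set.Icc 0 1 → Family c γ F ξ η O →
      γ 0 = a → γ 1 = b →
        V ≤ ENNReal.ofReal C * ∫⁻ θ in Set.Icc (0 : ℝ) 1, tangentNorm c κ γ F ξ η θ) :
    V ≤ ENNReal.ofReal C * geodesicDist c κ K a b := by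
  have hC0 : ENNReal.ofReal C ≠ 0 := (ENNReal.ofReal_pos.2 hC).ne'
  have hCt : ENNReal.ofReal C ≠ ⊤ := ENNReal.ofReal_ne_top
  rw [mul_comm, ← ENNReal.div_le_iff_le_mul (Or.inl hC0) (Or.inl hCt)]
  simp only [geodesicDist, pathLength, le_iInf_iff]
  intro γ ha hb hγ F ξ η hrep
  rw [ENNReal.div_le_iff_le_mul (Or.inl hC0) (Or.inl hCt), mul_comm]
  obtain ⟨O, hO, hO1, hfam⟩ := hrep.exists_family hc hc0 hγ
  have h0 : clamp 0 = 0 := clamp_of_mem ⟨le_rfl, zero_le_one⟩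
  have h1 : clamp 1 = 1 := clamp_of_mem ⟨zero_le_one, le_rfl⟩
  have := hV _ _ _ _ O hO hO1 hfam (by simp [h0, ha]) (by simp [h1, hb])
  rwa [lintegral_tangentNorm_clamp] at this

/-! ### Smooth data of compact support -/

theorem exists_bound_of_hasCompactSupport {f : ℝ → ℝ} (hf : HasCompactSupport f) :
    ∃ m : ℝ, 0 ≤ m ∧ ∀ x, m ≤ |x| → f x = 0 := by
  obtain ⟨r, hr⟩ := hf.isCompact.isBounded.subset_closedBall (0 : ℝ)
  refine ⟨max r 0 + 1, by positivity, fun x hx => image_eq_zero_of_notMem_tsupport fun h => ?_⟩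
  have := hr h
  rw [mem_closedBall_zero_iff, Real.norm_eq_abs] at this
  linarith [le_max_left r 0]

theorem le_of_forall_pos_ofReal_sub_mul {I m : ℝ} {L : ENNReal}
    (h : ∀ ε : ℝ, 0 < ε → ENNReal.ofReal (I - m * ε) ≤ L) : ENNReal.ofReal I ≤ L := by
  have h1 : Tendsto (fun ε : ℝ => ENNReal.ofReal (I - m * ε)) (𝓝[>] 0) (𝓝 (ENNReal.ofReal I)) := by
    have h2 : Continuous fun ε : ℝ => ENNReal.ofReal (I - m * ε) :=
      ENNReal.continuous_ofReal.comp (by fun_prop)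
    simpa using (h2.tendsto 0).mono_left nhdsWithin_le_nhds
  exact le_of_tendsto h1 (eventually_mem_nhdsWithin.mono fun ε hε => h ε hε)

/-- The `L¹` estimate for test data: `φ` runs through smooth approximations of the sign of the
difference of the profiles. -/
theorem eLpNorm_pos_sub_le_of_isTest {c : ℝ → ℝ} (hc : ContDiff ℝ ∞ c) {c₀ : ℝ} (hc₀ : 0 < c₀)
    (hcc₀ : ∀ v, c₀ ≤ c v) {κ : Fin 6 → ℝ} (hκ : ∀ l, 0 < κ l) {K : ℝ} {a b : WaveData}
    (ha : a.IsTest) (hb : b.IsTest) :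
    eLpNorm (fun x => a.pos x - b.pos x) 1 volume ≤
      ENNReal.ofReal (1 / κ 2 + 1 / (4 * c₀) * (1 / κ 0)) * geodesicDist c κ K a b := by
  have hκ0 := hκ 0
  have hκ2 := hκ 2
  set w : ℝ → ℝ := fun x => b.pos x - a.pos x
  have hwsm : ContDiff ℝ ∞ w := hb.1.sub ha.1
  have hwcs : HasCompactSupport w := hb.2.1.sub ha.2.1
  obtain ⟨m, hm0, hm⟩ := exists_bound_of_hasCompactSupport hwcs
  have hwint : Integrable w := hwsm.continuous.integrable_of_hasCompactSupport hwcs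
  have hnorm : eLpNorm (fun x => a.pos x - b.pos x) 1 volume = ENNReal.ofReal (∫ x, |w x|) := by
    rw [eLpNorm_one_eq_lintegral_enorm, ofReal_integral_eq_lintegral_ofReal hwint.abs
      (ae_of_all _ fun x => abs_nonneg _)]
    refine lintegral_congr fun x => ?_
    rw [Real.enorm_eq_ofReal_abs, abs_sub_comm]
  rw [hnorm]
  refine le_of_forall_pos_ofReal_sub_mul (m := 2 * m) fun ε hε => ?_
  -- a smooth approximation of the sign of `w`
  set φ : ℝ → ℝ := fun x => w x / √(w x ^ 2 + ε ^ 2) with hφ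
  have hpos : ∀ x, 0 < w x ^ 2 + ε ^ 2 := fun x => by positivity
  have hsqrt : ∀ x, |w x| ≤ √(w x ^ 2 + ε ^ 2) ∧ √(w x ^ 2 + ε ^ 2) ≤ |w x| + ε := fun x => by
    constructor
    · exact Real.abs_le_sqrt (by nlinarith)
    · rw [Real.sqrt_le_left (by positivity)]
      nlinarith [abs_nonneg (w x), sq_abs (w x)]
  have hφsm : ContDiff ℝ 1 φ := by
    have hw1 : ContDiff ℝ 1 w := hwsm.of_le ENat.LEInfty.out
    exact hw1.div (((hw1.pow 2).add contDiff_const).sqrt fun x => (hpos x).ne')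
      fun x => (Real.sqrt_pos.2 (hpos x)).ne'
  have hφ1 : ∀ x, |φ x| ≤ 1 := fun x => by
    simp only [hφ]
    rw [abs_div, abs_of_nonneg (Real.sqrt_nonneg _)]
    exact div_le_one_of_le₀ (hsqrt x).1 (Real.sqrt_nonneg _)
  have hφm : ∀ x, m ≤ |x| → φ x = 0 := fun x hx => by simp [hφ, hm x hx]
  have hint : ∀ {g : ℝ → ℝ}, ContDiff ℝ ∞ g → HasCompactSupport g →
      Integrable fun x => φ x * g x := fun hg hgc =>
    (hφsm.continuous.mul hg.continuous).integrable_of_hasCompactSupport hgc.mul_left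
  have hlow : (∫ x, |w x|) - 2 * m * ε ≤ (∫ x, φ x * b.pos x) - ∫ x, φ x * a.pos x := by
    rw [← integral_sub (hint hb.1 hb.2.1) (hint ha.1 ha.2.1)]
    have h1 : ∫ x, |w x| - (Set.Icc (-m) m).indicator (fun _ => ε) x ≤
        ∫ x, (φ x * b.pos x - φ x * a.pos x) := by
      refine integral_mono (hwint.abs.sub ((integrable_indicator_iff measurableSet_Icc).2
        (integrableOn_const (by simp)))) ((hint hb.1 hb.2.1).sub (hint ha.1 ha.2.1)) fun x => ?_
      simp only
      rw [← mul_sub]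
      by_cases hx : x ∈ Set.Icc (-m) m
      · rw [Set.indicator_of_mem hx]
        change _ ≤ φ x * w x
        simp only [hφ]
        rw [div_mul_eq_mul_div, le_div_iff₀ (Real.sqrt_pos.2 (hpos x)), ← abs_mul_abs_self (w x)]
        have h1 := (hsqrt x).1
        have h2 := (hsqrt x).2
        nlinarith [abs_nonneg (w x)]
      · have hxm : m ≤ |x| := by
          by_contra hlt
          exact hx (abs_le.1 (not_le.1 hlt).le)
        rw [Set.indicator_of_notMem hx, hm x hxm, hφm x hxm]
        simp
    rw [integral_sub hwint.abs ((integrable_indicator_iff measurableSet_Icc).2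
        (integrableOn_const (by simp))), integral_indicator measurableSet_Icc] at h1
    simp only [integral_const, MeasurableSet.univ, measureReal_restrict_apply, Set.univ_inter,
      smul_eq_mul, Real.volume_real_Icc] at h1
    rw [max_eq_left (by linarith)] at h1
    linarith
  refine (ENNReal.ofReal_le_ofReal (hlow.trans (le_abs_self _))).trans ?_
  refine le_mul_geodesicDist hc (fun v => hc₀.trans_le (hcc₀ v)) (by positivity) ?_
  rintro γ F ξ η O hO hO1 hfam rfl rfl
  exact hfam.ofReal_abs_integral_pos_sub_le hO hO1 hc₀ hcc₀ hκ hφsm hφ1 hm0 hφm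

/-- A cutoff function that is `1` on `[-m, m]` and has slope at most `1`. -/
theorem exists_cutoff (m : ℝ) : ∃ (χ : ℝ → ℝ) (m' : ℝ), ContDiff ℝ 1 χ ∧ (∀ x, |χ x| ≤ 1) ∧
    (∀ x, |deriv χ x| ≤ 1) ∧ (∀ x, |x| ≤ m → χ x = 1) ∧ 0 ≤ m' ∧ ∀ x, m' ≤ |x| → χ x = 0 := by
  let β : ContDiffBump (0 : ℝ) := ⟨1, 2, one_pos, one_lt_two⟩
  have hβ : ContDiff ℝ 1 β := β.contDiff
  obtain ⟨C, hC⟩ := (hβ.continuous_deriv le_rfl).bounded_above_of_compact_support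
    β.hasCompactSupport.deriv
  set n : ℝ := max (max C m) 1
  have hn0 : 0 < n := lt_of_lt_of_le one_pos (le_max_right _ _)
  refine ⟨fun x => β (x / n), 2 * n, hβ.comp (contDiff_id.div_const n), fun x => ?_, fun x => ?_,
    fun x hx => ?_, by positivity, fun x hx => ?_⟩
  · rw [abs_of_nonneg (β.nonneg)]
    exact β.le_one
  · have h1 : HasDerivAt (fun x => β (x / n)) (deriv β (x / n) * (1 / n)) x :=
      ((hβ.differentiable one_ne_zero _).hasDerivAt).comp x ((hasDerivAt_id x).div_const n)
    rw [h1.deriv, abs_mul, abs_of_pos (by positivity : 0 < 1 / n), mul_one_div]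
    exact div_le_one_of_le₀ ((hC _).trans ((le_max_left _ _).trans (le_max_left _ _))) hn0.le
  · refine β.one_of_mem_closedBall ?_
    rw [mem_closedBall_zero_iff, Real.norm_eq_abs, abs_div, abs_of_pos hn0]
    exact div_le_one_of_le₀ (hx.trans ((le_max_right _ _).trans (le_max_left _ _))) hn0.le
  · refine β.zero_of_le_dist ?_
    rw [dist_zero_right, Real.norm_eq_abs, abs_div, abs_of_pos hn0]
    exact (le_div_iff₀ hn0).2 hx

theorem WaveData.IsTest.exists_density_bound {a : WaveData} (ha : a.IsTest) (c : ℝ → ℝ) :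
    ∃ m : ℝ, ∀ x, m ≤ |x| → a.density c x = 0 := by
  obtain ⟨m₁, -, h1⟩ := exists_bound_of_hasCompactSupport ha.2.2.2
  obtain ⟨m₂, -, h2⟩ := exists_bound_of_hasCompactSupport ha.2.1.deriv
  refine ⟨max m₁ m₂, fun x hx => ?_⟩
  simp [density, h1 x ((le_max_left _ _).trans hx), h2 x ((le_max_right _ _).trans hx)]

/-- The estimate of the energy measures for test data; their densities have compact support, so that
the test function can be cut off. -/
theorem abs_integral_density_sub_le_of_isTest {c : ℝ → ℝ} (hc : ContDiff ℝ ∞ c)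
    (hc0 : ∀ v, 0 < c v) {κ : Fin 6 → ℝ} (hκ : ∀ l, 0 < κ l) {K : ℝ} {a b : WaveData}
    (ha : a.IsTest) (hb : b.IsTest) {f : ℝ → ℝ} (hf : ContDiff ℝ 1 f) (hf1 : ∀ x, |f x| ≤ 1)
    (hf2 : ∀ x, |deriv f x| ≤ 1) :
    ENNReal.ofReal |(∫ x, f x * a.density c x) - ∫ x, f x * b.density c x| ≤
      ENNReal.ofReal (1 / κ 0 + 1 / κ 5) * geodesicDist c κ K a b := by
  have hκ0 := hκ 0
  have hκ5 := hκ 5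
  obtain ⟨m₁, h1⟩ := ha.exists_density_bound c
  obtain ⟨m₂, h2⟩ := hb.exists_density_bound c
  obtain ⟨χ, m', hχ, hχ1, hχ2, hχm, hm', hχm'⟩ := exists_cutoff (max m₁ m₂)
  have hcut : ∀ d : WaveData, (∀ x, max m₁ m₂ ≤ |x| → d.density c x = 0) →
      ∫ x, f x * d.density c x = ∫ x, (f x * χ x) * d.density c x := by
    intro d hd
    refine integral_congr_ae (ae_of_all _ fun x => ?_)
    rcases le_total (max m₁ m₂) |x| with hx | hx
    · simp [hd x hx]
    · simp [hχm x hx]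
  rw [hcut a fun x hx => h1 x ((le_max_left _ _).trans hx),
    hcut b fun x hx => h2 x ((le_max_right _ _).trans hx), abs_sub_comm]
  refine le_mul_geodesicDist hc hc0 (by positivity) ?_
  rintro γ F ξ η O hO hO1 hfam rfl rfl
  refine hfam.ofReal_abs_integral_density_sub_le hO hO1 hκ (f := fun x => f x * χ x)
    (hf.mul hχ) (fun x => ?_) (fun x => ?_) hm' fun x hx => by simp [hχm' x hx]
  · rw [abs_mul]
    exact mul_le_one₀ (hf1 x) (abs_nonneg _) (hχ1 x)
  · have hd : HasDerivAt (fun x => f x * χ x) _ x :=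
      (hf.differentiable one_ne_zero x).hasDerivAt.mul (hχ.differentiable one_ne_zero x).hasDerivAt
    rw [hd.deriv]
    refine (abs_add_le _ _).trans ?_
    rw [abs_mul, abs_mul]
    have h3 := mul_le_one₀ (hf2 x) (abs_nonneg _) (hχ1 x)
    have h4 := mul_le_one₀ (hf1 x) (abs_nonneg _) (hχ2 x)
    linarith

/-! ### Limits of data in `H¹ × L²` -/

/-- The embedding of `H¹` into the bounded functions, by averaging over an interval of length one. -/
theorem enorm_le_eLpNorm_add_eLpNorm {w g : ℝ → ℝ} (hw : AEStronglyMeasurable w)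
    (hg : AEStronglyMeasurable g) (h : ∀ a b, w b - w a = ∫ y in a..b, g y) (x : ℝ) :
    ‖w x‖ₑ ≤ eLpNorm w 2 volume + eLpNorm g 2 volume := by
  have hprob : IsProbabilityMeasure (volume.restrict (Set.Ioc x (x + 1))) := ⟨by simp⟩
  have hL : ∀ {k : ℝ → ℝ}, AEStronglyMeasurable k →
      ∫⁻ y in Set.Ioc x (x + 1), ‖k y‖ₑ ≤ eLpNorm k 2 volume := fun hk => by
    rw [← eLpNorm_one_eq_lintegral_enorm]
    exact (eLpNorm_le_eLpNorm_of_exponent_le one_le_two hk.restrict).trans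
      (eLpNorm_restrict_le _ _ _ _)
  calc ‖w x‖ₑ = ∫⁻ _ in Set.Ioc x (x + 1), ‖w x‖ₑ := by simp
    _ ≤ ∫⁻ y in Set.Ioc x (x + 1), (‖w y‖ₑ + ∫⁻ z in Set.Ioc x (x + 1), ‖g z‖ₑ) := by
        refine setLIntegral_mono' measurableSet_Ioc fun y hy => ?_
        have h1 : w x = w y - ∫ z in x..y, g z := by rw [← h]; ring
        rw [h1]
        refine enorm_sub_le.trans (add_le_add le_rfl ?_)
        rw [intervalIntegral.integral_of_le hy.1.le]
        exact (enorm_integral_le_lintegral_enorm _).trans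
          (lintegral_mono_set (Set.Ioc_subset_Ioc_right hy.2))
    _ = (∫⁻ y in Set.Ioc x (x + 1), ‖w y‖ₑ) + ∫⁻ z in Set.Ioc x (x + 1), ‖g z‖ₑ := by
        rw [lintegral_add_left' hw.restrict.enorm]
        simp
    _ ≤ _ := add_le_add (hL hw) (hL hg)

/-- Strong convergence in `L²` gives convergence of the squares in `L¹`. -/
theorem tendsto_integral_mul_sq {f g : ℝ → ℝ} {G : ℕ → ℝ → ℝ} (hf : Continuous f)
    (hf1 : ∀ x, |f x| ≤ 1) (hg : MemLp g 2) (hG : ∀ᶠ n in atTop, MemLp (G n) 2)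
    (h : Tendsto (fun n => eLpNorm (fun x => G n x - g x) 2 volume) atTop (𝓝 0)) :
    Tendsto (fun n => ∫ x, f x * G n x ^ 2) atTop (𝓝 (∫ x, f x * g x ^ 2)) := by
  have hint : ∀ {k : ℝ → ℝ}, MemLp k 2 → Integrable fun x => f x * k x ^ 2 := fun hk =>
    hk.integrable_sq.bdd_mul hf.aestronglyMeasurable (ae_of_all _ hf1)
  refine tendsto_integral_of_L1' _ (hint hg).1 (hG.mono fun n hn => hint hn) ?_
  have hlim : Tendsto (fun n => eLpNorm (fun x => G n x - g x) 2 volume *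
      (eLpNorm (fun x => G n x - g x) 2 volume + eLpNorm (fun x => 2 * g x) 2 volume))
      atTop (𝓝 0) := by
    have hg2 : eLpNorm (fun x => 2 * g x) 2 volume ≠ ⊤ := (hg.const_mul 2).eLpNorm_ne_top
    have := ENNReal.Tendsto.mul h (Or.inr (by simpa using hg2))
      (h.add (tendsto_const_nhds (x := eLpNorm (fun x => 2 * g x) 2 volume)))
      (Or.inr ENNReal.zero_ne_top)
    simpa using this
  refine tendsto_of_tendsto_of_tendsto_of_le_of_le' tendsto_const_nhds hlim
    (Eventually.of_forall fun n => zero_le) (hG.mono fun n hn => ?_)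
  have hd : AEStronglyMeasurable (fun x => G n x - g x) := hn.1.sub hg.1
  have h2 : AEStronglyMeasurable (fun x => 2 * g x) := hg.1.const_mul 2
  calc eLpNorm ((fun x => f x * G n x ^ 2) - fun x => f x * g x ^ 2) 1 volume
      ≤ eLpNorm ((fun x => G n x - g x) • fun x => (G n x - g x) + 2 * g x) 1 volume := by
        refine eLpNorm_mono fun x => ?_
        simp only [Pi.sub_apply, Pi.smul_apply', smul_eq_mul, Real.norm_eq_abs]
        rw [← mul_sub, abs_mul, show (G n x - g x) * (G n x - g x + 2 * g x) =
          G n x ^ 2 - g x ^ 2 by ring]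
        exact mul_le_of_le_one_left (abs_nonneg _) (hf1 x)
    _ ≤ eLpNorm (fun x => G n x - g x) 2 volume *
        eLpNorm (fun x => (G n x - g x) + 2 * g x) 2 volume :=
        eLpNorm_smul_le_mul_eLpNorm (hd.add h2) hd
    _ ≤ _ := by
        gcongr
        exact eLpNorm_add_le hd h2 one_le_two

section

variable {c : ℝ → ℝ} {κ : Fin 6 → ℝ} {K : ℝ} {s : ℕ → WaveData} {a : WaveData}

/-- The distance of the profiles in `H¹` (the sum of the `L²` distances of the profiles and of
their derivatives). -/
def distH1 (a b : WaveData) : ENNReal :=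
  eLpNorm (fun x => a.pos x - b.pos x) 2 volume +
    eLpNorm (fun x => deriv a.pos x - deriv b.pos x) 2 volume

theorem enorm_pos_sub_le_distH1 {a b : WaveData} (ha : MemH1 a.pos) (hb : MemH1 b.pos) (x : ℝ) :
    ‖a.pos x - b.pos x‖ₑ ≤ distH1 a b := by
  have hint : ∀ {f : ℝ → ℝ}, MemH1 f → ∀ y z, IntervalIntegrable (deriv f) volume y z :=
    fun hf y z => ((hf.2.1.locallyIntegrable one_le_two).integrableOn_isCompact
      isCompact_uIcc).intervalIntegrable
  refine enorm_le_eLpNorm_add_eLpNorm (w := fun x => a.pos x - b.pos x)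
    (g := fun x => deriv a.pos x - deriv b.pos x) (ha.1.1.sub hb.1.1)
    (ha.2.1.1.sub hb.2.1.1) (fun y z => ?_) x
  rw [intervalIntegral.integral_sub (hint ha y z) (hint hb y z), ← ha.2.2, ← hb.2.2]
  ring

namespace Approximates

theorem tendsto_distH1 (h : Approximates c κ K s a) :
    Tendsto (fun n => distH1 (s n) a) atTop (𝓝 0) := by
  simpa [distH1] using h.pos_tendsto.add h.deriv_tendsto

theorem tendsto_pos (h : Approximates c κ K s a) (ha : MemH1 a.pos) (x : ℝ) :
    Tendsto (fun n => (s n).pos x) atTop (𝓝 (a.pos x)) := by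
  rw [tendsto_iff_edist_tendsto_0]
  refine tendsto_of_tendsto_of_tendsto_of_le_of_le tendsto_const_nhds h.tendsto_distH1
    (fun n => zero_le) fun n => ?_
  simp only
  rw [edist_eq_enorm_sub]
  exact enorm_pos_sub_le_distH1 (h.mem n).1.1 ha x

/-- `c(u) uₓ` converges in `L²`: the profiles converge uniformly, hence remain in an interval on
which `c` is bounded and Lipschitz continuous. -/
theorem tendsto_speed_mul_deriv (h : Approximates c κ K s a) (hc : ContDiff ℝ ∞ c)
    (ha : MemH1 a.pos) :
    (∀ᶠ n in atTop, MemLp (fun x => c ((s n).pos x) * deriv (s n).pos x) 2) ∧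
      MemLp (fun x => c (a.pos x) * deriv a.pos x) 2 ∧
      Tendsto (fun n => eLpNorm (fun x => c ((s n).pos x) * deriv (s n).pos x -
        c (a.pos x) * deriv a.pos x) 2 volume) atTop (𝓝 0) := by
  obtain ⟨B, hB⟩ : ∃ B : ℝ, ∀ x, |a.pos x| ≤ B := by
    have hfin : eLpNorm a.pos 2 volume + eLpNorm (deriv a.pos) 2 volume ≠ ⊤ :=
      ENNReal.add_ne_top.2 ⟨ha.1.eLpNorm_ne_top, ha.2.1.eLpNorm_ne_top⟩
    refine ⟨(eLpNorm a.pos 2 volume + eLpNorm (deriv a.pos) 2 volume).toReal, fun x => ?_⟩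
    have h1 := enorm_le_eLpNorm_add_eLpNorm ha.1.1 ha.2.1.1 ha.2.2 x
    rw [Real.enorm_eq_ofReal_abs] at h1
    exact (ENNReal.ofReal_le_iff_le_toReal hfin).1 h1
  set I : Set ℝ := Set.Icc (-(B + 1)) (B + 1)
  obtain ⟨C, hC⟩ := isCompact_Icc.exists_bound_of_continuousOn (s := I) hc.continuous.continuousOn
  obtain ⟨M, hM⟩ := hc.contDiffOn.exists_lipschitzOnWith (s := I) (by simp) (convex_Icc _ _)
    isCompact_Icc
  have haI : ∀ x, a.pos x ∈ I := fun x => abs_le.1 ((hB x).trans (by linarith))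
  have hsI : ∀ᶠ n in atTop, ∀ x, (s n).pos x ∈ I := by
    filter_upwards [h.tendsto_distH1.eventually_le_const zero_lt_one] with n hn x
    have h1 := (enorm_pos_sub_le_distH1 (h.mem n).1.1 ha x).trans hn
    rw [Real.enorm_eq_ofReal_abs, ENNReal.ofReal_le_one] at h1
    refine abs_le.1 ?_
    have h2 := abs_add_le ((s n).pos x - a.pos x) (a.pos x)
    rw [sub_add_cancel] at h2
    linarith [hB x]
  have hmeas : ∀ {d : WaveData}, MemH1 d.pos → AEStronglyMeasurable fun x => c (d.pos x) :=
    fun hd => hc.continuous.comp_aestronglyMeasurable hd.1.1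
  have hmem : ∀ {d : WaveData}, MemH1 d.pos → (∀ x, d.pos x ∈ I) →
      MemLp (fun x => c (d.pos x) * deriv d.pos x) 2 := fun {d} hd hdI => by
    refine hd.2.1.of_le_mul (c := C) ((hmeas hd).mul hd.2.1.1) (ae_of_all _ fun x => ?_)
    rw [norm_mul]
    exact mul_le_mul_of_nonneg_right (hC _ (hdI x)) (norm_nonneg _)
  refine ⟨hsI.mono fun n hn => hmem (h.mem n).1.1 hn, hmem ha haI, ?_⟩
  have hlim : Tendsto (fun n => ENNReal.ofReal C *
      eLpNorm (fun x => deriv (s n).pos x - deriv a.pos x) 2 volume +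
        ENNReal.ofReal (M * (distH1 (s n) a).toReal) * eLpNorm (deriv a.pos) 2 volume)
      atTop (𝓝 0) := by
    have h1 := ENNReal.Tendsto.const_mul (a := ENNReal.ofReal C) h.deriv_tendsto
      (Or.inr ENNReal.ofReal_ne_top)
    have h2 : Tendsto (fun n => ENNReal.ofReal (M * (distH1 (s n) a).toReal)) atTop (𝓝 0) := by
      have := ENNReal.tendsto_ofReal
        (((ENNReal.tendsto_toReal ENNReal.zero_ne_top).comp h.tendsto_distH1).const_mul (M : ℝ))
      simpa using this
    have h3 := ENNReal.Tendsto.mul_const (b := eLpNorm (deriv a.pos) 2 volume) h2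
      (Or.inr ha.2.1.eLpNorm_ne_top)
    simpa using h1.add h3
  refine tendsto_of_tendsto_of_tendsto_of_le_of_le' tendsto_const_nhds hlim
    (Eventually.of_forall fun n => zero_le) ?_
  filter_upwards [hsI, h.tendsto_distH1.eventually_lt_const ENNReal.zero_lt_top] with n hn hfin
  have hs := (h.mem n).1.1
  calc eLpNorm (fun x => c ((s n).pos x) * deriv (s n).pos x - c (a.pos x) * deriv a.pos x) 2 volume
      = eLpNorm ((fun x => c ((s n).pos x) * (deriv (s n).pos x - deriv a.pos x)) +
          fun x => (c ((s n).pos x) - c (a.pos x)) * deriv a.pos x) 2 volume := by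
        congr 1
        funext x
        simp only [Pi.add_apply]
        ring
    _ ≤ _ := eLpNorm_add_le ((hmeas hs).mul (hs.2.1.1.sub ha.2.1.1))
        (((hmeas hs).sub (hmeas ha)).mul ha.2.1.1) one_le_two
    _ ≤ _ := by
        refine add_le_add (eLpNorm_le_mul_eLpNorm_of_ae_le_mul (ae_of_all _ fun x => ?_) _)
          (eLpNorm_le_mul_eLpNorm_of_ae_le_mul (ae_of_all _ fun x => ?_) _)
        · rw [norm_mul]
          exact mul_le_mul_of_nonneg_right (hC _ (hn x)) (norm_nonneg _)
        · rw [norm_mul]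
          refine mul_le_mul_of_nonneg_right ?_ (norm_nonneg _)
          rw [← dist_eq_norm]
          refine (hM.dist_le_mul _ (hn x) _ (haI x)).trans
            (mul_le_mul_of_nonneg_left ?_ M.coe_nonneg)
          have h1 := enorm_pos_sub_le_distH1 hs ha x
          rw [Real.enorm_eq_ofReal_abs] at h1
          exact (ENNReal.ofReal_le_iff_le_toReal hfin.ne).1 h1

theorem tendsto_integral_density (h : Approximates c κ K s a) (hc : ContDiff ℝ ∞ c)
    (ha : a.Admissible) {f : ℝ → ℝ} (hf : Continuous f) (hf1 : ∀ x, |f x| ≤ 1) :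
    Tendsto (fun n => ∫ x, f x * (s n).density c x) atTop (𝓝 (∫ x, f x * a.density c x)) := by
  obtain ⟨h1, h2, h3⟩ := h.tendsto_speed_mul_deriv hc ha.1
  have hint : ∀ {k : ℝ → ℝ}, MemLp k 2 → Integrable fun x => f x * k x ^ 2 := fun hk =>
    hk.integrable_sq.bdd_mul hf.aestronglyMeasurable (ae_of_all _ hf1)
  have hsplit : ∀ {d : WaveData}, MemLp d.vel 2 →
      MemLp (fun x => c (d.pos x) * deriv d.pos x) 2 → ∫ x, f x * d.density c x =
        (∫ x, f x * d.vel x ^ 2) + ∫ x, f x * (c (d.pos x) * deriv d.pos x) ^ 2 :=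
    fun hv hd => by
      rw [← integral_add (hint hv) (hint hd)]
      congr 1
      funext x
      unfold WaveData.density
      ring
  rw [hsplit ha.2 h2]
  refine ((tendsto_integral_mul_sq hf hf1 ha.2 (Eventually.of_forall fun n => (h.mem n).1.2)
    h.vel_tendsto).add (tendsto_integral_mul_sq hf hf1 h2 h1 h3)).congr' ?_
  exact h1.mono fun n hn => (hsplit (h.mem n).1.2 hn).symm

end Approximates

end

/-! ### The two estimates -/

/-- A quantity that is a lower limit along approximating sequences is bounded by `d*` as soon as
it is bounded by the geodesic distance for test data. -/
theorem le_mul_dStar {c : ℝ → ℝ} {κ : Fin 6 → ℝ} {K : ℝ} {a b : WaveData}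
    (V : WaveData → WaveData → ENNReal) {C : ℝ} (hC : 0 < C)
    (hlim : ∀ s s' : ℕ → WaveData, Approximates c κ K s a → Approximates c κ K s' b →
      V a b ≤ liminf (fun n => V (s n) (s' n)) atTop)
    (hV : ∀ d d' : WaveData, d.IsTest → d'.IsTest →
      V d d' ≤ ENNReal.ofReal C * geodesicDist c κ K d d') :
    V a b ≤ ENNReal.ofReal C * dStar c κ K a b := by
  have hC0 : ENNReal.ofReal C ≠ 0 := (ENNReal.ofReal_pos.2 hC).ne'
  have hCt : ENNReal.ofReal C ≠ ⊤ := ENNReal.ofReal_ne_top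
  rw [mul_comm, ← ENNReal.div_le_iff_le_mul (Or.inl hC0) (Or.inl hCt)]
  simp only [dStar, le_iInf_iff]
  intro s s' hs hs'
  rw [ENNReal.div_le_iff_le_mul (Or.inl hC0) (Or.inl hCt), mul_comm,
    ← ENNReal.liminf_const_mul_of_ne_top hCt]
  exact (hlim s s' hs hs').trans (liminf_le_liminf
    (Eventually.of_forall fun n => hV _ _ (hs.test n) (hs'.test n)))

theorem eLpNorm_pos_sub_le_mul_dStar {c : ℝ → ℝ} (hc : ContDiff ℝ ∞ c) {c₀ : ℝ} (hc₀ : 0 < c₀)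
    (hcc₀ : ∀ v, c₀ ≤ c v) {κ : Fin 6 → ℝ} (hκ : ∀ l, 0 < κ l) {K : ℝ} {a b : WaveData}
    (ha : MemH1 a.pos) (hb : MemH1 b.pos) :
    eLpNorm (fun x => a.pos x - b.pos x) 1 volume ≤
      ENNReal.ofReal (1 / κ 2 + 1 / (4 * c₀) * (1 / κ 0)) * dStar c κ K a b := by
  have hκ0 := hκ 0
  have hκ2 := hκ 2
  refine le_mul_dStar (fun d d' => eLpNorm (fun x => d.pos x - d'.pos x) 1 volume) (by positivity)
    (fun s s' hs hs' => ?_) fun d d' hd hd' => eLpNorm_pos_sub_le_of_isTest hc hc₀ hcc₀ hκ hd hd'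
  exact Lp.eLpNorm_lim_le_liminf_eLpNorm
    (fun n => (hs.mem n).1.1.1.1.sub (hs'.mem n).1.1.1.1) _
    (ae_of_all _ fun x => (hs.tendsto_pos ha x).sub (hs'.tendsto_pos hb x))

theorem integral_energyMeasure {c : ℝ → ℝ} (hc : Continuous c) {a : WaveData} (ha : a.Admissible)
    (f : ℝ → ℝ) : ∫ x, f x ∂energyMeasure c a = ∫ x, f x * a.density c x := by
  have hm := (ha.aestronglyMeasurable hc).2.2.aemeasurable.ennreal_ofReal
  refine (integral_withDensity_eq_integral_toReal_smul₀ hm (ae_of_all _ fun x => by simp) f).trans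
    (integral_congr_ae (ae_of_all _ fun x => ?_))
  simp only [ENNReal.toReal_ofReal (a.density_nonneg c x), smul_eq_mul, mul_comm]

theorem dualC1Dist_energyMeasure_le_mul_dStar {c : ℝ → ℝ} (hc : ContDiff ℝ ∞ c)
    (hc0 : ∀ v, 0 < c v) {κ : Fin 6 → ℝ} (hκ : ∀ l, 0 < κ l) {K : ℝ} {a b : WaveData}
    (ha : a.Admissible) (hb : b.Admissible) :
    dualC1Dist (energyMeasure c a) (energyMeasure c b) ≤
      ENNReal.ofReal (1 / κ 0 + 1 / κ 5) * dStar c κ K a b := by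
  have hκ0 := hκ 0
  have hκ5 := hκ 5
  refine iSup₂_le fun f hf => iSup₂_le fun hf1 hf2 => ?_
  rw [integral_energyMeasure hc.continuous ha, integral_energyMeasure hc.continuous hb]
  refine le_mul_dStar (fun d d' => ENNReal.ofReal
      |(∫ x, f x * d.density c x) - ∫ x, f x * d'.density c x|) (by positivity)
    (fun s s' hs hs' => ?_)
    fun d d' hd hd' => abs_integral_density_sub_le_of_isTest hc hc0 hκ hd hd' hf hf1 hf2
  exact (ENNReal.tendsto_ofReal ((hs.tendsto_integral_density hc ha hf.continuous hf1).sub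
    (hs'.tendsto_integral_density hc hb hf.continuous hf1)).abs).liminf_eq.ge

end VarWave

end

theorem proposition3 (c : ℝ → ℝ) (hc : ContDiff ℝ ∞ c) (c₀ : ℝ) (hc₀ : 0 < c₀)
    (hcc₀ : ∀ v : ℝ, c₀ ≤ c v) (κ : Fin 6 → ℝ) (hκ : ∀ l, 0 < κ l) (K : ℝ) (hK : 0 < K) :
    ∃ δ₀ : ℝ, 0 < δ₀ ∧ ∀ a b : VarWave.WaveData,
      VarWave.MemH1 a.pos → MeasureTheory.MemLp a.pos 1 MeasureTheory.volume →
      MeasureTheory.MemLp a.vel 2 MeasureTheory.volume →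
      VarWave.MemH1 b.pos → MeasureTheory.MemLp b.pos 1 MeasureTheory.volume →
      MeasureTheory.MemLp b.vel 2 MeasureTheory.volume →
      VarWave.energy c a ≤ ENNReal.ofReal K → VarWave.energy c b ≤ ENNReal.ofReal K →
      MeasureTheory.eLpNorm (fun x => a.pos x - b.pos x) 1 MeasureTheory.volume
          ≤ ENNReal.ofReal δ₀ * VarWave.dStar c κ K a b ∧
        VarWave.dualC1Dist (VarWave.energyMeasure c a) (VarWave.energyMeasure c b)
          ≤ ENNReal.ofReal δ₀ * VarWave.dStar c κ K a b := by
  have hκ0 := hκ 0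
  have hκ2 := hκ 2
  have hκ5 := hκ 5
  refine ⟨(1 / κ 2 + 1 / (4 * c₀) * (1 / κ 0)) + (1 / κ 0 + 1 / κ 5), by positivity, ?_⟩
  intro a b ha _ hav hb _ hbv _ _
  refine ⟨(VarWave.eLpNorm_pos_sub_le_mul_dStar (K := K) hc hc₀ hcc₀ hκ ha hb).trans ?_,
    (VarWave.dualC1Dist_energyMeasure_le_mul_dStar (K := K) hc
      (fun v => hc₀.trans_le (hcc₀ v)) hκ
      ⟨ha, hav⟩ ⟨hb, hbv⟩).trans ?_⟩
  · exact mul_le_mul' (ENNReal.ofReal_le_ofReal (le_add_of_nonneg_right (by positivity))) le_rfl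
  · exact mul_le_mul' (ENNReal.ofReal_le_ofReal (le_add_of_nonneg_left (by positivity))) le_rfl
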